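/- Let $m\ge 2$ and $n\ge 0$ be integers, let $q$ be an indeterminate, and let $a$ be a non-zero complex number. Write $[k]=\frac{q^k-q^{-k}}{q-q^{-1}}$. **Algebras.** For a generalized Cartan matrix $(a_{ij})$ that is symmetric with off-diagonal entries in $\{0,-1,-2\}$, consider the (non-unital) $\mathbb C(q)$-algebra generated by $\mathbf 1_\lambda$, $E_i\mathbf 1_\lambda$, $F_i\mathbf 1_\lambda$, where $\lambda$ runs through all integer tuples indexed by the nodes and $\alpha_i=(a_{ji})_j$, with relations $\mathbf 1_\lambda\mathbf 1_{\lambda'}=\delta_{\lambda\lambda'}\mathbf 1_\lambda$, $E_i\mathbf 1_\lambda=\mathbf 1_{\lambda+\alpha_i}E_i\mathbf 1_\lambda$, $F_i\mathbf 1_\lambda=\mathbf 1_{\lambda-\alpha_i}F_i\mathbf 1_\lambda$, $(E_iF_j-F_jE_i)\mathbf 1_\lambda=\delta_{ij}[\lambda_i]\mathbf 1_\lambda$, and the quantum Serre relations among the $E$'s and among the $F$'s: $X_iX_j=X_jX_i$ if $a_{ij}=0$; $X_i^2X_j-[2]X_iX_jX_i+X_jX_i^2=0$ if $a_{ij}=-1$;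 $X_i^3X_j-[3]X_i^2X_jX_i+[3]X_iX_jX_i^2-X_jX_i^3=0$ if $a_{ij}=-2$. For the Cartan matrix of $\mathfrak{sl}_m$ (nodes $1,\dots,m-1$) this is $\dot{\mathbf U}_q(\mathfrak{sl}_m)$; for the cyclic Cartan matrix $A^{(1)}_{m-1}$ (nodes $0,\dots,m-1$; for $m=2$ the off-diagonal entries are $-2$) it is $\dot{\mathbf U}'_q(\widehat{\mathfrak{sl}}_m)$. **Module.** Let $\bigwedge_q(\mathbb C^n\otimes\mathbb C^m)$ be the $\mathbb C(q)$-algebra generated by $z_{ij}$ ($1\le i\le n$, $1\le j\le m$) with relations $z_{ij}^2=0$; $z_{ij}z_{il}=-q^{-1}z_{il}z_{ij}$ for $j<l$; $z_{ij}z_{kj}=-q^{-1}z_{kj}z_{ij}$ for $i<k$; and, for $i<k$, $j<l$, $z_{ij}z_{kl}=-z_{kl}z_{ij}$ and $z_{il}z_{kj}=-z_{kj}z_{il}+(q-q^{-1})z_{kl}z_{ij}$. It is graded by multidegrees $(a_1,\dots,a_m)$, where $a_j$ counts the generators $z_{*j}$. Let $E_j,F_j$ ($1\le j\le m-1$) be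 the operators with $E_jz_{ij}=z_{i,j+1}$, $F_jz_{i,j+1}=z_{ij}$, all other generators being sent to $0$, and $E_j(xy)=x\,E_j(y)+E_j(x)K_j(y)$, $F_j(xy)=K_j^{-1}(x)F_j(y)+F_j(x)y$, where $K_j$ acts by $q^{a_{j+1}-a_j}$ in multidegree $(a_1,\dots,a_m)$. Letting $\mathbf 1_\lambda$ act as the projection onto the sum of the components with $(a_2-a_1,\dots,a_m-a_{m-1})=\lambda$ makes it a $\dot{\mathbf U}_q(\mathfrak{sl}_m)$-module. **Braid operators.** On the weight space of weight $\lambda$ put $$T''_i=\sum_{x-y+z=-\lambda_i}(-1)^yq^{\,y-xz}E_i^{(x)}F_i^{(y)}E_i^{(z)}\qquad(x,y,z\ge 0),$$ with divided powers $X^{(k)}=X^k/([1]\cdots[k])$, and let $T_i=(-1)^{-a_{i+1}}q^{-a_{i+1}}T''_i$ on the component of multidegree $(a_1,\dots,a_m)$. The operators $T''_i$ and $T_i$ are invertible; for an invertible operator $T$ write $C_T(X)=TXT^{-1}$. **Proposition.** The action of $\dot{\mathbf U}_q(\mathfrak{sl}_m)$ on $\bigwedge_q(\mathbb C^n\otimes\mathbb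 C^m)$ extends to an action of $\dot{\mathbf U}'_q(\widehat{\mathfrak{sl}}_m)$ via $\rho_a$, as follows. For $\lambda=(\lambda_0,\dots,\lambda_{m-1})$ with $\sum_i\lambda_i=0$, the elements $\mathbf 1_\lambda$, $E_i\mathbf 1_\lambda$, $F_i\mathbf 1_\lambda$ ($i\ne 0$) act as those of weight $(\lambda_1,\dots,\lambda_{m-1})$ in $\dot{\mathbf U}_q(\mathfrak{sl}_m)$; if $\sum_i\lambda_i\neq 0$ then $\mathbf 1_\lambda$ acts as $0$; and, on the component of multidegree $(a_1,\dots,a_m)$, $$E_0\mathbf 1_\lambda\mapsto a\,q^{-(a_1+a_m)}\,C_{T''_{m-1}}\cdots C_{T''_2}(F_1)\,\mathbf 1_\lambda,\qquad F_0\mathbf 1_\lambda\mapsto a^{-1}q^{a_1+a_m}\,C_{T''_{m-1}}\cdots C_{T''_2}(E_1)\,\mathbf 1_\lambda .$$ Likewise the action extends via $\tilde\rho_a$, given by the same formulas with every $T''_i$ replaced by $T_i$. Moreover, all these actions preserve the form of $\bigwedge_q(\mathbb C^n\otimes\mathbb C^m)$ over $\mathbb C[q,q^{-1}]$, i.e.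 the $\mathbb C[q,q^{-1}]$-subalgebra generated by the $z_{ij}$, so that they restrict to it. -/

import Mathlib

noncomputable section

namespace SkewHowe

/-! ### Idempotented quantum groups -/

/-- The quantum integer `[k] = (q ^ k - q ^ (-k)) / (q - q⁻¹)`. -/
def qInt {K : Type*} [Field K] (q : Kˣ) (k : ℤ) : K :=
  (((q ^ k : Kˣ) : K) - ((q ^ (-k) : Kˣ) : K)) / ((q : K) - ((q⁻¹ : Kˣ) : K))

/-- The quantum factorial `[k]! = [1][2]⋯[k]`. -/
def qFact {K : Type*} [Field K] (q : Kˣ) (k : ℕ) : K :=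
  ∏ j ∈ Finset.range k, qInt q ((j : ℤ) + 1)

/-- The Cartan matrix of `sl_{r+1}`; its nodes are numbered `0, …, r-1`. -/
def cartanSl (r : ℕ) (i j : Fin r) : ℤ :=
  if i = j then 2 else if (i : ℕ) + 1 = j ∨ (j : ℕ) + 1 = i then -1 else 0

/-- The Cartan matrix of affine `sl_{r+1}`, `r ≥ 1`: a cycle with nodes `0, …, r`. Addition in
`Fin (r + 1)` is modulo `r + 1`. For `r = 1` the off-diagonal entries are `-2`. -/
def cartanAff (r : ℕ) (i j : Fin (r + 1)) : ℤ :=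
  if i = j then 2 else -((if j = i + 1 then 1 else 0) + (if i = j + 1 then 1 else 0))

/-- Generators of the idempotented quantum group: `1_λ`, `E_i 1_λ` and `F_i 1_λ`. -/
inductive DotGen (ι : Type) : Type
  | one (l : ι → ℤ)
  | E (i : ι) (l : ι → ℤ)
  | F (i : ι) (l : ι → ℤ)

section Dot

variable {K : Type*} [Field K] {ι : Type}

/-- The simple root `α_i` as a weight, `(α_i)_j = A j i`. -/
def simpleRoot (A : ι → ι → ℤ) (i : ι) : ι → ℤ := fun j => A j i

/-- The word `E_{i₁} ⋯ E_{i_k} 1_λ` in the free algebra on the generators. -/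
def wordE (K : Type*) [Field K] (A : ι → ι → ℤ) (l : ι → ℤ) :
    List ι → FreeAlgebra K (DotGen ι)
  | [] => FreeAlgebra.ι K (DotGen.one l)
  | i :: w => FreeAlgebra.ι K (DotGen.E i (l + (w.map (simpleRoot A)).sum)) * wordE K A l w

/-- The word `F_{i₁} ⋯ F_{i_k} 1_λ` in the free algebra on the generators. -/
def wordF (K : Type*) [Field K] (A : ι → ι → ℤ) (l : ι → ℤ) :
    List ι → FreeAlgebra K (DotGen ι)
  | [] => FreeAlgebra.ι K (DotGen.one l)
  | i :: w => FreeAlgebra.ι K (DotGen.F i (l - (w.map (simpleRoot A)).sum)) * wordF K A l w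

/-- The defining relations of the idempotented quantum group with Cartan matrix `A`, whose
off-diagonal entries lie in `{0, -1, -2}`. -/
inductive DotRel (q : Kˣ) (A : ι → ι → ℤ) :
    FreeAlgebra K (DotGen ι) → FreeAlgebra K (DotGen ι) → Prop
  | one_mul_one (l : ι → ℤ) :
      DotRel q A (FreeAlgebra.ι K (.one l) * FreeAlgebra.ι K (.one l)) (FreeAlgebra.ι K (.one l))
  | one_mul_one_of_ne {l l' : ι → ℤ} (h : l ≠ l') :
      DotRel q A (FreeAlgebra.ι K (.one l) * FreeAlgebra.ι K (.one l')) 0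
  | E_mul_one (i : ι) (l : ι → ℤ) :
      DotRel q A (FreeAlgebra.ι K (.E i l) * FreeAlgebra.ι K (.one l)) (FreeAlgebra.ι K (.E i l))
  | one_mul_E (i : ι) (l : ι → ℤ) :
      DotRel q A (FreeAlgebra.ι K (.one (l + simpleRoot A i)) * FreeAlgebra.ι K (.E i l))
        (FreeAlgebra.ι K (.E i l))
  | F_mul_one (i : ι) (l : ι → ℤ) :
      DotRel q A (FreeAlgebra.ι K (.F i l) * FreeAlgebra.ι K (.one l)) (FreeAlgebra.ι K (.F i l))
  | one_mul_F (i : ι) (l : ι → ℤ) :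
      DotRel q A (FreeAlgebra.ι K (.one (l - simpleRoot A i)) * FreeAlgebra.ι K (.F i l))
        (FreeAlgebra.ι K (.F i l))
  | commutator_self (i : ι) (l : ι → ℤ) :
      DotRel q A
        (FreeAlgebra.ι K (.E i (l - simpleRoot A i)) * FreeAlgebra.ι K (.F i l)
          - FreeAlgebra.ι K (.F i (l + simpleRoot A i)) * FreeAlgebra.ι K (.E i l))
        (qInt q (l i) • FreeAlgebra.ι K (.one l))
  | commutator_of_ne {i j : ι} (h : i ≠ j) (l : ι → ℤ) :
      DotRel q A
        (FreeAlgebra.ι K (.E i (l - simpleRoot A j)) * FreeAlgebra.ι K (.F j l)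
          - FreeAlgebra.ι K (.F j (l + simpleRoot A i)) * FreeAlgebra.ι K (.E i l)) 0
  | commE {i j : ι} (h : A i j = 0) (l : ι → ℤ) :
      DotRel q A (wordE K A l [i, j]) (wordE K A l [j, i])
  | commF {i j : ι} (h : A i j = 0) (l : ι → ℤ) :
      DotRel q A (wordF K A l [i, j]) (wordF K A l [j, i])
  | serreE {i j : ι} (h : A i j = -1) (l : ι → ℤ) :
      DotRel q A
        (wordE K A l [i, i, j] - qInt q 2 • wordE K A l [i, j, i] + wordE K A l [j, i, i]) 0
  | serreF {i j : ι} (h : A i j = -1) (l : ι → ℤ) :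
      DotRel q A
        (wordF K A l [i, i, j] - qInt q 2 • wordF K A l [i, j, i] + wordF K A l [j, i, i]) 0
  | serreE' {i j : ι} (h : A i j = -2) (l : ι → ℤ) :
      DotRel q A
        (wordE K A l [i, i, i, j] - qInt q 3 • wordE K A l [i, i, j, i]
          + qInt q 3 • wordE K A l [i, j, i, i] - wordE K A l [j, i, i, i]) 0
  | serreF' {i j : ι} (h : A i j = -2) (l : ι → ℤ) :
      DotRel q A
        (wordF K A l [i, i, i, j] - qInt q 3 • wordF K A l [i, i, j, i]
          + qInt q 3 • wordF K A l [i, j, i, i] - wordF K A l [j, i, i, i]) 0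

/-- The idempotented quantum group with Cartan matrix `A`, as a non-unital algebra: the span of
all non-empty products of the generators in the algebra presented by `DotRel` (the latter is
obtained from it by adjoining a unit). -/
def Dot (q : Kˣ) (A : ι → ι → ℤ) : NonUnitalSubalgebra K (RingQuot (DotRel q A)) :=
  NonUnitalAlgebra.adjoin K
    (Set.range fun g : DotGen ι => RingQuot.mkAlgHom K (DotRel q A) (FreeAlgebra.ι K g))

/-- A generator as an element of the idempotented quantum group. -/
def Dot.gen (q : Kˣ) (A : ι → ι → ℤ) (g : DotGen ι) : Dot q A :=
  ⟨RingQuot.mkAlgHom K (DotRel q A) (FreeAlgebra.ι K g),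
    NonUnitalAlgebra.subset_adjoin K (Set.mem_range_self g)⟩

/-- The idempotent `1_λ`. -/
abbrev Dot.one (q : Kˣ) (A : ι → ι → ℤ) (l : ι → ℤ) : Dot q A := Dot.gen q A (.one l)

/-- The generator `E_i 1_λ`. -/
abbrev Dot.E (q : Kˣ) (A : ι → ι → ℤ) (i : ι) (l : ι → ℤ) : Dot q A := Dot.gen q A (.E i l)

/-- The generator `F_i 1_λ`. -/
abbrev Dot.F (q : Kˣ) (A : ι → ι → ℤ) (i : ι) (l : ι → ℤ) : Dot q A := Dot.gen q A (.F i l)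

end Dot

/-! ### The quantum exterior algebra -/

section Ext

variable {K : Type*} [Field K] (q : Kˣ) (n m : ℕ)

/-- The skew-commutation relations among the generators `z_{ij}`. Each row and each column of
generators satisfies the relations `X_i X_j = - q⁻¹ X_j X_i` for `i < j`, `X_i ^ 2 = 0`. -/
inductive ExtRel :
    FreeAlgebra K (Fin n × Fin m) → FreeAlgebra K (Fin n × Fin m) → Prop
  | sq (i : Fin n) (j : Fin m) :
      ExtRel (FreeAlgebra.ι K (i, j) * FreeAlgebra.ι K (i, j)) 0
  | row (i : Fin n) {j l : Fin m} (h : j < l) :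
      ExtRel (FreeAlgebra.ι K (i, j) * FreeAlgebra.ι K (i, l))
        (-(((q⁻¹ : Kˣ) : K) • (FreeAlgebra.ι K (i, l) * FreeAlgebra.ι K (i, j))))
  | col {i k : Fin n} (h : i < k) (j : Fin m) :
      ExtRel (FreeAlgebra.ι K (i, j) * FreeAlgebra.ι K (k, j))
        (-(((q⁻¹ : Kˣ) : K) • (FreeAlgebra.ι K (k, j) * FreeAlgebra.ι K (i, j))))
  | main {i k : Fin n} (h : i < k) {j l : Fin m} (h' : j < l) :
      ExtRel (FreeAlgebra.ι K (i, j) * FreeAlgebra.ι K (k, l))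
        (-(FreeAlgebra.ι K (k, l) * FreeAlgebra.ι K (i, j)))
  | anti {i k : Fin n} (h : i < k) {j l : Fin m} (h' : j < l) :
      ExtRel (FreeAlgebra.ι K (i, l) * FreeAlgebra.ι K (k, j))
        (-(FreeAlgebra.ι K (k, j) * FreeAlgebra.ι K (i, l))
          + ((q : K) - ((q⁻¹ : Kˣ) : K)) • (FreeAlgebra.ι K (k, l) * FreeAlgebra.ι K (i, j)))

/-- The quantum exterior algebra `⋀_q(ℂ^n ⊗ ℂ^m)`. -/
def QExt : Type _ := RingQuot (ExtRel q n m)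

instance : Ring (QExt q n m) := inferInstanceAs (Ring (RingQuot (ExtRel q n m)))

instance : Algebra K (QExt q n m) := inferInstanceAs (Algebra K (RingQuot (ExtRel q n m)))

variable {n m}

/-- The generator `z_{ij}`. -/
def z (i : Fin n) (j : Fin m) : QExt q n m :=
  RingQuot.mkAlgHom K (ExtRel q n m) (FreeAlgebra.ι K (i, j))

theorem z_sq (i : Fin n) (j : Fin m) : z q i j * z q i j = 0 := by
  have := RingQuot.mkAlgHom_rel K (ExtRel.sq (q := q) i j)
  rw [map_mul, map_zero] at this
  exact this

theorem z_row (i : Fin n) {j l : Fin m} (h : j < l) :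
    z q i j * z q i l = -(((q⁻¹ : Kˣ) : K) • (z q i l * z q i j)) := by
  have := RingQuot.mkAlgHom_rel K (ExtRel.row (q := q) i h)
  rw [map_mul, map_neg, map_smul, map_mul] at this
  exact this

theorem z_col {i k : Fin n} (h : i < k) (j : Fin m) :
    z q i j * z q k j = -(((q⁻¹ : Kˣ) : K) • (z q k j * z q i j)) := by
  have := RingQuot.mkAlgHom_rel K (ExtRel.col (q := q) h j)
  rw [map_mul, map_neg, map_smul, map_mul] at this
  exact this

theorem z_main {i k : Fin n} (h : i < k) {j l : Fin m} (h' : j < l) :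
    z q i j * z q k l = -(z q k l * z q i j) := by
  have := RingQuot.mkAlgHom_rel K (ExtRel.main (q := q) h h')
  rw [map_mul, map_neg, map_mul] at this
  exact this

theorem z_anti {i k : Fin n} (h : i < k) {j l : Fin m} (h' : j < l) :
    z q i l * z q k j = -(z q k j * z q i l)
      + ((q : K) - ((q⁻¹ : Kˣ) : K)) • (z q k l * z q i j) := by
  have := RingQuot.mkAlgHom_rel K (ExtRel.anti (q := q) h h')
  rw [map_mul, map_add, map_neg, map_smul, map_mul, map_mul] at this
  exact this

/-- An algebra morphism out of the quantum exterior algebra, given by its values on the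
generators. -/
def extLift {B : Type*} [Ring B] [Algebra K B] (f : Fin n → Fin m → B)
    (hsq : ∀ i j, f i j * f i j = 0)
    (hrow : ∀ i j l, j < l → f i j * f i l = -(((q⁻¹ : Kˣ) : K) • (f i l * f i j)))
    (hcol : ∀ i k j, i < k → f i j * f k j = -(((q⁻¹ : Kˣ) : K) • (f k j * f i j)))
    (hmain : ∀ i k j l, i < k → j < l → f i j * f k l = -(f k l * f i j))
    (hanti : ∀ i k j l, i < k → j < l → f i l * f k j = -(f k j * f i l)
      + ((q : K) - ((q⁻¹ : Kˣ) : K)) • (f k l * f i j)) :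
    QExt q n m →ₐ[K] B :=
  RingQuot.liftAlgHom K ⟨FreeAlgebra.lift K fun p => f p.1 p.2, by
    rintro x y (⟨i, j⟩ | ⟨i, h⟩ | ⟨h, j⟩ | ⟨h, h'⟩ | ⟨h, h'⟩)
    · simpa using hsq i j
    · simpa using hrow i _ _ h
    · simpa using hcol _ _ j h
    · simpa using hmain _ _ _ _ h h'
    · simpa using hanti _ _ _ _ h h'⟩

theorem extLift_z {B : Type*} [Ring B] [Algebra K B] (f : Fin n → Fin m → B)
    (hsq hrow hcol hmain hanti) (i : Fin n) (j : Fin m) :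
    extLift q f hsq hrow hcol hmain hanti (z q i j) = f i j := by
  unfold extLift z
  erw [RingQuot.liftAlgHom_mkAlgHom_apply]
  simp

/-! #### The multigrading -/

/-- The coaction `z_{ij} ↦ z_{ij} ⊗ t_j` recording the multidegree `(a_1, …, a_m)`, where `a_j`
counts the generators in column `j`. -/
def coact : QExt q n m →ₐ[K] AddMonoidAlgebra (QExt q n m) (Fin m → ℕ) :=
  extLift q (fun i j => AddMonoidAlgebra.single (Pi.single j 1) (z q i j))
    (by intro i j; simp [AddMonoidAlgebra.single_mul_single, z_sq])
    (by
      intro i j l h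
      rw [AddMonoidAlgebra.single_mul_single, AddMonoidAlgebra.single_mul_single, z_row q i h,
        add_comm (Pi.single l 1)]
      ext; simp)
    (by
      intro i k j h
      rw [AddMonoidAlgebra.single_mul_single, AddMonoidAlgebra.single_mul_single, z_col q h j]
      ext; simp)
    (by
      intro i k j l h h'
      rw [AddMonoidAlgebra.single_mul_single, AddMonoidAlgebra.single_mul_single, z_main q h h',
        add_comm (Pi.single l 1)]
      ext; simp)
    (by
      intro i k j l h h'
      rw [AddMonoidAlgebra.single_mul_single, AddMonoidAlgebra.single_mul_single,
        AddMonoidAlgebra.single_mul_single, z_anti q h h', add_comm (Pi.single l 1)]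
      ext; simp)

/-- The diagonal operator acting on the component of multidegree `a` as the scalar `f a`. -/
def diagOp (f : (Fin m → ℕ) → K) : Module.End K (QExt q n m) where
  toFun x := (coact q x).coeff.sum fun a y => f a • y
  map_add' x y := by
    rw [map_add, AddMonoidAlgebra.coeff_add, Finsupp.sum_add_index'] <;> simp
  map_smul' c x := by
    rw [map_smul, AddMonoidAlgebra.coeff_smul, Finsupp.sum_smul_index'] <;>
      simp [Finsupp.smul_sum, smul_comm c]

/-! #### The Chevalley generators -/

variable {r : ℕ}

/-- The value of `E_i` on generators. -/
def eZ (i : Fin r) (k : Fin n) (j : Fin (r + 1)) : QExt q n (r + 1) :=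
  if j = i.castSucc then z q k i.succ else 0

/-- The value of `F_i` on generators. -/
def fZ (i : Fin r) (k : Fin n) (j : Fin (r + 1)) : QExt q n (r + 1) :=
  if j = i.succ then z q k i.castSucc else 0

/-- The eigenvalue of `K_i` on the generators of column `j`. -/
def kZ (i : Fin r) (j : Fin (r + 1)) : Kˣ :=
  if j = i.castSucc then q⁻¹ else if j = i.succ then q else 1

theorem col_cases (i : Fin r) {j l : Fin (r + 1)} (h : j < l) :
    (j = i.castSucc ∧ l = i.succ) ∨
    (j = i.castSucc ∧ l ≠ i.castSucc ∧ l ≠ i.succ ∧ i.succ < l) ∨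
    (j = i.succ ∧ l ≠ i.castSucc ∧ l ≠ i.succ ∧ i.castSucc < l) ∨
    (j ≠ i.castSucc ∧ j ≠ i.succ ∧ l = i.castSucc ∧ j < i.succ) ∨
    (j ≠ i.castSucc ∧ j ≠ i.succ ∧ l = i.succ ∧ j < i.castSucc) ∨
    (j ≠ i.castSucc ∧ j ≠ i.succ ∧ l ≠ i.castSucc ∧ l ≠ i.succ) := by
  simp only [Fin.ext_iff, Fin.lt_def, Fin.val_castSucc, Fin.val_succ, ne_eq] at *
  omega

theorem tri_ext {B : Type*} [Ring B] {a b c a' b' c' : B} (h₁ : a = a') (h₂ : b = b')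
    (h₃ : c = c') : !![a, b; 0, c] = !![a', b'; 0, c'] := by
  rw [h₁, h₂, h₃]

theorem tri_mul {B : Type*} [Ring B] (a b c a' b' c' : B) :
    !![a, b; 0, c] * !![a', b'; 0, c'] = !![a * a', a * b' + b * c'; 0, c * c'] := by
  rw [Matrix.mul_fin_two]; simp

theorem tri_neg {B : Type*} [Ring B] (a b c : B) :
    -!![a, b; 0, c] = !![-a, -b; 0, -c] := by
  ext i j; fin_cases i <;> fin_cases j <;> simp

theorem tri_add {B : Type*} [Ring B] (a b c a' b' c' : B) :
    !![a, b; 0, c] + !![a', b'; 0, c'] = !![a + a', b + b'; 0, c + c'] := by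
  ext i j; fin_cases i <;> fin_cases j <;> simp

theorem tri_smul {B : Type*} [Ring B] [Algebra K B] (t : K) (a b c : B) :
    t • !![a, b; 0, c] = !![t • a, t • b; 0, t • c] := by
  ext i j; fin_cases i <;> fin_cases j <;> simp

theorem tri_zero {B : Type*} [Ring B] : (0 : Matrix (Fin 2) (Fin 2) B) = !![0, 0; 0, 0] := by
  ext i j; fin_cases i <;> fin_cases j <;> rfl

/-- The algebra morphism `x ↦ [[x, E_i x], [0, K_i x]]`. -/
def triE (i : Fin r) : QExt q n (r + 1) →ₐ[K] Matrix (Fin 2) (Fin 2) (QExt q n (r + 1)) :=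
  have hc := Fin.castSucc_lt_succ (i := i)
  have hne : i.succ ≠ i.castSucc := hc.ne'
  extLift q (fun k j => !![z q k j, eZ q i k j; 0, ((kZ q i j : Kˣ) : K) • z q k j])
    (by
      intro k j
      rw [tri_mul, tri_zero]
      refine tri_ext (z_sq q k j) ?_ (by simp [z_sq])
      by_cases hj : j = i.castSucc
      · simp [eZ, kZ, hj, z_row q k hc]
      · simp [eZ, hj])
    (by
      intro k j l h
      rw [tri_mul, tri_mul, tri_smul, tri_neg]
      refine tri_ext (z_row q k h) ?_ (by simp [z_row q k h]; match_scalars; ring)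
      rcases col_cases i h with ⟨hj, hl⟩ | ⟨hj, hl, hl', h'⟩ | ⟨hj, hl, hl', h'⟩ |
          ⟨hj, hj', hl, h'⟩ | ⟨hj, hj', hl, h'⟩ | ⟨hj, hj', hl, hl'⟩
      · simp [eZ, kZ, hj, hl, hne, z_sq]
      · simp [eZ, kZ, hj, hl, hl', z_row q k h']
      · simp [eZ, hj, hl, hne]
      · simp [eZ, kZ, hj, hj', hl, z_row q k h']
      · simp [eZ, hj, hl, hne]
      · simp [eZ, hj, hl])
    (by
      intro k k' j h
      rw [tri_mul, tri_mul, tri_smul, tri_neg]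
      refine tri_ext (z_col q h j) ?_ (by simp [z_col q h j, smul_comm (kZ q i j : K)])
      by_cases hj : j = i.castSucc
      · simp [eZ, kZ, hj, z_main q h hc, z_anti q h hc]
        match_scalars <;> field_simp <;> ring
      · simp [eZ, hj])
    (by
      intro k k' j l h₁ h
      rw [tri_mul, tri_mul, tri_neg]
      refine tri_ext (z_main q h₁ h) ?_
        (by simp [z_main q h₁ h, smul_comm (kZ q i j : K)])
      rcases col_cases i h with ⟨hj, hl⟩ | ⟨hj, hl, hl', h'⟩ | ⟨hj, hl, hl', h'⟩ |
          ⟨hj, hj', hl, h'⟩ | ⟨hj, hj', hl, h'⟩ | ⟨hj, hj', hl, hl'⟩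
      · simp [eZ, kZ, hj, hl, hne, z_col q h₁]
      · simp [eZ, kZ, hj, hl, hl', z_main q h₁ h']
      · simp [eZ, hj, hl, hne]
      · simp [eZ, kZ, hj, hj', hl, z_main q h₁ h']
      · simp [eZ, hj, hl, hne]
      · simp [eZ, hj, hl])
    (by
      intro k k' j l h₁ h
      rw [tri_mul, tri_mul, tri_mul, tri_neg, tri_smul, tri_add]
      refine tri_ext (z_anti q h₁ h) ?_
        (by simp [z_anti q h₁ h]; match_scalars <;> ring)
      rcases col_cases i h with ⟨hj, hl⟩ | ⟨hj, hl, hl', h'⟩ | ⟨hj, hl, hl', h'⟩ |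
          ⟨hj, hj', hl, h'⟩ | ⟨hj, hj', hl, h'⟩ | ⟨hj, hj', hl, hl'⟩
      · simp [eZ, kZ, hj, hl, hne, z_col q h₁]
        match_scalars <;> ring
      · simp [eZ, kZ, hj, hl, hl', z_anti q h₁ h']
      · simp [eZ, hj, hl, hne]
      · simp [eZ, kZ, hj, hj', hl, z_anti q h₁ h']
      · simp [eZ, hj, hl, hne]
      · simp [eZ, hj, hl])

/-- The algebra morphism `x ↦ [[K_i⁻¹ x, F_i x], [0, x]]`. -/
def triF (i : Fin r) : QExt q n (r + 1) →ₐ[K] Matrix (Fin 2) (Fin 2) (QExt q n (r + 1)) :=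
  have hc := Fin.castSucc_lt_succ (i := i)
  have hne : i.succ ≠ i.castSucc := hc.ne'
  extLift q (fun k j => !![(((kZ q i j)⁻¹ : Kˣ) : K) • z q k j, fZ q i k j; 0, z q k j])
    (by
      intro k j
      rw [tri_mul, tri_zero]
      refine tri_ext (by simp [z_sq]) ?_ (z_sq q k j)
      by_cases hj : j = i.succ
      · simp [fZ, kZ, hj, hne, z_row q k hc]
      · simp [fZ, hj])
    (by
      intro k j l h
      rw [tri_mul, tri_mul, tri_smul, tri_neg]
      refine tri_ext (by simp [z_row q k h]; match_scalars; ring) ?_ (z_row q k h)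
      rcases col_cases i h with ⟨hj, hl⟩ | ⟨hj, hl, hl', h'⟩ | ⟨hj, hl, hl', h'⟩ |
          ⟨hj, hj', hl, h'⟩ | ⟨hj, hj', hl, h'⟩ | ⟨hj, hj', hl, hl'⟩
      · simp [fZ, kZ, hj, hl, hne, hne.symm, z_sq]
      · simp [fZ, hj, hl', hne.symm]
      · simp [fZ, kZ, hj, hl, hl', z_row q k h']
      · simp [fZ, hj', hl, hne.symm]
      · simp [fZ, kZ, hj, hj', hl, hne, z_row q k h']
      · simp [fZ, hj', hl'])
    (by
      intro k k' j h
      rw [tri_mul, tri_mul, tri_smul, tri_neg]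
      refine tri_ext (by simp [z_col q h j]; match_scalars; ring) ?_ (z_col q h j)
      by_cases hj : j = i.succ
      · simp [fZ, kZ, hj, hne, z_main q h hc, z_anti q h hc]
        match_scalars <;> field_simp <;> ring
      · simp [fZ, hj])
    (by
      intro k k' j l h₁ h
      rw [tri_mul, tri_mul, tri_neg]
      refine tri_ext (by simp [z_main q h₁ h]; match_scalars; ring) ?_ (z_main q h₁ h)
      rcases col_cases i h with ⟨hj, hl⟩ | ⟨hj, hl, hl', h'⟩ | ⟨hj, hl, hl', h'⟩ |
          ⟨hj, hj', hl, h'⟩ | ⟨hj, hj', hl, h'⟩ | ⟨hj, hj', hl, hl'⟩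
      · simp [fZ, kZ, hj, hl, hne, hne.symm, z_col q h₁]
      · simp [fZ, hj, hl', hne.symm]
      · simp [fZ, kZ, hj, hl, hl', z_main q h₁ h']
      · simp [fZ, hj', hl, hne.symm]
      · simp [fZ, kZ, hj, hj', hl, hne, z_main q h₁ h']
      · simp [fZ, hj', hl'])
    (by
      intro k k' j l h₁ h
      rw [tri_mul, tri_mul, tri_mul, tri_neg, tri_smul, tri_add]
      refine tri_ext (by simp [z_anti q h₁ h]; match_scalars <;> ring) ?_ (z_anti q h₁ h)
      rcases col_cases i h with ⟨hj, hl⟩ | ⟨hj, hl, hl', h'⟩ | ⟨hj, hl, hl', h'⟩ |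
          ⟨hj, hj', hl, h'⟩ | ⟨hj, hj', hl, h'⟩ | ⟨hj, hj', hl, hl'⟩
      · simp [fZ, kZ, hj, hl, hne, hne.symm, z_col q h₁]
        match_scalars <;> ring
      · simp [fZ, hj, hl', hne.symm]
      · simp [fZ, kZ, hj, hl, hl', z_anti q h₁ h']
      · simp [fZ, hj', hl, hne.symm]
      · simp [fZ, kZ, hj, hj', hl, hne, z_anti q h₁ h']
      · simp [fZ, hj', hl'])

/-- The operator of `E_i`: one has `E_i (x y) = x (E_i y) + (E_i x) (K_i y)`, according to the
coproduct `Δ(E_i) = 1 ⊗ E_i + E_i ⊗ K_i`, and `E_i z_{k,i} = z_{k,i+1}`, `E_i z_{k,j} = 0` for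
`j ≠ i`. -/
def opE (i : Fin r) : Module.End K (QExt q n (r + 1)) :=
  Matrix.entryLinearMap K (QExt q n (r + 1)) 0 1 ∘ₗ (triE q i).toLinearMap

/-- The operator of `F_i`: one has `F_i (x y) = (K_i⁻¹ x) (F_i y) + (F_i x) y`, according to the
coproduct `Δ(F_i) = K_i⁻¹ ⊗ F_i + F_i ⊗ 1`, and `F_i z_{k,i+1} = z_{k,i}`, `F_i z_{k,j} = 0` for
`j ≠ i + 1`. -/
def opF (i : Fin r) : Module.End K (QExt q n (r + 1)) :=
  Matrix.entryLinearMap K (QExt q n (r + 1)) 0 1 ∘ₗ (triF q i).toLinearMap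

/-- The `sl` weight `(a_2 - a_1, a_3 - a_2, …)` of the component of multidegree `a`. -/
def wtSl (a : Fin (r + 1) → ℕ) : Fin r → ℤ := fun i => (a i.succ : ℤ) - (a i.castSucc : ℤ)

/-- The projection onto the weight space of weight `l`. -/
def wtProj (l : Fin r → ℤ) : Module.End K (QExt q n (r + 1)) :=
  diagOp q fun a => if wtSl a = l then 1 else 0

/-- The divided power `X ^ k / [k]!`. -/
def divPow (X : Module.End K (QExt q n m)) (k : ℕ) : Module.End K (QExt q n m) :=
  (qFact q k)⁻¹ • X ^ k

/-- The braid operator `T''_i`: on the weight space of weight `λ` it is the sum over all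
`a - b + c = -λ_i` of `(-1)^b q^(b - ac) E_i^(a) F_i^(b) E_i^(c)`. The indices are
`t = (a, b, c)`; only finitely many terms are nonzero operators. -/
def braid (i : Fin r) : Module.End K (QExt q n (r + 1)) :=
  ∑ᶠ t : ℕ × ℕ × ℕ,
    ((-1 : K) ^ t.2.1 * ((q ^ ((t.2.1 : ℤ) - (t.1 : ℤ) * (t.2.2 : ℤ)) : Kˣ) : K)) •
      (divPow q (opE q i) t.1 * divPow q (opF q i) t.2.1 * divPow q (opE q i) t.2.2 *
        diagOp q fun a => if (t.1 : ℤ) - (t.2.1 : ℤ) + (t.2.2 : ℤ) = -wtSl a i then 1 else 0)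

/-- The rescaled braid operator `T_i`, equal to `(-1)^(-a_{i+1}) q^(-a_{i+1}) T''_i` on the
component of multidegree `a`. -/
def braidGl (i : Fin r) : Module.End K (QExt q n (r + 1)) :=
  braid q i * diagOp q fun a => (-1 : K) ^ (a i.succ) * ((q ^ (-(a i.succ : ℤ)) : Kˣ) : K)

/-- Conjugation `X ↦ T X T⁻¹` by an invertible operator `T`. -/
def conjBy (T X : Module.End K (QExt q n m)) : Module.End K (QExt q n m) :=
  T * X * Ring.inverse T

/-- `C_{T_{m-1}} ⋯ C_{T_2} (X)`. The nodes `1, …, m-1` of `sl_m` are here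
`0, …, s` with `s = m - 2`, so that the conjugations are by `T 1`, then `T 2`, …, then `T s`. -/
def conjTower {s : ℕ} (T : Fin (s + 1) → Module.End K (QExt q n (s + 1 + 1)))
    (X : Module.End K (QExt q n (s + 1 + 1))) : Module.End K (QExt q n (s + 1 + 1)) :=
  (List.finRange s).foldl (fun Y i => conjBy q (T i.succ) Y) X

/-- The operator `q^(c (a_1 + a_m))` on the component of multidegree `(a_1, …, a_m)`. -/
def endsOp {s : ℕ} (c : ℤ) : Module.End K (QExt q n (s + 1 + 1)) :=
  diagOp q fun a => ((q ^ (c * ((a 0 : ℤ) + (a (Fin.last (s + 1)) : ℤ))) : Kˣ) : K)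

/-! ### Actions -/

/-- `π` is the skew Howe action of the idempotented quantum group of `sl_{r+1}` on the quantum
exterior algebra. -/
structure IsSkewHoweAction (π : Dot q (cartanSl r) →ₙₐ[K] Module.End K (QExt q n (r + 1))) :
    Prop where
  one : ∀ l, π (Dot.one q _ l) = wtProj q l
  E : ∀ i l, π (Dot.E q _ i l) = opE q i * wtProj q l
  F : ∀ i l, π (Dot.F q _ i l) = opF q i * wtProj q l

/-- The affine weight `(λ_0, λ_1, …, λ_r)` of coordinate sum `0` that extends
`(λ_1, …, λ_r)`. -/
def affWt (l : Fin r → ℤ) : Fin (r + 1) → ℤ := Fin.cons (-∑ i, l i) l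

/-- `ρ` is an action of the idempotented quantum affine algebra of `sl_m`, `m = s + 2`, extending
the action `π` of the idempotented quantum group of `sl_m`, where `E_0` and `F_0` act by the
conjugates of `F_1` and `E_1` under the operators `T`, scaled with the parameter `c`. The node `i`
of `sl_m` is the node `i.succ` of the affine diagram. -/
structure IsEvalExtension {s : ℕ} (c : K) (T : Fin (s + 1) → Module.End K (QExt q n (s + 1 + 1)))
    (π : Dot q (cartanSl (s + 1)) →ₙₐ[K] Module.End K (QExt q n (s + 1 + 1)))
    (ρ : Dot q (cartanAff (s + 1)) →ₙₐ[K] Module.End K (QExt q n (s + 1 + 1))) : Prop where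
  one : ∀ l, ρ (Dot.one q _ (affWt l)) = π (Dot.one q _ l)
  one_eq_zero : ∀ l : Fin (s + 1 + 1) → ℤ, ∑ i, l i ≠ 0 → ρ (Dot.one q _ l) = 0
  E : ∀ i l, ρ (Dot.E q _ i.succ (affWt l)) = π (Dot.E q _ i l)
  F : ∀ i l, ρ (Dot.F q _ i.succ (affWt l)) = π (Dot.F q _ i l)
  E_zero : ∀ l, ρ (Dot.E q _ 0 l) =
    c • (conjTower q T (opF q 0) * endsOp q (-1) * ρ (Dot.one q _ l))
  F_zero : ∀ l, ρ (Dot.F q _ 0 l) =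
    c⁻¹ • (conjTower q T (opE q 0) * endsOp q 1 * ρ (Dot.one q _ l))

end Ext

/-! ### The generic parameter -/

/-- The indeterminate `q` of `ℂ(q)`. -/
def qq : (RatFunc ℂ)ˣ := Units.mk0 RatFunc.X RatFunc.X_ne_zero

/-- The subring `ℂ[q, q⁻¹]` of `ℂ(q)`. -/
def laurent : Subalgebra ℂ (RatFunc ℂ) := Algebra.adjoin ℂ {RatFunc.X, RatFunc.X⁻¹}

/-- The form of the quantum exterior algebra over `ℂ[q, q⁻¹]`: the `ℂ[q, q⁻¹]`-subalgebra
generated by the `z_{ij}`. -/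
def lattice (n m : ℕ) : Subalgebra laurent (QExt qq n m) :=
  Algebra.adjoin laurent (Set.range fun p : Fin n × Fin m => z qq p.1 p.2)

/-- An action of an idempotented quantum group on the quantum exterior algebra over `ℂ(q)`
preserves the lattice if its generators preserve the form over `ℂ[q, q⁻¹]`. -/
def PreservesLattice {ι : Type} {A : ι → ι → ℤ} {n m : ℕ}
    (ρ : Dot qq A →ₙₐ[RatFunc ℂ] Module.End (RatFunc ℂ) (QExt qq n m)) : Prop :=
  ∀ g : DotGen ι, ∀ x ∈ lattice n m, ρ (Dot.gen qq A g) x ∈ lattice n m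

end SkewHowe

end

/-!
The quantum exterior algebra carries the operators `E_i`, `F_i`, which are twisted derivations.
Because of this, identities between them can be checked by moving the operators past one generator
at a time: this gives the relations of quantum `sl_m` (`opE_opF_sub`, `commE`, `serreE`, …), and the
straightening rule makes the algebra finite-dimensional, so that `E_i` and `F_i` are nilpotent.

The braid operators enter only through intertwining relations. If `A`, `B` span a doublet for the
adjoint action of `E_i`, `F_i`, expanding `T''_i A` into words `E^(a) F^(b) E^(c)` and moving `A` to
the left gives `T''_i A = B T''_i` up to a scalar (`braidSum_mul_of_commute_left`,
`braidSum_mul_of_commute_right`). Applied to multiplications by generators this shows that the range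
of `T''_i` is stable under enough multiplications to be everything, whence invertibility
(`isUnit_braid`). Applied to the Chevalley operators at the node `i - 1` it shows that conjugation by
`T''_i` extends an iterated `q`-commutator of Chevalley operators by one letter (`braid_mul_tower`).
So the conjugates of `F_1` and `E_1` in the definition of the evaluation action are, up to a power of
`-q⁻¹`, the iterated `q`-commutators `[⋯[F_1, F_2], ⋯, F_{m-1}]` and `[⋯[E_1, E_2], ⋯, E_{m-1}]`.
The diagonal operator that distinguishes `T_i` from `T''_i` commutes with the operators that are
conjugated, so that both families give the same conjugates and a single action serves for both.

It remains to verify the affine relations for these `q`-commutators. The relation between `E_0` and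
`F_0` is transported from that of `E_1` and `F_1` by the braid operators (`comm_tower_tower`). All
others follow from `q`-commutation rules of iterated `q`-commutators with Chevalley operators of the
same half, which come from the Serre relations, and from their commutators with Chevalley operators
of the opposite half, which are shorter `q`-commutators times Cartan elements (`comm_tower_first`,
`comm_tower_last`). The factor `q ^ (∓ (a_1 + a_m))` turns the `q`-commutation rules into commutation
(`commute_chev_affOp`) and into the Serre relations at the nodes adjacent to the affine one
(`serre_affine`). For `m = 2` the cubic Serre relations reduce to an identity of quantum integers
(`cubic_serre_of_comm`). The form over `ℂ[q, q⁻¹]` is preserved because no divided powers occur in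
the `q`-commutators.
-/

noncomputable section

namespace SkewHowe

/-! ### Powers of `q` and quantum integers -/

section Scalars

variable {K : Type*} [Field K] (q : Kˣ)

/-- The scalar `q ^ k`. -/
def qe (k : ℤ) : K := ((q ^ k : Kˣ) : K)

theorem qe_add (k l : ℤ) : qe q (k + l) = qe q k * qe q l := by
  simp [qe, zpow_add]

@[simp] theorem qe_zero : qe q 0 = 1 := by simp [qe]

theorem qe_one : qe q 1 = (q : K) := by simp [qe]

theorem qe_neg_one : qe q (-1) = ((q⁻¹ : Kˣ) : K) := by simp [qe]

theorem qe_ne_zero (k : ℤ) : qe q k ≠ 0 := Units.ne_zero _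

theorem qe_mul_neg (k : ℤ) : qe q k * qe q (-k) = 1 := by
  rw [← qe_add]; simp

/-- Products of two powers of `q` are compared through their exponents. -/
theorem qe_mul_eq {k l m : ℤ} (h : k + l = m) : qe q k * qe q l = qe q m := by
  rw [← qe_add, h]

theorem qInt_def (k : ℤ) : qInt q k = (qe q k - qe q (-k)) / (qe q 1 - qe q (-1)) := by
  rw [qInt, qe_one, qe_neg_one]; rfl

@[simp] theorem qInt_zero : qInt q 0 = 0 := by simp [qInt]

theorem qInt_neg (k : ℤ) : qInt q (-k) = -qInt q k := by
  rw [qInt_def, qInt_def, neg_neg, ← neg_div, neg_sub]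

variable {q}

/-- Throughout, the assumption that `q` is not a root of unity takes the form that the quantum
integers `[k]`, `k ≠ 0`, do not vanish. Since division by zero gives zero, this includes
`q ≠ q⁻¹`. -/
theorem sub_ne_zero_of_qInt (hq : ∀ k : ℤ, k ≠ 0 → qInt q k ≠ 0) : qe q 1 - qe q (-1) ≠ 0 := by
  intro h
  apply hq 1 one_ne_zero
  rw [qInt_def, h, div_zero]

theorem qInt_one (hq : ∀ k : ℤ, k ≠ 0 → qInt q k ≠ 0) : qInt q 1 = 1 := by
  rw [qInt_def, div_self (sub_ne_zero_of_qInt hq)]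

/-- The identity `[x + y] = q ^ x [y] + q ^ (-y) [x]`. -/
theorem qInt_add (x y : ℤ) : qInt q (x + y) = qe q x * qInt q y + qe q (-y) * qInt q x := by
  simp only [qInt_def, mul_div_assoc', ← add_div]
  congr 1
  simp only [mul_sub, ← qe_add]
  rw [show -(x + y) = -y + -x by ring, show x + -y = -y + x by ring]
  ring

theorem qInt_two (hq : ∀ k : ℤ, k ≠ 0 → qInt q k ≠ 0) : qInt q 2 = qe q 1 + qe q (-1) := by
  rw [show (2 : ℤ) = 1 + 1 by norm_num, qInt_add, qInt_one hq]; ring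

theorem qInt_three (hq : ∀ k : ℤ, k ≠ 0 → qInt q k ≠ 0) :
    qInt q 3 = qe q 2 + 1 + qe q (-2) := by
  rw [show (3 : ℤ) = 1 + 2 by norm_num, qInt_add, qInt_one hq, qInt_two hq, mul_add,
    qe_mul_eq q (show (1 : ℤ) + 1 = 2 by norm_num), qe_mul_neg]; ring

theorem qFact_ne_zero (hq : ∀ k : ℤ, k ≠ 0 → qInt q k ≠ 0) (k : ℕ) : qFact q k ≠ 0 := by
  rw [qFact, Finset.prod_ne_zero_iff]
  intro j _
  exact hq _ (by positivity)

end Scalars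

/-! ### Divided powers -/

section DividedPowers

variable {K : Type*} [Field K] {q : Kˣ} {R : Type*} [Ring R] [Algebra K R]

/-- The divided power `X ^ k / [k]!` for an integer `k`, equal to `0` for `k < 0`; with this
convention the summation indices below can be shifted freely. -/
def dp (q : Kˣ) (X : R) (k : ℤ) : R := if 0 ≤ k then (qFact q k.toNat)⁻¹ • X ^ k.toNat else 0

theorem dp_of_neg (X : R) {k : ℤ} (h : k < 0) : dp q X k = 0 := if_neg (by omega)

@[simp] theorem dp_zero (X : R) : dp q X 0 = 1 := by simp [dp, qFact]

theorem dp_natCast (X : R) (k : ℕ) : dp q X k = (qFact q k)⁻¹ • X ^ k := by simp [dp]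

theorem dp_eq_zero_of_pow (X : R) {N : ℕ} (hN : X ^ N = 0) {k : ℤ} (h : (N : ℤ) ≤ k) :
    dp q X k = 0 := by
  rw [dp, if_pos (by omega), pow_eq_zero_of_le (by omega) hN, smul_zero]

theorem mul_dp (hq : ∀ k : ℤ, k ≠ 0 → qInt q k ≠ 0) (X : R) (k : ℤ) :
    X * dp q X k = qInt q (k + 1) • dp q X (k + 1) := by
  rcases lt_trichotomy k (-1) with h | rfl | h
  · rw [dp_of_neg X (by omega), dp_of_neg X (by omega), mul_zero, smul_zero]
  · rw [dp_of_neg X (by omega)]; simp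
  · lift k to ℕ using by omega
    rw [dp_natCast, show ((k : ℤ) + 1) = ((k + 1 : ℕ) : ℤ) by push_cast; rfl, dp_natCast,
      mul_smul_comm, ← pow_succ', smul_smul, qFact, qFact, Finset.prod_range_succ]
    congr 1
    have h1 := hq (k + 1) (by omega)
    have h2 := qFact_ne_zero hq k
    rw [qFact] at h2
    push_cast
    field_simp

/-- To prove a family of identities between divided powers, it suffices to check that both sides
satisfy the recursion of `mul_dp`. -/
theorem dp_induction (hq : ∀ k : ℤ, k ≠ 0 → qInt q k ≠ 0) {f g : ℤ → R}
    (hneg : ∀ k < 0, f k = g k) (h0 : f 0 = g 0)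
    (hs : ∀ k, 0 ≤ k → f k = g k → qInt q (k + 1) • f (k + 1) = qInt q (k + 1) • g (k + 1))
    (k : ℤ) : f k = g k := by
  rcases lt_or_ge k 0 with h | h
  · exact hneg k h
  · lift k to ℕ using h
    induction k with
    | zero => exact h0
    | succ k ih =>
      have := hs k (by omega) ih
      have h1 := hq (k + 1) (by omega)
      push_cast
      exact (smul_right_injective R h1) this

theorem dp_mul_comm_smul (hq : ∀ k : ℤ, k ≠ 0 → qInt q k ≠ 0) {X A : R} {e : ℤ}
    (h : X * A = qe q e • (A * X)) (k : ℤ) :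
    dp q X k * A = qe q (e * k) • (A * dp q X k) := by
  refine dp_induction hq (f := fun k => dp q X k * A)
    (g := fun k => qe q (e * k) • (A * dp q X k)) (fun k hk => by simp [dp_of_neg X hk])
    (by simp) (fun k _ ih => ?_) k
  beta_reduce at ih ⊢
  rw [← smul_mul_assoc, ← mul_dp hq, mul_assoc, ih, smul_comm (qInt q (k + 1)),
    ← mul_smul_comm (qInt q (k + 1)), ← mul_dp hq, mul_smul_comm, ← mul_assoc, h, smul_mul_assoc,
    smul_smul, mul_assoc, qe_mul_eq q (show e * k + e = e * (k + 1) by ring)]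

theorem dp_mul_comm (hq : ∀ k : ℤ, k ≠ 0 → qInt q k ≠ 0) {X A : R} (h : X * A = A * X) (k : ℤ) :
    dp q X k * A = A * dp q X k := by
  have := dp_mul_comm_smul hq (e := 0) (X := X) (A := A) (by simpa using h) k
  simpa using this

/-- The relation between `X ^ (k)` and a vector `A` which `X` moves to `B`, where `A` and `B` are
the two weight vectors of a doublet: the version without Cartan part. -/
theorem dp_mul_doublet (hq : ∀ k : ℤ, k ≠ 0 → qInt q k ≠ 0) {X A B : R}
    (hA : X * A = qe q (-1) • (A * X) + B) (hB : X * B = qe q 1 • (B * X)) (k : ℤ) :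
    dp q X k * A = qe q (-k) • (A * dp q X k) + B * dp q X (k - 1) := by
  refine dp_induction hq (f := fun k => dp q X k * A)
    (g := fun k => qe q (-k) • (A * dp q X k) + B * dp q X (k - 1))
    (fun k hk => by simp [dp_of_neg X hk, dp_of_neg X (show k - 1 < 0 by omega)])
    (by simp [dp_of_neg X (show (-1 : ℤ) < 0 by omega)]) (fun k _ ih => ?_) k
  beta_reduce at ih ⊢
  have h1 : X * dp q X (k - 1) = qInt q k • dp q X k := by
    rw [mul_dp hq]; simp
  rw [← smul_mul_assoc, ← mul_dp hq, mul_assoc, ih, mul_add, mul_smul_comm, ← mul_assoc, hA,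
    ← mul_assoc, hB, add_mul, smul_mul_assoc, mul_assoc, mul_dp hq, smul_mul_assoc, mul_assoc, h1,
    smul_add, mul_smul_comm, mul_smul_comm, add_sub_cancel_right, qInt_add, qInt_one hq,
    show -(k + 1) = -k + -1 by ring, qe_add]
  have h2 : qInt q (k + 1) = qe q 1 * qInt q k + qe q (-k) := by
    rw [add_comm k, qInt_add, qInt_one hq, mul_one]
  rw [show qe q k * 1 + qe q (-1) * qInt q k = qInt q (k + 1) by
    rw [qInt_add, qInt_one hq], h2]
  match_scalars <;> ring

/-- The relation between `X ^ (k)` and a vector `A` which `X` moves to `B`, where `A` and `B` are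
the two weight vectors of a doublet: the version with Cartan part `C`. -/
theorem dp_mul_doublet' (hq : ∀ k : ℤ, k ≠ 0 → qInt q k ≠ 0) {X A B C : R}
    (hA : X * A = A * X) (hB : X * B = B * X + A * C) (hC : C * X = qe q 2 • (X * C)) (k : ℤ) :
    dp q X k * B = B * dp q X k + qe q (k - 1) • (A * dp q X (k - 1) * C) := by
  refine dp_induction hq (f := fun k => dp q X k * B)
    (g := fun k => B * dp q X k + qe q (k - 1) • (A * dp q X (k - 1) * C))
    (fun k hk => by simp [dp_of_neg X hk, dp_of_neg X (show k - 1 < 0 by omega)])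
    (by simp [dp_of_neg X (show (-1 : ℤ) < 0 by omega)]) (fun k _ ih => ?_) k
  beta_reduce at ih ⊢
  have h1 : X * dp q X (k - 1) = qInt q k • dp q X k := by
    rw [mul_dp hq]; simp
  have h3 : C * dp q X k = qe q (2 * k) • (dp q X k * C) := by
    have : X * C = qe q (-2) • (C * X) := by
      rw [hC, smul_smul, mul_comm, qe_mul_neg, one_smul]
    rw [dp_mul_comm_smul hq this, smul_smul, qe_mul_eq q (show 2 * k + -2 * k = 0 by ring)]
    simp
  rw [← smul_mul_assoc, ← mul_dp hq, mul_assoc, ih, mul_add, mul_smul_comm, ← mul_assoc, hB,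
    add_mul, mul_assoc, mul_dp hq, mul_assoc A C, h3, ← mul_assoc X, ← mul_assoc X A, hA,
    mul_assoc A X, h1, smul_add, mul_smul_comm, mul_smul_comm, add_sub_cancel_right,
    mul_smul_comm, smul_mul_assoc, ← mul_assoc A]
  have h2 : qInt q (k + 1) = qe q k + qe q (-1) * qInt q k := by
    rw [qInt_add, qInt_one hq, mul_one]
  rw [h2, show 2 * k = k + k by ring, show k - 1 = k + -1 by ring, qe_add, qe_add]
  match_scalars <;> ring

end DividedPowers

/-! ### Intertwining relations of the braid operators -/

section Braid

variable {K : Type*} [Field K] {q : Kˣ} {R : Type*} [Ring R] [Algebra K R]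

/-- The operator `E ^ (a) F ^ (b) E ^ (c)`. -/
def efeWord (q : Kˣ) (E F : R) (t : ℤ × ℤ × ℤ) : R :=
  dp q E t.1 * dp q F t.2.1 * dp q E t.2.2

/-- The coefficient of `E ^ (a) F ^ (b) E ^ (c)` in the braid operator on the weight space of
weight `l`. -/
def braidCoef (q : Kˣ) (l : ℤ) (t : ℤ × ℤ × ℤ) : K :=
  if t.1 - t.2.1 + t.2.2 = -l then ((-1 : Kˣ) ^ t.2.1 : Kˣ) * qe q (t.2.1 - t.1 * t.2.2) else 0

/-- Nilpotency of `E` and `F` leaves only finitely many nonzero words, so that the sums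
below may be rearranged. The index is shifted by `δ` for the sake of `wordSum_mul`. -/
theorem finite_support_efeWord {E F : R} (hE : IsNilpotent E) (hF : IsNilpotent F)
    (δ : ℤ × ℤ × ℤ) (f : ℤ × ℤ × ℤ → R → R) (hf : ∀ t, f t 0 = 0) :
    Function.HasFiniteSupport fun t => f t (efeWord q E F (t - δ)) := by
  obtain ⟨N, hN⟩ := hE
  obtain ⟨M, hM⟩ := hF
  have hfin : (Set.Icc (0 : ℤ) N ×ˢ Set.Icc (0 : ℤ) M ×ˢ Set.Icc (0 : ℤ) N).Finite :=
    (Set.finite_Icc _ _).prod ((Set.finite_Icc _ _).prod (Set.finite_Icc _ _))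
  refine (hfin.preimage (f := fun t => t - δ) (sub_left_injective.injOn)).subset ?_
  intro t ht
  have key : ∀ (X : R) (N : ℕ) (_ : X ^ N = 0) (k : ℤ), dp q X k ≠ 0 → k ∈ Set.Icc (0 : ℤ) N := by
    intro X N hN k hk
    constructor
    · by_contra h; exact hk (dp_of_neg X (by omega))
    · by_contra h; exact hk (dp_eq_zero_of_pow X hN (by omega))
  have h0 : efeWord q E F (t - δ) ≠ 0 := by
    intro h; apply ht; simp only [h, hf]
  unfold efeWord at h0
  refine ⟨key E N hN _ ?_, key F M hM _ ?_, key E N hN _ ?_⟩ <;>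
    (intro h; apply h0; rw [h]; simp)

/-- The linear combination of the words `E ^ (a) F ^ (b) E ^ (c)` with coefficients `φ`. -/
def wordSum (q : Kˣ) (E F : R) (φ : ℤ × ℤ × ℤ → K) : R := ∑ᶠ t, φ t • efeWord q E F t

/-- The braid operator `T''` on the weight space of weight `l`. -/
def braidSum (q : Kˣ) (E F : R) (l : ℤ) : R := wordSum q E F (braidCoef q l)

theorem neg_one_zpow_add_one (b : ℤ) :
    (((-1 : Kˣ) ^ (b + 1) : Kˣ) : K) = -(((-1 : Kˣ) ^ b : Kˣ) : K) := by
  rw [zpow_add_one]; simp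

theorem wordSum_add {E F : R} (hE : IsNilpotent E) (hF : IsNilpotent F)
    (φ ψ : ℤ × ℤ × ℤ → K) :
    wordSum q E F φ + wordSum q E F ψ = wordSum q E F fun t => φ t + ψ t := by
  have h := fun c : ℤ × ℤ × ℤ → K => finite_support_efeWord (q := q) hE hF 0
    (fun t x => c t • x) (by simp)
  simp only [sub_zero] at h
  simp only [wordSum, add_smul]
  exact (finsum_add_distrib (h φ) (h ψ)).symm

theorem mul_wordSum_mul {E F : R} (hE : IsNilpotent E) (hF : IsNilpotent F)
    (φ : ℤ × ℤ × ℤ → K) (A B : R) :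
    A * wordSum q E F φ * B = ∑ᶠ t, φ t • (A * efeWord q E F t * B) := by
  have hfin := finite_support_efeWord (q := q) hE hF 0 (fun t x => φ t • x) (by simp)
  simp only [sub_zero] at hfin
  have := ((AddMonoidHom.mulLeft A).comp (AddMonoidHom.mulRight B)).map_finsum hfin
  simp only [AddMonoidHom.coe_comp, Function.comp_apply, AddMonoidHom.coe_mulLeft,
    AddMonoidHom.coe_mulRight] at this
  rw [mul_assoc, wordSum, this]
  refine finsum_congr fun t => ?_
  rw [smul_mul_assoc, mul_smul_comm, mul_assoc]

/-- If `A` can be moved to the left through every word `E ^ (a) F ^ (b) E ^ (c)` at the expense of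
shifts of the indices, then it can be moved through a sum of words. -/
theorem wordSum_mul {E F : R} (hE : IsNilpotent E) (hF : IsNilpotent F) {N : ℕ} {A p : R}
    (M : Fin N → R) (δ : Fin N → ℤ × ℤ × ℤ)
    (ψ : Fin N → ℤ × ℤ × ℤ → K)
    (h : ∀ t, efeWord q E F t * A * p =
      ∑ k, ψ k (t - δ k) • (M k * efeWord q E F (t - δ k) * p)) (φ : ℤ × ℤ × ℤ → K) :
    wordSum q E F φ * A * p =
      ∑ k, M k * (wordSum q E F fun t => φ (t + δ k) * ψ k t) * p := by
  have h1 := mul_wordSum_mul (q := q) hE hF φ 1 (A * p)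
  rw [one_mul, ← mul_assoc] at h1
  rw [h1]
  have h2 : ∀ t, φ t • (1 * efeWord q E F t * (A * p)) =
      ∑ k, (φ t * ψ k (t - δ k)) • (M k * efeWord q E F (t - δ k) * p) := fun t => by
    rw [one_mul, ← mul_assoc, h, Finset.smul_sum]
    simp only [smul_smul]
  rw [finsum_congr h2, finsum_sum_comm]
  · refine Finset.sum_congr rfl fun k _ => ?_
    rw [mul_wordSum_mul hE hF, ← finsum_comp_equiv (Equiv.addRight (δ k))]
    simp
  · exact fun k _ => finite_support_efeWord (q := q) hE hF (δ k)
      (fun t x => (φ t * ψ k (t - δ k)) • (M k * x * p)) (by simp)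

theorem wordSum_eq_zero {E F : R} {φ : ℤ × ℤ × ℤ → K} (h : ∀ t, φ t = 0) :
    wordSum q E F φ = 0 := by
  simp [wordSum, h]

theorem smul_wordSum {E F : R} (c : K) (φ : ℤ × ℤ × ℤ → K) :
    c • wordSum q E F φ = wordSum q E F fun t => c * φ t := by
  simp [wordSum, smul_finsum, smul_smul]

/-- Divided powers of `X` shift the weight of an eigenvector `y` of `C`. -/
theorem dp_eigen (hq : ∀ k : ℤ, k ≠ 0 → qInt q k ≠ 0) {X C y : R} {e l : ℤ}
    (h : C * X = qe q e • (X * C)) (hy : C * y = qe q l • y) (k : ℤ) :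
    C * (dp q X k * y) = qe q (l + e * k) • (dp q X k * y) := by
  have : X * C = qe q (-e) • (C * X) := by
    rw [h, smul_smul, mul_comm, qe_mul_neg, one_smul]
  have h2 : C * dp q X k = qe q (e * k) • (dp q X k * C) := by
    rw [dp_mul_comm_smul hq this, smul_smul, qe_mul_eq q (show e * k + -e * k = 0 by ring)]
    simp
  rw [← mul_assoc, h2, smul_mul_assoc, mul_assoc, hy, mul_smul_comm, smul_smul,
    qe_mul_eq q (show e * k + l = l + e * k by ring)]

/-- The braid operator carries the highest vector `A` of a doublet, which commutes with `E`, to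
the lowest vector `B`. The words in the expansion of `T'' A` in which `A` survives cancel in
pairs `(a, b, c)`, `(a + 1, b + 1, c)`. The factor `p` stands for a projection to a weight
space. -/
theorem braidSum_mul_of_commute_left (hq : ∀ k : ℤ, k ≠ 0 → qInt q k ≠ 0) {E F A B C p : R}
    (hE : IsNilpotent E) (hF : IsNilpotent F)
    (hEA : E * A = A * E) (hFA : F * A = qe q (-1) • (A * F) + B)
    (hFB : F * B = qe q 1 • (B * F)) (hEB : E * B = B * E + A * C)
    (hCE : C * E = qe q 2 • (E * C)) (hCF : C * F = qe q (-2) • (F * C))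
    {l : ℤ} (hCp : C * p = qe q l • p) :
    braidSum q E F (l + 1) * A * p = -qe q 1 • (B * braidSum q E F l * p) := by
  have word : ∀ a b c : ℤ, efeWord q E F (a, b, c) * A * p =
      qe q (-b) • (A * efeWord q E F (a, b, c) * p) + B * efeWord q E F (a, b - 1, c) * p
      + qe q (a - 1 + (l + 2 * c - 2 * (b - 1))) • (A * efeWord q E F (a - 1, b - 1, c) * p) := by
    intro a b c
    have e1 : dp q F b * (A * (dp q E c * p)) =
        qe q (-b) • (A * (dp q F b * (dp q E c * p))) + B * (dp q F (b - 1) * (dp q E c * p)) := by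
      rw [← mul_assoc, dp_mul_doublet hq hFA hFB, add_mul, smul_mul_assoc, mul_assoc, mul_assoc]
    have e2 : ∀ y, dp q E a * (A * y) = A * (dp q E a * y) := fun y => by
      rw [← mul_assoc, dp_mul_comm hq hEA, mul_assoc]
    have e3 : ∀ y, dp q E a * (B * y) =
        B * (dp q E a * y) + qe q (a - 1) • (A * (dp q E (a - 1) * (C * y))) := fun y => by
      rw [← mul_assoc, dp_mul_doublet' hq hEA hEB hCE, add_mul, smul_mul_assoc]
      simp only [mul_assoc]
    have e4 := dp_eigen hq hCF (dp_eigen hq hCE hCp c) (b - 1)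
    unfold efeWord
    simp only [mul_assoc]
    rw [← mul_assoc (dp q E c) A, dp_mul_comm hq hEA, mul_assoc, e1, mul_add, mul_smul_comm, e2,
      e3, e4]
    simp only [mul_smul_comm, smul_smul, ← qe_add, add_assoc]
    ring_nf
  -- the three terms of `word`, each with its shift of indices and its coefficient; the first two
  -- cancel
  rw [neg_smul, braidSum, wordSum_mul hE hF ![A, A, B] ![0, (1, 1, 0), (0, 1, 0)]
    ![fun t => qe q (-t.2.1), fun t => qe q (t.1 + (l + 2 * t.2.2 - 2 * t.2.1)), fun _ => 1]]
  · simp only [Fin.sum_univ_three, Matrix.cons_val_zero, Matrix.cons_val_one, Matrix.cons_val]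
    rw [← add_mul, ← mul_add, wordSum_add hE hF, wordSum_eq_zero, mul_zero, zero_mul, zero_add,
      braidSum, ← smul_mul_assoc, ← mul_smul_comm, smul_wordSum, ← neg_mul, ← mul_neg,
      ← neg_one_smul K (wordSum _ _ _ _), smul_wordSum]
    · congr 3
      funext ⟨a, b, c⟩
      simp only [braidCoef, Prod.fst_add, Prod.snd_add, add_zero]
      by_cases h : a - b + c = -l
      · rw [if_pos (by omega), if_pos h, neg_one_zpow_add_one, show b + 1 - a * c = 1 + (b - a * c)
          by ring, qe_add]
        ring
      · rw [if_neg (by omega), if_neg h]; simp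
    · rintro ⟨a, b, c⟩
      simp only [braidCoef, Prod.fst_add, Prod.snd_add, add_zero]
      by_cases h : a - b + c = -(l + 1)
      · rw [if_pos h, if_pos (by omega), neg_one_zpow_add_one]
        simp only [neg_mul, mul_assoc, ← qe_add]
        rw [show b + 1 - (a + 1) * c + (a + (l + 2 * c - 2 * b)) = b - a * c + -b by
          linear_combination h]
        ring
      · rw [if_neg h, if_neg (by omega)]; simp
  · rintro ⟨a, b, c⟩
    rw [word]
    simp only [Fin.sum_univ_three, Matrix.cons_val_zero, Matrix.cons_val_one, Matrix.cons_val,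
      Prod.mk_sub_mk, sub_zero, one_smul]
    abel

/-- The braid operator carries the lowest vector `A` of a doublet, which commutes with `F`, to
the highest vector `B`. Again the words with `A` cancel in pairs, while the three kinds of words
with `B` add up to one. -/
theorem braidSum_mul_of_commute_right (hq : ∀ k : ℤ, k ≠ 0 → qInt q k ≠ 0) {E F A B C p : R}
    (hE : IsNilpotent E) (hF : IsNilpotent F)
    (hFA : F * A = A * F) (hEA : E * A = qe q (-1) • (A * E) + B)
    (hEB : E * B = qe q 1 • (B * E)) (hFB : F * B = B * F + A * C)
    (hCE : C * E = qe q (-2) • (E * C)) (hCF : C * F = qe q 2 • (F * C))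
    {l : ℤ} (hCp : C * p = qe q (-l) • p) :
    braidSum q E F (l - 1) * A * p = B * braidSum q E F l * p := by
  have word : ∀ a b c : ℤ, efeWord q E F (a, b, c) * A * p =
      qe q (-c - a) • (A * efeWord q E F (a, b, c) * p)
      + qe q (-c) • (B * efeWord q E F (a - 1, b, c) * p)
      + qe q a • (B * efeWord q E F (a, b, c - 1) * p)
      + qe q (b - 1 - l - 2 * (c - 1) - a) • (A * efeWord q E F (a, b - 1, c - 1) * p)
      + qe q (b - 1 - l - 2 * (c - 1)) • (B * efeWord q E F (a - 1, b - 1, c - 1) * p) := by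
    intro a b c
    have e1 : ∀ k y, dp q E k * (A * y) =
        qe q (-k) • (A * (dp q E k * y)) + B * (dp q E (k - 1) * y) := fun k y => by
      rw [← mul_assoc, dp_mul_doublet hq hEA hEB, add_mul, smul_mul_assoc, mul_assoc, mul_assoc]
    have e2 : ∀ y, dp q F b * (A * y) = A * (dp q F b * y) := fun y => by
      rw [← mul_assoc, dp_mul_comm hq hFA, mul_assoc]
    have e3 : ∀ y, dp q F b * (B * y) =
        B * (dp q F b * y) + qe q (b - 1) • (A * (dp q F (b - 1) * (C * y))) := fun y => by
      rw [← mul_assoc, dp_mul_doublet' hq hFA hFB hCF, add_mul, smul_mul_assoc]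
      simp only [mul_assoc]
    have e4 := dp_eigen hq hCE hCp (c - 1)
    have e5 : ∀ y, dp q E a * (B * y) = qe q a • (B * (dp q E a * y)) := fun y => by
      rw [← mul_assoc, dp_mul_comm_smul hq hEB, smul_mul_assoc, mul_assoc, one_mul]
    unfold efeWord
    simp only [mul_assoc]
    rw [e1, mul_add, mul_smul_comm, e2, e3, e4]
    simp only [mul_smul_comm, mul_add, e1, e5, smul_add, smul_smul, ← qe_add]
    rw [show b - 1 + (-l + -2 * (c - 1)) + -a = b - 1 - l - 2 * (c - 1) - a by ring,
      show b - 1 + (-l + -2 * (c - 1)) = b - 1 - l - 2 * (c - 1) by ring,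
      show -c + -a = -c - a by ring]
    abel
  rw [braidSum, wordSum_mul hE hF ![A, B, B, A, B] ![0, (1, 0, 0), (0, 0, 1), (0, 1, 1), (1, 1, 1)]
    ![fun t => qe q (-t.2.2 - t.1), fun t => qe q (-t.2.2), fun t => qe q t.1,
      fun t => qe q (t.2.1 - l - 2 * t.2.2 - t.1), fun t => qe q (t.2.1 - l - 2 * t.2.2)]]
  · simp only [Fin.sum_univ_five, Matrix.cons_val_zero, Matrix.cons_val_one, Matrix.cons_val]
    have rearr : ∀ w₀ w₁ w₂ w₃ w₄ : R, w₀ + w₃ = 0 → A * w₀ * p + B * w₁ * p + B * w₂ * p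
        + A * w₃ * p + B * w₄ * p = B * (w₁ + w₄ + w₂) * p := fun w₀ w₁ w₂ w₃ w₄ h => by
      rw [eq_neg_of_add_eq_zero_left h]; noncomm_ring
    rw [rearr, wordSum_add hE hF, wordSum_add hE hF, braidSum]
    · congr 3
      funext ⟨a, b, c⟩
      simp only [braidCoef, Prod.fst_add, Prod.snd_add, add_zero]
      by_cases h : a - b + c = -l
      · rw [if_pos (by omega), if_pos (by omega), if_pos (by omega), if_pos h,
          neg_one_zpow_add_one]
        simp only [neg_mul, mul_assoc, ← qe_add]
        rw [show b + 1 - (a + 1) * (c + 1) + (b - l - 2 * c) = b - (a + 1) * c + -c by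
          linear_combination -h, show b - a * (c + 1) + a = b - a * c by ring]
        ring
      · rw [if_neg (by omega), if_neg (by omega), if_neg (by omega), if_neg h]; simp
    · rw [wordSum_add hE hF]
      apply wordSum_eq_zero
      rintro ⟨a, b, c⟩
      simp only [braidCoef, Prod.fst_add, Prod.snd_add, add_zero]
      by_cases h : a - b + c = -(l - 1)
      · rw [if_pos h, if_pos (by omega), neg_one_zpow_add_one]
        simp only [neg_mul, mul_assoc, ← qe_add]
        rw [show b + 1 - a * (c + 1) + (b - l - 2 * c - a) = b - a * c + (-c - a) by
          linear_combination -h]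
        ring
      · rw [if_neg h, if_neg (by omega)]; simp
  · rintro ⟨a, b, c⟩
    rw [word]
    simp only [Fin.sum_univ_five, Matrix.cons_val_zero, Matrix.cons_val_one, Matrix.cons_val,
      Prod.mk_sub_mk, sub_zero]

/-- The braid operator commutes with the elements that commute with `E` and `F`. -/
theorem braidSum_mul_of_commute (hq : ∀ k : ℤ, k ≠ 0 → qInt q k ≠ 0) {E F A : R}
    (hE : IsNilpotent E) (hF : IsNilpotent F) (hEA : E * A = A * E) (hFA : F * A = A * F)
    (l : ℤ) : braidSum q E F l * A = A * braidSum q E F l := by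
  have h1 := mul_wordSum_mul (q := q) hE hF (braidCoef q l) 1 A
  have h2 := mul_wordSum_mul (q := q) hE hF (braidCoef q l) A 1
  rw [one_mul] at h1
  rw [mul_one] at h2
  rw [braidSum, h1, h2]
  refine finsum_congr fun t => ?_
  rw [one_mul, mul_one, efeWord, mul_assoc, dp_mul_comm hq hEA, mul_assoc, ← mul_assoc _ A,
    dp_mul_comm hq hFA, mul_assoc, ← mul_assoc, dp_mul_comm hq hEA]
  simp only [mul_assoc]

end Braid

/-! ### Monomials and the multigrading -/

section Monomials

variable {K : Type*} [Field K] (q : Kˣ) {n m : ℕ}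

/-- The product of the generators `z_{ij}` along a list of index pairs. -/
def mon (l : List (Fin n × Fin m)) : QExt q n m := (l.map fun p => z q p.1 p.2).prod

/-- The multidegree of a monomial; degrees are integer vectors, so that they can be subtracted. -/
def mdeg (l : List (Fin n × Fin m)) : Fin m → ℤ := (l.map fun p => Pi.single p.2 1).sum

@[simp] theorem mon_nil : mon q ([] : List (Fin n × Fin m)) = 1 := rfl

@[simp] theorem mon_cons (p : Fin n × Fin m) (l) : mon q (p :: l) = z q p.1 p.2 * mon q l := by
  simp [mon]

@[simp] theorem mon_append (l l' : List (Fin n × Fin m)) :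
    mon q (l ++ l') = mon q l * mon q l' := by
  simp [mon]

@[simp] theorem mdeg_nil : mdeg ([] : List (Fin n × Fin m)) = 0 := rfl

@[simp] theorem mdeg_cons (p : Fin n × Fin m) (l) :
    mdeg (p :: l) = Pi.single p.2 1 + mdeg l := by
  simp [mdeg]

@[simp] theorem mdeg_append (l l' : List (Fin n × Fin m)) :
    mdeg (l ++ l') = mdeg l + mdeg l' := by
  simp [mdeg]

theorem mon_mul_mem_span {x y : QExt q n m} (hx : x ∈ Submodule.span K (Set.range (mon q)))
    (hy : y ∈ Submodule.span K (Set.range (mon q))) :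
    x * y ∈ Submodule.span K (Set.range (mon q)) := by
  have h := Submodule.mul_mem_mul hx hy
  rw [Submodule.span_mul_span] at h
  refine Submodule.span_mono ?_ h
  rintro _ ⟨_, ⟨l, rfl⟩, _, ⟨l', rfl⟩, rfl⟩
  exact ⟨l ++ l', mon_append q l l'⟩

theorem span_mon : Submodule.span K (Set.range (mon q : List (Fin n × Fin m) → _)) = ⊤ := by
  rw [eq_top_iff]
  rintro x -
  obtain ⟨w, rfl⟩ := RingQuot.mkAlgHom_surjective K (ExtRel q n m) x
  induction w using FreeAlgebra.induction with
  | grade0 c =>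
    rw [AlgHom.commutes, Algebra.algebraMap_eq_smul_one]
    exact Submodule.smul_mem _ _ (Submodule.subset_span ⟨[], rfl⟩)
  | grade1 p => exact Submodule.subset_span ⟨[p], by rw [mon_cons, mon_nil, mul_one]; rfl⟩
  | mul a b ha hb => rw [map_mul]; exact mon_mul_mem_span q ha hb
  | add a b ha hb => rw [map_add]; exact Submodule.add_mem _ ha hb

variable {q}

/-- Linear maps which agree on monomials are equal. -/
theorem ext_mon {W : Type*} [AddCommGroup W] [Module K W] {A B : QExt q n m →ₗ[K] W}
    (h : ∀ l, A (mon q l) = B (mon q l)) : A = B := by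
  refine LinearMap.ext_on (span_mon q) ?_
  rintro _ ⟨l, rfl⟩
  exact h l

/-- A submodule containing all monomials is everything. -/
theorem eq_top_of_mon {S : Submodule K (QExt q n m)} (h : ∀ l, mon q l ∈ S) : S = ⊤ := by
  rw [eq_top_iff, ← span_mon q, Submodule.span_le]
  rintro _ ⟨l, rfl⟩
  exact h l

variable (q)

/-- The homogeneous component of multidegree `d`. -/
def homog (d : Fin m → ℤ) : Submodule K (QExt q n m) :=
  Submodule.span K (mon q '' {l | mdeg l = d})

variable {q}

theorem mon_mem_homog (l : List (Fin n × Fin m)) : mon q l ∈ homog q (mdeg l) :=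
  Submodule.subset_span ⟨l, rfl, rfl⟩

theorem mul_mem_homog {d d' : Fin m → ℤ} {x y : QExt q n m} (hx : x ∈ homog q d)
    (hy : y ∈ homog q d') : x * y ∈ homog q (d + d') := by
  have h := Submodule.mul_mem_mul hx hy
  rw [homog, homog, Submodule.span_mul_span] at h
  refine Submodule.span_mono ?_ h
  rintro _ ⟨_, ⟨l, rfl, rfl⟩, _, ⟨l', rfl, rfl⟩, rfl⟩
  exact ⟨l ++ l', by simp, mon_append q l l'⟩

theorem z_mem_homog (i : Fin n) (j : Fin m) : z q i j ∈ homog q (Pi.single j 1) := by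
  simpa using mon_mem_homog (q := q) [(i, j)]

variable (q)

/-- The operator acting on the component of multidegree `d` as the scalar `f d`. -/
def dg (f : (Fin m → ℤ) → K) : Module.End K (QExt q n m) :=
  diagOp q fun a => f fun j => (a j : ℤ)

variable {q}

theorem coact_mon (l : List (Fin n × Fin m)) :
    coact q (mon q l) = AddMonoidAlgebra.single (l.map fun p => Pi.single p.2 1).sum (mon q l) := by
  induction l with
  | nil => simp [AddMonoidAlgebra.one_def]
  | cons p l ih =>
    rw [mon_cons, map_mul, ih, coact, extLift_z, AddMonoidAlgebra.single_mul_single]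
    simp

theorem dg_mon (f : (Fin m → ℤ) → K) (l : List (Fin n × Fin m)) :
    dg q f (mon q l) = f (mdeg l) • mon q l := by
  have h : (fun j => (((l.map fun p => Pi.single p.2 1).sum : Fin m → ℕ) j : ℤ)) = mdeg l := by
    induction l with
    | nil => funext j; simp
    | cons p l ih =>
      rw [mdeg_cons, ← ih]
      funext j
      by_cases hj : j = p.2
      · subst hj; simp
      · simp [hj]
  change ((coact q (mon q l)).coeff.sum fun a y => (f fun j => (a j : ℤ)) • y) = _
  rw [coact_mon, AddMonoidAlgebra.coeff_single, Finsupp.sum_single_index (by simp), h]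

theorem dg_apply {d : Fin m → ℤ} {x : QExt q n m} (hx : x ∈ homog q d) (f : (Fin m → ℤ) → K) :
    dg q f x = f d • x := by
  refine Submodule.span_induction ?_ (by simp) ?_ ?_ hx
  · rintro _ ⟨l, rfl, rfl⟩; exact dg_mon f l
  · intro x y _ _ hx hy; rw [map_add, hx, hy, smul_add]
  · intro c x _ hx; rw [map_smul, hx, smul_comm]

theorem dg_mul_dg (f g : (Fin m → ℤ) → K) :
    dg (n := n) q f * dg q g = dg q fun d => f d * g d := by
  refine ext_mon fun l => ?_
  simp [dg_mon, smul_smul, mul_comm]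

theorem dg_one : dg (n := n) (m := m) q (fun _ => 1) = 1 := ext_mon fun l => by simp [dg_mon]

theorem dg_zero : dg (n := n) (m := m) q (fun _ => 0) = 0 := ext_mon fun l => by simp [dg_mon]

theorem smul_dg (c : K) (f : (Fin m → ℤ) → K) :
    c • dg (n := n) q f = dg q fun d => c * f d := ext_mon fun l => by simp [dg_mon, smul_smul]

theorem dg_sub (f g : (Fin m → ℤ) → K) :
    dg (n := n) q f - dg q g = dg q fun d => f d - g d := ext_mon fun l => by
  simp [dg_mon, sub_smul]

theorem dg_comm (f g : (Fin m → ℤ) → K) :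
    dg (n := n) q f * dg q g = dg q g * dg q f := by
  rw [dg_mul_dg, dg_mul_dg]; simp only [mul_comm]

/-- A linear map which shifts the multidegree of monomials by `e` intertwines the diagonal
operators accordingly. -/
theorem dg_mul_of_homog {A : Module.End K (QExt q n m)} {e : Fin m → ℤ}
    (h : ∀ l, A (mon q l) ∈ homog q (mdeg l + e)) (f : (Fin m → ℤ) → K) :
    dg q f * A = A * dg q fun d => f (d + e) := by
  refine ext_mon fun l => ?_
  simp [dg_mon, dg_apply (h l)]

theorem dg_mul_mulLeft (f : (Fin m → ℤ) → K) (i : Fin n) (j : Fin m) :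
    dg q f * LinearMap.mulLeft K (z q i j) =
      LinearMap.mulLeft K (z q i j) * dg q fun d => f (d + Pi.single j 1) :=
  dg_mul_of_homog (fun l => by
    rw [add_comm]
    exact mul_mem_homog (z_mem_homog i j) (mon_mem_homog l)) f

theorem dg_mul_mulRight (f : (Fin m → ℤ) → K) (i : Fin n) (j : Fin m) :
    dg q f * LinearMap.mulRight K (z q i j) =
      LinearMap.mulRight K (z q i j) * dg q fun d => f (d + Pi.single j 1) :=
  dg_mul_of_homog (fun l => mul_mem_homog (mon_mem_homog l) (z_mem_homog i j)) f

/-- Two linear maps are equal if they agree at `1` and if agreement passes from a monomial to its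
left multiples by generators. -/
theorem ext_left {W : Type*} [AddCommGroup W] [Module K W] {A B : QExt q n m →ₗ[K] W}
    (h1 : A 1 = B 1) (hz : ∀ i j l, A (mon q l) = B (mon q l) →
      A (z q i j * mon q l) = B (z q i j * mon q l)) : A = B := by
  refine ext_mon fun l => ?_
  induction l with
  | nil => exact h1
  | cons p l ih => rw [mon_cons]; exact hz _ _ _ ih

theorem ext_right {W : Type*} [AddCommGroup W] [Module K W] {A B : QExt q n m →ₗ[K] W}
    (h1 : A 1 = B 1) (hz : ∀ i j l, A (mon q l) = B (mon q l) →
      A (mon q l * z q i j) = B (mon q l * z q i j)) : A = B := by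
  refine ext_mon fun l => ?_
  induction l using List.reverseRecOn with
  | nil => exact h1
  | append_singleton l p ih =>
    rw [mon_append, mon_cons, mon_nil, mul_one]; exact hz _ _ _ ih

end Monomials

/-! ### The Chevalley operators as twisted derivations -/

section Chevalley

variable {K : Type*} [Field K] (q : Kˣ) {n r : ℕ}

/-- The shift of the multidegree by `E_i`. -/
def mroot (i : Fin r) : Fin (r + 1) → ℤ := Pi.single i.succ 1 - Pi.single i.castSucc 1

/-- The `i`-th weight `a_{i+1} - a_i` of the multidegree `a`. -/
def wt (i : Fin r) (d : Fin (r + 1) → ℤ) : ℤ := d i.succ - d i.castSucc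

theorem wt_add (i : Fin r) (d e : Fin (r + 1) → ℤ) : wt i (d + e) = wt i d + wt i e := by
  simp [wt]; ring

theorem wt_sub (i : Fin r) (d e : Fin (r + 1) → ℤ) : wt i (d - e) = wt i d - wt i e := by
  simp [wt]; ring

/-- The operator `K_i ^ c`. -/
def opK (i : Fin r) (c : ℤ) : Module.End K (QExt q n (r + 1)) := dg q fun d => qe q (c * wt i d)

variable {q}

theorem kZ_eq (i : Fin r) (j : Fin (r + 1)) :
    ((kZ q i j : Kˣ) : K) = qe q (wt i (Pi.single j 1)) := by
  have h : i.castSucc ≠ i.succ := Fin.castSucc_lt_succ.ne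
  unfold kZ wt
  split_ifs with h1 h2
  · subst h1; simp [h.symm, qe]
  · subst h2; simp [h, qe]
  · simp [Ne.symm h1, Ne.symm h2]

theorem kZ_inv_eq (i : Fin r) (j : Fin (r + 1)) :
    (((kZ q i j)⁻¹ : Kˣ) : K) = qe q (-wt i (Pi.single j 1)) := by
  rw [Units.val_inv_eq_inv_val, kZ_eq]
  exact inv_eq_of_mul_eq_one_right (qe_mul_neg q _)

theorem opK_apply (i : Fin r) (c : ℤ) {d : Fin (r + 1) → ℤ} {x : QExt q n (r + 1)}
    (hx : x ∈ homog q d) : opK q i c x = qe q (c * wt i d) • x := dg_apply hx _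

/-- The entries of the matrix of `triE` other than `E_i x` are the expected ones; multiplicativity
of `triE` then says that `E_i` is a twisted derivation. -/
theorem triE_eq (i : Fin r) (x : QExt q n (r + 1)) :
    triE q i x = !![x, opE q i x; 0, opK q i 1 x] := by
  have h : ∀ l, triE q i (mon q l) 0 0 = mon q l ∧ triE q i (mon q l) 1 0 = (0 : QExt q n (r + 1)) ∧
      triE q i (mon q l) 1 1 = opK q i 1 (mon q l) := by
    intro l
    induction l with
    | nil =>
      rw [mon_nil, map_one, ← mon_nil, opK_apply i 1 (mon_mem_homog [])]
      simp [wt]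
    | cons p l ih =>
      obtain ⟨h1, h2, h3⟩ := ih
      rw [opK_apply i 1 (mon_mem_homog _)] at h3 ⊢
      rw [mon_cons, map_mul, triE, extLift_z, ← triE]
      simp only [Matrix.mul_apply, Fin.sum_univ_two, h1, h2, h3, kZ_eq]
      simp [smul_smul, ← qe_add, wt_add, add_comm]
  have e1 : (Matrix.entryLinearMap K (QExt q n (r + 1)) 0 0 ∘ₗ (triE q i).toLinearMap)
      = LinearMap.id := ext_mon fun l => (h l).1
  have e2 : (Matrix.entryLinearMap K (QExt q n (r + 1)) 1 0 ∘ₗ (triE q i).toLinearMap)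
      = 0 := ext_mon fun l => (h l).2.1
  have e3 : (Matrix.entryLinearMap K (QExt q n (r + 1)) 1 1 ∘ₗ (triE q i).toLinearMap)
      = opK q i 1 := ext_mon fun l => (h l).2.2
  ext a b
  fin_cases a <;> fin_cases b
  · exact LinearMap.congr_fun e1 x
  · rfl
  · exact LinearMap.congr_fun e2 x
  · exact LinearMap.congr_fun e3 x

theorem triF_eq (i : Fin r) (x : QExt q n (r + 1)) :
    triF q i x = !![opK q i (-1) x, opF q i x; 0, x] := by
  have h : ∀ l, triF q i (mon q l) 0 0 = opK q i (-1) (mon q l) ∧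
      triF q i (mon q l) 1 0 = (0 : QExt q n (r + 1)) ∧ triF q i (mon q l) 1 1 = mon q l := by
    intro l
    induction l with
    | nil =>
      rw [mon_nil, map_one, ← mon_nil, opK_apply i (-1) (mon_mem_homog [])]
      simp [wt]
    | cons p l ih =>
      obtain ⟨h1, h2, h3⟩ := ih
      rw [opK_apply i (-1) (mon_mem_homog _)] at h1 ⊢
      rw [mon_cons, map_mul, triF, extLift_z, ← triF]
      simp only [Matrix.mul_apply, Fin.sum_univ_two, h1, h2, h3, kZ_inv_eq]
      simp [smul_smul, ← qe_add, wt_add, add_comm]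
  have e1 : (Matrix.entryLinearMap K (QExt q n (r + 1)) 0 0 ∘ₗ (triF q i).toLinearMap)
      = opK q i (-1) := ext_mon fun l => (h l).1
  have e2 : (Matrix.entryLinearMap K (QExt q n (r + 1)) 1 0 ∘ₗ (triF q i).toLinearMap)
      = 0 := ext_mon fun l => (h l).2.1
  have e3 : (Matrix.entryLinearMap K (QExt q n (r + 1)) 1 1 ∘ₗ (triF q i).toLinearMap)
      = LinearMap.id := ext_mon fun l => (h l).2.2
  ext a b
  fin_cases a <;> fin_cases b
  · exact LinearMap.congr_fun e1 x
  · rfl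
  · exact LinearMap.congr_fun e2 x
  · exact LinearMap.congr_fun e3 x

theorem opE_mul (i : Fin r) (x y : QExt q n (r + 1)) :
    opE q i (x * y) = x * opE q i y + opE q i x * opK q i 1 y := by
  have h := triE_eq i (x * y)
  rw [map_mul, triE_eq, triE_eq, Matrix.mul_fin_two] at h
  simpa using (congrFun (congrFun h 0) 1).symm

theorem opF_mul (i : Fin r) (x y : QExt q n (r + 1)) :
    opF q i (x * y) = opK q i (-1) x * opF q i y + opF q i x * y := by
  have h := triF_eq i (x * y)
  rw [map_mul, triF_eq, triF_eq, Matrix.mul_fin_two] at h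
  simpa using (congrFun (congrFun h 0) 1).symm

theorem opE_z (i : Fin r) (k : Fin n) (j : Fin (r + 1)) : opE q i (z q k j) = eZ q i k j := by
  change triE q i (z q k j) 0 1 = _
  rw [triE, extLift_z]; simp

theorem opF_z (i : Fin r) (k : Fin n) (j : Fin (r + 1)) : opF q i (z q k j) = fZ q i k j := by
  change triF q i (z q k j) 0 1 = _
  rw [triF, extLift_z]; simp

theorem opE_one (i : Fin r) : opE q i (1 : QExt q n (r + 1)) = 0 := by
  change triE q i 1 0 1 = _
  rw [map_one]; simp

theorem opF_one (i : Fin r) : opF q i (1 : QExt q n (r + 1)) = 0 := by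
  change triF q i 1 0 1 = _
  rw [map_one]; simp

theorem one_mem_homog {m : ℕ} : (1 : QExt q n m) ∈ homog q 0 := mon_mem_homog []

theorem opE_z_mem (i : Fin r) (k : Fin n) (j : Fin (r + 1)) :
    opE q i (z q k j) ∈ homog q (Pi.single j 1 + mroot i) := by
  rw [opE_z, eZ]
  split_ifs with h
  · subst h; simpa [mroot] using z_mem_homog k i.succ
  · exact zero_mem _

theorem opF_z_mem (i : Fin r) (k : Fin n) (j : Fin (r + 1)) :
    opF q i (z q k j) ∈ homog q (Pi.single j 1 - mroot i) := by
  rw [opF_z, fZ]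
  split_ifs with h
  · subst h; simpa [mroot] using z_mem_homog k i.castSucc
  · exact zero_mem _

theorem opE_mon_mem (i : Fin r) (l : List (Fin n × Fin (r + 1))) :
    opE q i (mon q l) ∈ homog q (mdeg l + mroot i) := by
  induction l with
  | nil => rw [mon_nil, opE_one]; exact zero_mem _
  | cons p l ih =>
    rw [mon_cons, opE_mul, opK_apply i 1 (mon_mem_homog l), mdeg_cons, mul_smul_comm]
    refine add_mem ?_ (Submodule.smul_mem _ _ ?_)
    · rw [add_assoc]; exact mul_mem_homog (z_mem_homog _ _) ih
    · rw [add_right_comm]; exact mul_mem_homog (opE_z_mem _ _ _) (mon_mem_homog l)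

theorem opF_mon_mem (i : Fin r) (l : List (Fin n × Fin (r + 1))) :
    opF q i (mon q l) ∈ homog q (mdeg l + -mroot i) := by
  induction l with
  | nil => rw [mon_nil, opF_one]; exact zero_mem _
  | cons p l ih =>
    rw [mon_cons, opF_mul, opK_apply i (-1) (z_mem_homog _ _), mdeg_cons, smul_mul_assoc]
    refine add_mem (Submodule.smul_mem _ _ ?_) ?_
    · rw [add_assoc]; exact mul_mem_homog (z_mem_homog _ _) ih
    · rw [add_right_comm]
      exact mul_mem_homog (by simpa [sub_eq_add_neg] using opF_z_mem (q := q) _ _ _)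
        (mon_mem_homog l)

theorem dg_mul_opE (f : (Fin (r + 1) → ℤ) → K) (i : Fin r) :
    dg (n := n) q f * opE q i = opE q i * dg q fun d => f (d + mroot i) :=
  dg_mul_of_homog (opE_mon_mem i) f

theorem dg_mul_opF (f : (Fin (r + 1) → ℤ) → K) (i : Fin r) :
    dg (n := n) q f * opF q i = opF q i * dg q fun d => f (d - mroot i) := by
  simpa [sub_eq_add_neg] using dg_mul_of_homog (opF_mon_mem (q := q) i) f

open LinearMap (mulLeft mulRight)

theorem opE_mul_mulLeft (i : Fin r) (x : QExt q n (r + 1)) :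
    opE q i * mulLeft K x = mulLeft K x * opE q i + mulLeft K (opE q i x) * opK q i 1 := by
  ext y; simp [opE_mul]

theorem opF_mul_mulRight (i : Fin r) (x : QExt q n (r + 1)) :
    opF q i * mulRight K x = mulRight K x * opF q i + mulRight K (opF q i x) * opK q i (-1) := by
  ext y; simp [opF_mul, add_comm]

theorem opE_mul_mulRight (i : Fin r) {x : QExt q n (r + 1)} {d} (hx : x ∈ homog q d) :
    opE q i * mulRight K x = qe q (wt i d) • (mulRight K x * opE q i)
      + mulRight K (opE q i x) := by
  ext y; simp [opE_mul, add_comm, opK_apply i 1 hx]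

theorem opF_mul_mulLeft (i : Fin r) {x : QExt q n (r + 1)} {d} (hx : x ∈ homog q d) :
    opF q i * mulLeft K x = qe q (-wt i d) • (mulLeft K x * opF q i)
      + mulLeft K (opF q i x) := by
  ext y; simp [opF_mul, opK_apply i (-1) hx]

end Chevalley

/-! ### The relations of quantum `sl_m` -/

section Serre

variable {K : Type*} [Field K] {q : Kˣ}

theorem qe_eq_zpow (k : ℤ) : qe q k = (q : K) ^ k := by simp [qe]

/-- The quantum Serre element is skew-primitive: it commutes with the multiplication `L` by a
generator on which the simple root operators act as on a matrix unit chain. Here `A`, `B`, `C`, `D`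
are the multiplications by `X z`, `Y z`, `X Y z`, `Y X z`. -/
theorem serre_mul_comm {R : Type*} [Ring R] [Algebra K R]
    (hq : ∀ k : ℤ, k ≠ 0 → qInt q k ≠ 0) {X Y k l L A B C D : R}
    (hXL : X * L = L * X + A * k) (hYL : Y * L = L * Y + B * l)
    (hXA : X * A = A * X) (hYA : Y * A = A * Y + D * l)
    (hXB : X * B = B * X + C * k) (hXC : X * C = C * X) (hXD : X * D = D * X)
    (hkX : k * X = qe q 2 • (X * k)) (hkY : k * Y = qe q (-1) • (Y * k))
    (hlX : l * X = qe q (-1) • (X * l)) (hkl : k * l = l * k) :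
    (X * X * Y - qInt q 2 • (X * Y * X) + Y * X * X) * L =
      L * (X * X * Y - qInt q 2 • (X * Y * X) + Y * X * X) := by
  have a {u v w : R} (h : u * v = w) (y : R) : u * (v * y) = w * y := by rw [← mul_assoc, h]
  simp only [add_mul, mul_add, sub_mul, mul_sub, smul_mul_assoc, mul_smul_comm, mul_assoc,
    hXL, hYL, a hXL, a hYL, a hXA, a hYA, a hXB, a hXC, a hXD,
    a hkX, a hkY, a hlX, hkX, hkY, hlX, hkl, smul_add, smul_smul, qInt_two hq]
  match_scalars <;> simp only [qe_eq_zpow] <;> field_simp <;> ring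

/-- The commutator of two distant simple root vectors commutes with the multiplication `L` by a
generator. -/
theorem comm_mul_comm {R : Type*} [Ring R] {X Y k l L A B : R}
    (hXL : X * L = L * X + A * k) (hYL : Y * L = L * Y + B * l)
    (hYA : Y * A = A * Y) (hXB : X * B = B * X) (hkY : k * Y = Y * k) (hlX : l * X = X * l) :
    (X * Y - Y * X) * L = L * (X * Y - Y * X) := by
  have a {u v w : R} (h : u * v = w) (y : R) : u * (v * y) = w * y := by rw [← mul_assoc, h]
  simp only [add_mul, mul_add, sub_mul, mul_sub, mul_assoc, hXL, hYL, a hXL, a hYL,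
    a hYA, a hXB, hkY, hlX]
  abel

end Serre

section Relations

open LinearMap (mulLeft mulRight)

variable {K : Type*} [Field K] {q : Kˣ} {n r : ℕ}

theorem opK_mul_opE (i j : Fin r) (c : ℤ) :
    opK (n := n) q i c * opE q j = qe q (c * wt i (mroot j)) • (opE q j * opK q i c) := by
  rw [opK, dg_mul_opE, ← mul_smul_comm, smul_dg]
  simp only [wt_add, ← qe_add, mul_add, add_comm]

theorem opK_mul_opF (i j : Fin r) (c : ℤ) :
    opK (n := n) q i c * opF q j = qe q (-(c * wt i (mroot j))) • (opF q j * opK q i c) := by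
  rw [opK, dg_mul_opF, ← mul_smul_comm, smul_dg]
  congr 2
  funext d
  rw [← qe_add, wt_sub]
  congr 1
  ring

theorem opK_comm (i j : Fin r) (c c' : ℤ) :
    opK (n := n) q i c * opK q j c' = opK q j c' * opK q i c := dg_comm _ _

theorem wt_mroot (i j : Fin r) : wt i (mroot j) = cartanSl r i j := by
  simp only [wt, mroot, cartanSl, Pi.sub_apply, Pi.single_apply, Fin.ext_iff, Fin.val_succ,
    Fin.val_castSucc]
  split_ifs <;> omega

theorem cartanSl_symm (i j : Fin r) : cartanSl r i j = cartanSl r j i := by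
  simp only [cartanSl, Fin.ext_iff]
  split_ifs <;> omega

theorem opE_z' (i : Fin r) (k : Fin n) (j : Fin (r + 1)) :
    opE q i (z q k j) = if (j : ℕ) = i then z q k i.succ else 0 := by
  rw [opE_z, eZ]; simp only [Fin.ext_iff, Fin.val_castSucc]

theorem opF_z' (i : Fin r) (k : Fin n) (j : Fin (r + 1)) :
    opF q i (z q k j) = if (j : ℕ) = i + 1 then z q k i.castSucc else 0 := by
  rw [opF_z, fZ]; simp only [Fin.ext_iff, Fin.val_succ]

theorem opE_opF_z (hq : ∀ k : ℤ, k ≠ 0 → qInt q k ≠ 0) (i j : Fin r) (k : Fin n)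
    (c : Fin (r + 1)) : opE q i (opF q j (z q k c)) - opF q j (opE q i (z q k c)) =
      if i = j then qInt q (wt i (Pi.single c 1)) • z q k c else 0 := by
  have h1 : qInt q (1 : ℤ) = 1 := qInt_one hq
  have h2 : qInt q (-1 : ℤ) = -1 := by rw [qInt_neg, h1]
  rw [opF_z', opE_z']
  simp only [apply_ite (opE q i), apply_ite (opF q j), map_zero, opE_z', opF_z', wt,
    Pi.single_apply, Fin.ext_iff, Fin.val_castSucc, Fin.val_succ]
  split_ifs <;> first
    | omega
    | (simp [h1, h2]; done)
    | (simp only [sub_zero, zero_sub, h1, h2, one_smul, neg_one_smul, neg_inj]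
       congr 1
       ext
       simp only [Fin.val_castSucc, Fin.val_succ]
       omega)

/-- The commutator of `E_i` and `F_j` is a twisted derivation, hence determined by its values on
generators. -/
theorem opE_opF_sub (hq : ∀ k : ℤ, k ≠ 0 → qInt q k ≠ 0) (i j : Fin r) :
    opE (n := n) q i * opF q j - opF q j * opE q i =
      if i = j then dg q fun d => qInt q (wt i d) else 0 := by
  refine ext_left ?_ fun k c l ih => ?_
  · rw [← mon_nil (q := q)]
    split_ifs <;> simp [opE_one, opF_one, dg_apply (one_mem_homog), wt]
  have hz := opE_opF_z hq i j k c
  have e1 : opE q i (opF q j (z q k c * mon q l)) - opF q j (opE q i (z q k c * mon q l)) =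
      qe q (-wt j (Pi.single c 1)) • (z q k c *
        (opE q i (opF q j (mon q l)) - opF q j (opE q i (mon q l))))
      + qe q (wt i (mdeg l)) •
        ((opE q i (opF q j (z q k c)) - opF q j (opE q i (z q k c))) * mon q l) := by
    rw [opF_mul, opE_mul, opK_apply j (-1) (z_mem_homog k c), opK_apply i 1 (mon_mem_homog l)]
    simp only [map_add, map_smul, smul_mul_assoc, mul_smul_comm, opE_mul, opF_mul]
    rw [opK_apply j (-1) (z_mem_homog k c), opK_apply i 1 (mon_mem_homog l),
      opK_apply i 1 (opF_mon_mem j l), opK_apply j (-1) (opE_z_mem i k c)]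
    simp only [smul_mul_assoc, mul_smul_comm, smul_smul, ← qe_add, wt_add, wt_mroot, smul_add,
      ← sub_eq_add_neg, wt_sub, mul_sub, sub_mul]
    rw [cartanSl_symm j i]
    simp only [neg_mul, one_mul]
    rw [show -wt j (Pi.single c 1) + (wt i (mdeg l) - cartanSl r i j)
      = wt i (mdeg l) + -(wt j (Pi.single c 1) + cartanSl r i j) by ring]
    module
  simp only [LinearMap.sub_apply, Module.End.mul_apply] at ih ⊢
  rw [e1, ih, hz]
  split_ifs with h
  · subst h
    rw [dg_mon, ← mon_cons q (k, c), dg_mon, mdeg_cons, wt_add, add_comm (wt i _), qInt_add]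
    simp only [mon_cons, mul_smul_comm, smul_mul_assoc, smul_smul, ← add_smul]
    congr 1
    ring
  · simp

/-- The operators `E` are compatible with left multiplications, so that the relations among them can
be checked on `1`; for the operators `F` right multiplications are used instead. -/
theorem commE (i j : Fin r) (h : cartanSl r i j = 0) :
    opE (n := n) q i * opE q j = opE q j * opE q i := by
  rw [← sub_eq_zero]
  refine ext_left (by simp [opE_one]) fun k c l ih => ?_
  have hij : ¬ (i : ℕ) = j ∧ ¬ (i : ℕ) + 1 = j ∧ ¬ (j : ℕ) + 1 = i := by
    simp only [cartanSl, Fin.ext_iff] at h; split_ifs at h <;> omega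
  have := comm_mul_comm (opE_mul_mulLeft (q := q) i (z q k c)) (opE_mul_mulLeft j (z q k c))
    (by
      have h0 : opE q j (opE q i (z q k c)) = 0 := by
        rw [opE_z']; split_ifs <;> simp [opE_z']; omega
      rw [opE_mul_mulLeft, h0]; simp)
    (by
      have h0 : opE q i (opE q j (z q k c)) = 0 := by
        rw [opE_z']; split_ifs <;> simp [opE_z']; omega
      rw [opE_mul_mulLeft, h0]; simp)
    (by rw [opK_mul_opE, wt_mroot, h]; simp)
    (by rw [opK_mul_opE, wt_mroot, cartanSl_symm, h]; simp)
  have := LinearMap.congr_fun this (mon q l)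
  rw [Module.End.mul_apply, Module.End.mul_apply, ih] at this
  simpa using this

theorem commF (i j : Fin r) (h : cartanSl r i j = 0) :
    opF (n := n) q i * opF q j = opF q j * opF q i := by
  rw [← sub_eq_zero]
  refine ext_right (by simp [opF_one]) fun k c l ih => ?_
  have hij : ¬ (i : ℕ) = j ∧ ¬ (i : ℕ) + 1 = j ∧ ¬ (j : ℕ) + 1 = i := by
    simp only [cartanSl, Fin.ext_iff] at h; split_ifs at h <;> omega
  have := comm_mul_comm (opF_mul_mulRight (q := q) i (z q k c)) (opF_mul_mulRight j (z q k c))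
    (by
      have h0 : opF q j (opF q i (z q k c)) = 0 := by
        rw [opF_z']; split_ifs <;> simp [opF_z']; omega
      rw [opF_mul_mulRight, h0]; simp)
    (by
      have h0 : opF q i (opF q j (z q k c)) = 0 := by
        rw [opF_z']; split_ifs <;> simp [opF_z']; omega
      rw [opF_mul_mulRight, h0]; simp)
    (by rw [opK_mul_opF, wt_mroot, h]; simp)
    (by rw [opK_mul_opF, wt_mroot, cartanSl_symm, h]; simp)
  have := LinearMap.congr_fun this (mon q l)
  rw [Module.End.mul_apply, Module.End.mul_apply, ih] at this
  simpa using this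

theorem serreE (hq : ∀ k : ℤ, k ≠ 0 → qInt q k ≠ 0) (i j : Fin r) (h : cartanSl r i j = -1) :
    opE (n := n) q i * opE q i * opE q j - qInt q 2 • (opE q i * opE q j * opE q i)
      + opE q j * opE q i * opE q i = 0 := by
  refine ext_left (by simp [opE_one]) fun k c l ih => ?_
  have hii : cartanSl r i i = 2 := by simp [cartanSl]
  have hij : (i : ℕ) + 1 = j ∨ (j : ℕ) + 1 = i := by
    simp only [cartanSl, Fin.ext_iff] at h; split_ifs at h ; omega
  have := serre_mul_comm hq (opE_mul_mulLeft (q := q) i (z q k c))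
    (opE_mul_mulLeft j (z q k c))
    (by
      have h0 : opE q i (opE q i (z q k c)) = 0 := by
        rw [opE_z']; split_ifs <;> simp [opE_z']
      rw [opE_mul_mulLeft, h0]; simp)
    (opE_mul_mulLeft j _) (opE_mul_mulLeft i _)
    (by
      have h0 : opE q i (opE q i (opE q j (z q k c))) = 0 := by
        rw [opE_z']; split_ifs <;> simp [opE_z']; split_ifs <;> simp [opE_z']
      rw [opE_mul_mulLeft, h0]; simp)
    (by
      have h0 : opE q i (opE q j (opE q i (z q k c))) = 0 := by
        rw [opE_z']; split_ifs <;> simp [opE_z']; split_ifs <;> simp [opE_z']; omega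
      rw [opE_mul_mulLeft, h0]; simp)
    (by rw [opK_mul_opE, wt_mroot, hii]; simp)
    (by rw [opK_mul_opE, wt_mroot, h]; simp)
    (by rw [opK_mul_opE, wt_mroot, cartanSl_symm, h]; simp)
    (opK_comm _ _ _ _)
  have := LinearMap.congr_fun this (mon q l)
  rw [Module.End.mul_apply, Module.End.mul_apply, ih] at this
  simpa using this

theorem serreF (hq : ∀ k : ℤ, k ≠ 0 → qInt q k ≠ 0) (i j : Fin r) (h : cartanSl r i j = -1) :
    opF (n := n) q i * opF q i * opF q j - qInt q 2 • (opF q i * opF q j * opF q i)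
      + opF q j * opF q i * opF q i = 0 := by
  refine ext_right (by simp [opF_one]) fun k c l ih => ?_
  have hii : cartanSl r i i = 2 := by simp [cartanSl]
  have hij : (i : ℕ) + 1 = j ∨ (j : ℕ) + 1 = i := by
    simp only [cartanSl, Fin.ext_iff] at h; split_ifs at h ; omega
  have := serre_mul_comm hq (opF_mul_mulRight (q := q) i (z q k c))
    (opF_mul_mulRight j (z q k c))
    (by
      have h0 : opF q i (opF q i (z q k c)) = 0 := by
        rw [opF_z']; split_ifs <;> simp [opF_z']
      rw [opF_mul_mulRight, h0]; simp)
    (opF_mul_mulRight j _) (opF_mul_mulRight i _)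
    (by
      have h0 : opF q i (opF q i (opF q j (z q k c))) = 0 := by
        rw [opF_z']; split_ifs <;> simp [opF_z']; split_ifs <;> simp [opF_z']
      rw [opF_mul_mulRight, h0]; simp)
    (by
      have h0 : opF q i (opF q j (opF q i (z q k c))) = 0 := by
        rw [opF_z']; split_ifs <;> simp [opF_z']; split_ifs <;> simp [opF_z']; omega
      rw [opF_mul_mulRight, h0]; simp)
    (by rw [opK_mul_opF, wt_mroot, hii]; simp)
    (by rw [opK_mul_opF, wt_mroot, h]; simp)
    (by rw [opK_mul_opF, wt_mroot, cartanSl_symm, h]; simp)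
    (opK_comm _ _ _ _)
  have := LinearMap.congr_fun this (mon q l)
  rw [Module.End.mul_apply, Module.End.mul_apply, ih] at this
  simpa using this

end Relations

/-! ### Finiteness of the quantum exterior algebra -/

section Straightening

/-- If `C` can be absorbed by the factor `S k` and moved past all other factors, then it can be
absorbed by a product containing `S k`. -/
theorem mul_list_prod_le {K A ι : Type*} [CommSemiring K] [Semiring A] [Algebra K A]
    {S : ι → Submodule K A} {C : Submodule K A} {k : ι} (hk : C * S k ≤ S k)
    (h : ∀ i ≠ k, C * S i ≤ S i * C) (l : List ι) (hl : k ∈ l) :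
    C * (l.map S).prod ≤ (l.map S).prod := by
  induction l with
  | nil => simp at hl
  | cons i l ih =>
    rw [List.map_cons, List.prod_cons, ← mul_assoc]
    by_cases hi : i = k
    · subst hi
      exact mul_le_mul' hk le_rfl
    · refine (mul_le_mul' (h i hi) le_rfl).trans ?_
      rw [mul_assoc]
      exact mul_le_mul' le_rfl (ih ((List.mem_cons.1 hl).resolve_left (Ne.symm hi)))

theorem one_le_list_prod {K A ι : Type*} [CommSemiring K] [Semiring A] [Algebra K A]
    {S : ι → Submodule K A} (h : ∀ i, 1 ≤ S i) (l : List ι) : 1 ≤ (l.map S).prod := by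
  induction l with
  | nil => simp
  | cons i l ih =>
    rw [List.map_cons, List.prod_cons, ← one_mul (1 : Submodule K A)]
    exact mul_le_mul' (h i) ih

theorem fg_list_prod {K A ι : Type*} [CommSemiring K] [Semiring A] [Algebra K A]
    {S : ι → Submodule K A} (h : ∀ i, (S i).FG) (l : List ι) : (l.map S).prod.FG := by
  induction l with
  | nil =>
    rw [List.map_nil, List.prod_nil, Submodule.one_eq_span]
    exact Submodule.fg_span_singleton _
  | cons i l ih =>
    rw [List.map_cons, List.prod_cons]
    exact (h i).mul ih

variable {K : Type*} [Field K] (q : Kˣ) {n m : ℕ}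

/-- The span of the generators in the `j`-th column. -/
def colSpan (n : ℕ) {m : ℕ} (j : Fin m) : Submodule K (QExt q n m) :=
  Submodule.span K (Set.range fun i => z q i j)

variable {q}

theorem z_mem_colSpan (i : Fin n) (j : Fin m) : z q i j ∈ colSpan q n j :=
  Submodule.subset_span ⟨i, rfl⟩

theorem colSpan_mul_le {j : Fin m} {S T : Submodule K (QExt q n m)}
    (h : ∀ i, ∀ x ∈ S, z q i j * x ∈ T) : colSpan q n j * S ≤ T := by
  rw [Submodule.mul_le]
  intro y hy x hx
  refine Submodule.span_induction ?_ (by simp) ?_ ?_ hy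
  · rintro _ ⟨i, rfl⟩; exact h i x hx
  · intro a b _ _ ha hb; rw [add_mul]; exact add_mem ha hb
  · intro c a _ ha; rw [smul_mul_assoc]; exact T.smul_mem c ha

/-- The straightening rule: a generator in column `j` can be moved past a generator in another
column `l`, at the expense of changing the rows of both. -/
theorem colSpan_mul_colSpan_le {j l : Fin m} (hjl : j ≠ l) :
    colSpan q n j * colSpan q n l ≤ colSpan q n l * colSpan q n j := by
  rw [colSpan, colSpan, Submodule.span_mul_span, Submodule.span_le]
  rintro _ ⟨_, ⟨i, rfl⟩, _, ⟨k, rfl⟩, rfl⟩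
  change z q i j * z q k l ∈ colSpan q n l * colSpan q n j
  have mem (a b : Fin n) : z q a l * z q b j ∈ colSpan q n l * colSpan q n j :=
    Submodule.mul_mem_mul (z_mem_colSpan _ _) (z_mem_colSpan _ _)
  rcases lt_or_gt_of_ne hjl with h | h <;> rcases lt_trichotomy i k with h' | rfl | h'
  · rw [z_main q h' h]; exact neg_mem (mem _ _)
  · rw [z_row q i h]; exact neg_mem (Submodule.smul_mem _ _ (mem _ _))
  · have e : z q i j * z q k l = -(z q k l * z q i j)
        + ((q : K) - ((q⁻¹ : Kˣ) : K)) • (z q i l * z q k j) := by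
      rw [z_anti q h' h]; abel
    rw [e]
    exact add_mem (neg_mem (mem _ _)) (Submodule.smul_mem _ _ (mem _ _))
  · have e : z q k j * z q i l = -(z q i l * z q k j) := by rw [z_main q h' h, neg_neg]
    rw [z_anti q h' h, e]
    exact add_mem (neg_mem (mem _ _)) (Submodule.smul_mem _ _ (neg_mem (mem _ _)))
  · have e : z q i j * z q i l = -((q : K) • (z q i l * z q i j)) := by
      rw [z_row q i h, smul_neg, neg_neg, smul_smul]; simp
    rw [e]; exact neg_mem (Submodule.smul_mem _ _ (mem _ _))
  · have e : z q i j * z q k l = -(z q k l * z q i j) := by rw [z_main q h' h, neg_neg]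
    rw [e]; exact neg_mem (mem _ _)

/-- A submodule is everything if it contains `1` and is stable under right multiplication by the
generators of column `v` and under left multiplication by the generators of all other columns. -/
theorem eq_top_of_mul_mem {S : Submodule K (QExt q n m)} (v : Fin m) (h1 : 1 ∈ S)
    (hl : ∀ j ≠ v, ∀ i, ∀ x ∈ S, z q i j * x ∈ S) (hr : ∀ i, ∀ x ∈ S, x * z q i v ∈ S) :
    S = ⊤ := by
  have hr' : S * colSpan q n v ≤ S := by
    rw [Submodule.mul_le]
    intro x hx y hy
    refine Submodule.span_induction ?_ (by simp) ?_ ?_ hy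
    · rintro _ ⟨i, rfl⟩; exact hr i x hx
    · intro a b _ _ ha hb; rw [mul_add]; exact add_mem ha hb
    · intro c a _ ha; rw [mul_smul_comm]; exact S.smul_mem c ha
  have hpow : ∀ k : ℕ, colSpan q n v ^ k ≤ S := fun k => by
    induction k with
    | zero => rw [pow_zero, Submodule.one_le]; exact h1
    | succ k ih => rw [pow_succ]; exact (mul_le_mul' ih le_rfl).trans hr'
  have hmove : ∀ l : List (Fin m), colSpan q n v * (l.map (colSpan q n)).prod
      ≤ (l.map (colSpan q n)).prod * colSpan q n v := fun l => by
    induction l with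
    | nil => simp
    | cons j l ih =>
      rw [List.map_cons, List.prod_cons]
      have hj : colSpan q n v * colSpan q n j ≤ colSpan q n j * colSpan q n v := by
        by_cases h : v = j
        · subst h; exact le_rfl
        · exact colSpan_mul_colSpan_le h
      calc _ = colSpan q n v * colSpan q n j * (l.map (colSpan q n)).prod := by rw [mul_assoc]
        _ ≤ colSpan q n j * colSpan q n v * (l.map (colSpan q n)).prod :=
          mul_le_mul' hj le_rfl
        _ ≤ colSpan q n j * ((l.map (colSpan q n)).prod * colSpan q n v) := by
          rw [mul_assoc]; exact mul_le_mul' le_rfl ih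
        _ = _ := by rw [mul_assoc]
  have key : ∀ (l : List (Fin m)) (k : ℕ), (l.map (colSpan q n)).prod * colSpan q n v ^ k ≤ S := by
    intro l
    induction l with
    | nil => intro k; simpa using hpow k
    | cons j l ih =>
      intro k
      rw [List.map_cons, List.prod_cons]
      by_cases h : j = v
      · subst h
        refine (mul_le_mul' (hmove l) le_rfl).trans ?_
        rw [mul_assoc, ← pow_succ']
        exact ih (k + 1)
      · rw [mul_assoc]
        refine (mul_le_mul' le_rfl (ih k)).trans ?_
        exact colSpan_mul_le (hl j h)
  refine eq_top_of_mon fun l => key (l.map Prod.snd) 0 ?_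
  rw [pow_zero, mul_one, List.map_map]
  induction l with
  | nil => exact Submodule.one_le.1 le_rfl
  | cons p l ih =>
    rw [mon_cons, List.map_cons, List.prod_cons]
    exact Submodule.mul_mem_mul (z_mem_colSpan _ _) ih

/-- The quantum exterior algebra is spanned by the products of distinct generators, ordered by
columns and then by rows: this is the product of the spaces spanned by `1` and one generator, and
it is stable under left multiplication by generators. -/
instance : Module.Finite K (QExt q n m) := by
  let D (j : Fin m) (i : Fin n) : Submodule K (QExt q n m) := Submodule.span K {1, z q i j}
  have hD1 : ∀ j i, 1 ≤ D j i := fun j i => by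
    rw [Submodule.one_le]; exact Submodule.subset_span (by simp)
  let A (j : Fin m) : Submodule K (QExt q n m) := ((List.finRange n).map (D j)).prod
  have hA1 : ∀ j, 1 ≤ A j := fun j => one_le_list_prod (hD1 j) _
  have hzA : ∀ j k, Submodule.span K {z q k j} * A j ≤ A j := by
    intro j k
    refine mul_list_prod_le (k := k) ?_ ?_ _ (List.mem_finRange k)
    · rw [Submodule.span_mul_span, Submodule.span_le]
      rintro _ ⟨_, rfl, y, rfl | rfl, rfl⟩
      · change z q k j * 1 ∈ D j k
        rw [mul_one]; exact Submodule.subset_span (by simp)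
      · change z q k j * z q k j ∈ D j k
        rw [z_sq]; exact zero_mem _
    · intro i hi
      rw [Submodule.span_mul_span, Submodule.span_le]
      have mem1 : (1 : QExt q n m) * z q k j ∈ D j i * Submodule.span K {z q k j} :=
        Submodule.mul_mem_mul (Submodule.subset_span (by simp)) (Submodule.subset_span (by simp))
      have mem2 : z q i j * z q k j ∈ D j i * Submodule.span K {z q k j} :=
        Submodule.mul_mem_mul (Submodule.subset_span (by simp)) (Submodule.subset_span (by simp))
      rintro _ ⟨_, rfl, y, rfl | rfl, rfl⟩
      · change z q k j * 1 ∈ _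
        rw [mul_one]; rwa [one_mul] at mem1
      · change z q k j * z q i j ∈ _
        rcases lt_or_gt_of_ne hi with h | h
        · have e : z q k j * z q i j = -((q : K) • (z q i j * z q k j)) := by
            rw [z_col q h, smul_neg, neg_neg, smul_smul]; simp
          rw [e]; exact neg_mem (Submodule.smul_mem _ _ mem2)
        · rw [z_col q h]; exact neg_mem (Submodule.smul_mem _ _ mem2)
  have hCA : ∀ j, colSpan q n j * A j ≤ A j := fun j => colSpan_mul_le fun i x hx =>
    hzA j i (Submodule.mul_mem_mul (Submodule.subset_span rfl) hx)
  have hCA' : ∀ l j, j ≠ l → colSpan q n l * A j ≤ A j * colSpan q n l := by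
    intro l j hjl
    have : ∀ L : List (Fin n), colSpan q n l * (L.map (D j)).prod ≤ A j * colSpan q n l := by
      intro L
      induction L with
      | nil =>
        rw [List.map_nil, List.prod_nil, mul_one]
        nth_rewrite 1 [← one_mul (colSpan q n l)]
        exact mul_le_mul' (hA1 j) le_rfl
      | cons i L ih =>
        have hDi : D j i ≤ 1 ⊔ colSpan q n j := by
          refine Submodule.span_le.2 ?_
          rintro _ (rfl | rfl)
          · exact Submodule.mem_sup_left (Submodule.one_le.1 le_rfl)
          · exact Submodule.mem_sup_right (z_mem_colSpan _ _)
        rw [List.map_cons, List.prod_cons]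
        calc _ ≤ colSpan q n l * ((1 ⊔ colSpan q n j) * (L.map (D j)).prod) :=
              mul_le_mul' le_rfl (mul_le_mul' hDi le_rfl)
          _ = colSpan q n l * (L.map (D j)).prod
              ⊔ colSpan q n l * colSpan q n j * (L.map (D j)).prod := by
            rw [Submodule.sup_mul, one_mul, Submodule.mul_sup, mul_assoc]
          _ ≤ _ := by
            refine sup_le ih ?_
            calc _ ≤ colSpan q n j * colSpan q n l * (L.map (D j)).prod :=
                  mul_le_mul' (colSpan_mul_colSpan_le hjl.symm) le_rfl
              _ ≤ colSpan q n j * (A j * colSpan q n l) := by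
                rw [mul_assoc]; exact mul_le_mul' le_rfl ih
              _ ≤ _ := by rw [← mul_assoc]; exact mul_le_mul' (hCA j) le_rfl
    exact this _
  -- the span of the ordered products
  let P : Submodule K (QExt q n m) := ((List.finRange m).map A).prod
  have hP : ∀ j, colSpan q n j * P ≤ P := fun j =>
    mul_list_prod_le (k := j) (hCA j) (fun l hl => hCA' j l hl) _ (List.mem_finRange j)
  have htop : P = ⊤ := eq_top_of_mon fun l => by
    induction l with
    | nil => exact Submodule.one_le.1 (one_le_list_prod hA1 _)
    | cons p l ih =>
      rw [mon_cons]; exact hP p.2 (Submodule.mul_mem_mul (z_mem_colSpan _ _) ih)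
  refine ⟨htop ▸ fg_list_prod (fun j => fg_list_prod (fun i => ?_) _) _⟩
  exact Submodule.fg_span (by simp)

end Straightening

section Nilpotent

open LinearMap (mulLeft mulRight)

variable {K : Type*} [Field K] {q : Kˣ} {n r : ℕ}

/-- On a finite-dimensional space local nilpotency implies nilpotency; it suffices that high divided
powers kill each monomial. -/
theorem isNilpotent_of_dp (hq : ∀ k : ℤ, k ≠ 0 → qInt q k ≠ 0)
    {X : Module.End K (QExt q n r)}
    (h : ∀ l, ∃ N : ℤ, ∀ k ≥ N, dp q X k (mon q l) = 0) : IsNilpotent X := by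
  rw [Module.End.isNilpotent_iff_of_finite]
  have : ∀ x, ∃ N : ℕ, ∀ k ≥ N, (X ^ k) x = 0 := by
    intro x
    have hx : x ∈ Submodule.span K (Set.range (mon q)) := by rw [span_mon]; trivial
    refine Submodule.span_induction ?_ ⟨0, by simp⟩ ?_ ?_ hx
    · rintro _ ⟨l, rfl⟩
      obtain ⟨N, hN⟩ := h l
      refine ⟨N.toNat, fun k hk => ?_⟩
      have := hN k (by omega)
      rw [dp_natCast, LinearMap.smul_apply] at this
      exact (smul_eq_zero.1 this).resolve_left (inv_ne_zero (qFact_ne_zero hq k))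
    · rintro a b _ _ ⟨N, hN⟩ ⟨M, hM⟩
      refine ⟨max N M, fun k hk => ?_⟩
      rw [map_add, hN k (le_of_max_le_left hk), hM k (le_of_max_le_right hk), add_zero]
    · rintro c a _ ⟨N, hN⟩
      exact ⟨N, fun k hk => by rw [map_smul, hN k hk, smul_zero]⟩
  intro x
  obtain ⟨N, hN⟩ := this x
  exact ⟨N, hN N le_rfl⟩

theorem isNilpotent_opE (hq : ∀ k : ℤ, k ≠ 0 → qInt q k ≠ 0) (i : Fin r) :
    IsNilpotent (opE (n := n) q i) := by
  refine isNilpotent_of_dp hq fun l => ?_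
  induction l with
  | nil =>
    refine ⟨1, fun k hk => ?_⟩
    lift k to ℕ using by omega
    obtain ⟨k, rfl⟩ : ∃ k', k = k' + 1 := ⟨k - 1, by omega⟩
    rw [dp_natCast, LinearMap.smul_apply, pow_succ, Module.End.mul_apply, mon_nil, opE_one]
    simp
  | cons p l ih =>
    obtain ⟨N, hN⟩ := ih
    refine ⟨N + 1, fun k hk => ?_⟩
    have h0 : opE q i (opE q i (z q p.1 p.2)) = 0 := by
      rw [opE_z']; split_ifs <;> simp [opE_z']
    have := dp_mul_doublet' hq (X := opE q i) (A := mulLeft K (opE q i (z q p.1 p.2)))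
      (B := mulLeft K (z q p.1 p.2)) (C := opK q i 1)
      (by rw [opE_mul_mulLeft, h0]; simp) (opE_mul_mulLeft i _)
      (by rw [opK_mul_opE, wt_mroot]; simp [cartanSl]) k
    have := LinearMap.congr_fun this (mon q l)
    simp only [Module.End.mul_apply, LinearMap.add_apply, LinearMap.smul_apply,
      LinearMap.mulLeft_apply] at this
    rw [mon_cons, this, opK_apply i 1 (mon_mem_homog l), map_smul, hN k (by omega),
      hN (k - 1) (by omega)]
    simp

theorem isNilpotent_opF (hq : ∀ k : ℤ, k ≠ 0 → qInt q k ≠ 0) (i : Fin r) :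
    IsNilpotent (opF (n := n) q i) := by
  refine isNilpotent_of_dp hq fun l => ?_
  induction l using List.reverseRecOn with
  | nil =>
    refine ⟨1, fun k hk => ?_⟩
    lift k to ℕ using by omega
    obtain ⟨k, rfl⟩ : ∃ k', k = k' + 1 := ⟨k - 1, by omega⟩
    rw [dp_natCast, LinearMap.smul_apply, pow_succ, Module.End.mul_apply, mon_nil, opF_one]
    simp
  | append_singleton l p ih =>
    obtain ⟨N, hN⟩ := ih
    refine ⟨N + 1, fun k hk => ?_⟩
    have h0 : opF q i (opF q i (z q p.1 p.2)) = 0 := by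
      rw [opF_z']; split_ifs <;> simp [opF_z']
    have := dp_mul_doublet' hq (X := opF q i) (A := mulRight K (opF q i (z q p.1 p.2)))
      (B := mulRight K (z q p.1 p.2)) (C := opK q i (-1))
      (by rw [opF_mul_mulRight, h0]; simp) (opF_mul_mulRight i _)
      (by rw [opK_mul_opF, wt_mroot]; simp [cartanSl]) k
    have := LinearMap.congr_fun this (mon q l)
    simp only [Module.End.mul_apply, LinearMap.add_apply, LinearMap.smul_apply,
      LinearMap.mulRight_apply] at this
    rw [mon_append, mon_cons, mon_nil, mul_one, this, opK_apply i (-1) (mon_mem_homog l), map_smul,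
      hN k (by omega), hN (k - 1) (by omega)]
    simp

end Nilpotent

/-! ### The braid operators on the quantum exterior algebra -/

section BraidOperators

open LinearMap (mulLeft mulRight)

variable {K : Type*} [Field K] {q : Kˣ} {n r : ℕ}

variable (q) in
/-- The projection to the sum of the components whose `i`-th weight is `l`. -/
def wtP (i : Fin r) (l : ℤ) : Module.End K (QExt q n (r + 1)) :=
  dg q fun d => if wt i d = l then 1 else 0

theorem ext_wtP (i : Fin r) {A B : Module.End K (QExt q n (r + 1))}
    (h : ∀ l, A * wtP q i l = B * wtP q i l) : A = B := by
  refine ext_mon fun l => ?_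
  have := LinearMap.congr_fun (h (wt i (mdeg l))) (mon q l)
  simpa [wtP, dg_mon] using this

theorem opK_mul_wtP (i : Fin r) (c l : ℤ) :
    opK (n := n) q i c * wtP q i l = qe q (c * l) • wtP q i l := by
  refine ext_mon fun w => ?_
  by_cases h : wt i (mdeg w) = l <;> simp [opK, wtP, dg_mon, h]

/-- A sum over triples of natural numbers as a sum over triples of integers, which may
be shifted. -/
theorem finsum_natCast {R : Type*} [AddCommMonoid R] (G : ℤ × ℤ × ℤ → R)
    (hG : ∀ t, G t ≠ 0 → 0 ≤ t.1 ∧ 0 ≤ t.2.1 ∧ 0 ≤ t.2.2) :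
    ∑ᶠ t : ℕ × ℕ × ℕ, G (t.1, t.2.1, t.2.2) = ∑ᶠ t, G t := by
  have hinj : Function.Injective fun t : ℕ × ℕ × ℕ => ((t.1, t.2.1, t.2.2) : ℤ × ℤ × ℤ) := by
    rintro ⟨a, b, c⟩ ⟨a', b', c'⟩ h
    simpa using h
  rw [← finsum_mem_range (f := G) hinj, ← finsum_mem_univ G]
  refine finsum_mem_inter_support_eq _ _ _ ?_
  ext ⟨a, b, c⟩
  simp only [Set.mem_inter_iff, Set.mem_range, Function.mem_support, Set.mem_univ, true_and,
    and_iff_right_iff_imp]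
  intro h
  obtain ⟨h1, h2, h3⟩ := hG _ h
  exact ⟨(a.toNat, b.toNat, c.toNat), by simp_all⟩

/-- On a weight space the braid operator is the sum `braidSum`. -/
theorem braid_mul_wtP (hq : ∀ k : ℤ, k ≠ 0 → qInt q k ≠ 0) (i : Fin r) (l : ℤ) :
    braid (n := n) q i * wtP q i l = braidSum q (opE q i) (opF q i) l * wtP q i l := by
  have hE := isNilpotent_opE (n := n) hq i
  have hF := isNilpotent_opF (n := n) hq i
  let D (t : ℤ × ℤ × ℤ) : Module.End K (QExt q n (r + 1)) :=
    dg q fun d => if t.1 - t.2.1 + t.2.2 = -wt i d then 1 else 0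
  let c (t : ℤ × ℤ × ℤ) : K := ((-1 : Kˣ) ^ t.2.1 : Kˣ) * qe q (t.2.1 - t.1 * t.2.2)
  let G (t : ℤ × ℤ × ℤ) := c t • (efeWord q (opE q i) (opF q i) t * D t)
  have hG : braid (n := n) q i = ∑ᶠ t, G t := by
    rw [← finsum_natCast G]
    · refine finsum_congr fun t => ?_
      simp only [G, c, efeWord, dp_natCast]
      congr 2
    · rintro ⟨x, y, w⟩ h
      by_contra hneg
      apply h
      simp only [G, efeWord]
      by_cases hx : 0 ≤ x
      · by_cases hy : 0 ≤ y
        · rw [dp_of_neg (k := w) _ (by simp only at hneg; omega)]; simp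
        · rw [dp_of_neg (k := y) _ (by omega)]; simp
      · rw [dp_of_neg (k := x) _ (by omega)]; simp
  have hfin : Function.HasFiniteSupport G := by
    have := finite_support_efeWord (q := q) hE hF 0 (fun t x => c t • (x * D t)) (by simp)
    simpa using this
  have h1 := (AddMonoidHom.mulRight (wtP (n := n) q i l)).map_finsum hfin
  have h2 := mul_wordSum_mul (q := q) hE hF (braidCoef q l) 1 (wtP q i l)
  rw [one_mul] at h2
  rw [hG, braidSum, h2]
  simp only [AddMonoidHom.coe_mulRight] at h1
  rw [h1]
  refine finsum_congr fun t => ?_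
  have hD : D t * wtP q i l = (if t.1 - t.2.1 + t.2.2 = -l then (1 : K) else 0) • wtP q i l := by
    refine ext_mon fun w => ?_
    by_cases h : wt i (mdeg w) = l
    · split_ifs with h' <;> simp [D, wtP, dg_mon, h, h']
    · split_ifs <;> simp [D, wtP, dg_mon, h]
  simp only [G, smul_mul_assoc, mul_assoc, hD, mul_smul_comm, smul_smul, one_mul]
  congr 1
  simp only [braidCoef, c]
  split_ifs <;> simp

/-- The braid operator carries the highest vector of a doublet to the lowest vector. -/
theorem braid_mul_of_commute_opE (hq : ∀ k : ℤ, k ≠ 0 → qInt q k ≠ 0) (i : Fin r)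
    {A B : Module.End K (QExt q n (r + 1))}
    (hEA : opE q i * A = A * opE q i) (hFA : opF q i * A = qe q (-1) • (A * opF q i) + B)
    (hFB : opF q i * B = qe q 1 • (B * opF q i)) (hEB : opE q i * B = B * opE q i + A * opK q i 1)
    (hA : ∀ l, A * wtP q i l = wtP q i (l + 1) * A) :
    braid q i * A = -qe q 1 • (B * braid q i) := by
  refine ext_wtP i fun l => ?_
  have hii : cartanSl r i i = 2 := by simp [cartanSl]
  have h1 := braidSum_mul_of_commute_left hq (isNilpotent_opE hq i) (isNilpotent_opF hq i)
    hEA hFA hFB hEB (by rw [opK_mul_opE, wt_mroot, hii]; simp)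
    (by rw [opK_mul_opF, wt_mroot, hii]; simp) (l := l) (p := wtP q i l)
    (by rw [opK_mul_wtP]; simp)
  rw [mul_assoc, hA, ← mul_assoc, braid_mul_wtP hq, mul_assoc, ← hA, ← mul_assoc, h1,
    smul_mul_assoc, mul_assoc, mul_assoc, braid_mul_wtP hq]

/-- The braid operator carries the lowest vector of a doublet to the highest vector. -/
theorem braid_mul_of_commute_opF (hq : ∀ k : ℤ, k ≠ 0 → qInt q k ≠ 0) (i : Fin r)
    {A B : Module.End K (QExt q n (r + 1))}
    (hFA : opF q i * A = A * opF q i) (hEA : opE q i * A = qe q (-1) • (A * opE q i) + B)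
    (hEB : opE q i * B = qe q 1 • (B * opE q i))
    (hFB : opF q i * B = B * opF q i + A * opK q i (-1))
    (hA : ∀ l, A * wtP q i l = wtP q i (l - 1) * A) :
    braid q i * A = B * braid q i := by
  refine ext_wtP i fun l => ?_
  have hii : cartanSl r i i = 2 := by simp [cartanSl]
  have h1 := braidSum_mul_of_commute_right hq (isNilpotent_opE hq i) (isNilpotent_opF hq i)
    hFA hEA hEB hFB (by rw [opK_mul_opE, wt_mroot, hii]; simp)
    (by rw [opK_mul_opF, wt_mroot, hii]; simp) (l := l) (p := wtP q i l)
    (by rw [opK_mul_wtP]; simp)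
  rw [mul_assoc, hA, ← mul_assoc, braid_mul_wtP hq, mul_assoc, ← hA, ← mul_assoc, h1,
    mul_assoc, mul_assoc, braid_mul_wtP hq]

theorem braid_mul_of_commute (hq : ∀ k : ℤ, k ≠ 0 → qInt q k ≠ 0) (i : Fin r)
    {A : Module.End K (QExt q n (r + 1))}
    (hEA : opE q i * A = A * opE q i) (hFA : opF q i * A = A * opF q i)
    (hA : ∀ l, A * wtP q i l = wtP q i l * A) : braid q i * A = A * braid q i := by
  refine ext_wtP i fun l => ?_
  rw [mul_assoc, hA, ← mul_assoc, braid_mul_wtP hq, mul_assoc, ← hA, ← mul_assoc,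
    braidSum_mul_of_commute hq (isNilpotent_opE hq i) (isNilpotent_opF hq i) hEA hFA,
    mul_assoc, mul_assoc, braid_mul_wtP hq]

theorem dg_mul_dp_opE (f : (Fin (r + 1) → ℤ) → K) (i : Fin r) (k : ℤ) :
    dg (n := n) q f * dp q (opE q i) k =
      dp q (opE q i) k * dg q fun d => f (d + k • mroot i) := by
  rcases lt_or_ge k 0 with h | h
  · simp [dp_of_neg _ h]
  · lift k to ℕ using h
    rw [dp_natCast, mul_smul_comm, smul_mul_assoc]
    congr 1
    induction k generalizing f with
    | zero => simp
    | succ k ih =>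
      rw [pow_succ, ← mul_assoc, ih, mul_assoc, dg_mul_opE, mul_assoc]
      push_cast
      simp only [add_smul, one_smul, add_assoc, add_comm (mroot i)]

theorem dg_mul_dp_opF (f : (Fin (r + 1) → ℤ) → K) (i : Fin r) (k : ℤ) :
    dg (n := n) q f * dp q (opF q i) k =
      dp q (opF q i) k * dg q fun d => f (d - k • mroot i) := by
  rcases lt_or_ge k 0 with h | h
  · simp [dp_of_neg _ h]
  · lift k to ℕ using h
    rw [dp_natCast, mul_smul_comm, smul_mul_assoc]
    congr 1
    induction k generalizing f with
    | zero => simp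
    | succ k ih =>
      rw [pow_succ, ← mul_assoc, ih, mul_assoc, dg_mul_opF, mul_assoc]
      push_cast
      simp only [add_smul, one_smul, sub_sub, add_comm (mroot i)]

/-- The simple reflection exchanging the entries `i` and `i + 1` of a multidegree. -/
def reflect (i : Fin r) (d : Fin (r + 1) → ℤ) : Fin (r + 1) → ℤ :=
  d ∘ Equiv.swap i.castSucc i.succ

theorem reflect_eq (i : Fin r) (d : Fin (r + 1) → ℤ) : reflect i d = d - wt i d • mroot i := by
  have h : i.castSucc ≠ i.succ := Fin.castSucc_lt_succ.ne
  funext j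
  simp only [reflect, wt, mroot, Function.comp_apply, Pi.sub_apply, Pi.smul_apply, smul_eq_mul]
  by_cases h1 : j = i.castSucc
  · subst h1; simp [h]
  · by_cases h2 : j = i.succ
    · subst h2; simp [h.symm]
    · rw [Equiv.swap_apply_of_ne_of_ne h1 h2]; simp [h1, h2]

/-- The braid operator permutes the multidegrees. -/
theorem dg_mul_braid (hq : ∀ k : ℤ, k ≠ 0 → qInt q k ≠ 0) (i : Fin r)
    (f : (Fin (r + 1) → ℤ) → K) :
    dg (n := n) q f * braid q i = braid q i * dg q fun d => f (reflect i d) := by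
  refine ext_wtP i fun l => ?_
  have hE := isNilpotent_opE (n := n) hq i
  have hF := isNilpotent_opF (n := n) hq i
  rw [mul_assoc, braid_mul_wtP hq, mul_assoc, wtP, dg_comm (q := q) (n := n), ← mul_assoc, ← wtP,
    ← mul_assoc, braid_mul_wtP hq, mul_assoc (braidSum _ _ _ _), braidSum, mul_wordSum_mul hE hF]
  have h1 := mul_wordSum_mul (q := q) hE hF (braidCoef q l) 1
    (wtP (n := n) q i l * dg q fun d => f (reflect i d))
  rw [one_mul] at h1
  rw [h1]
  refine finsum_congr fun t => ?_
  by_cases h : t.1 - t.2.1 + t.2.2 = -l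
  · congr 1
    rw [one_mul, efeWord, ← mul_assoc, ← mul_assoc, dg_mul_dp_opE, mul_assoc _ _ (dp q _ t.2.1),
      dg_mul_dp_opF, ← mul_assoc, mul_assoc _ _ (dp q _ t.2.2), dg_mul_dp_opE, ← mul_assoc,
      mul_assoc]
    congr 1
    refine ext_mon fun w => ?_
    by_cases hw : wt i (mdeg w) = l
    · simp only [wtP, Module.End.mul_apply, dg_mon, hw, if_true, one_smul, map_smul]
      congr 2
      rw [reflect_eq, hw]
      have : -l • mroot i = (t.1 - t.2.1 + t.2.2) • mroot i := by rw [h]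
      rw [neg_smul] at this
      rw [sub_eq_add_neg (mdeg w) (l • mroot i), this]
      module
    · simp [wtP, dg_mon, hw]
  · simp [braidCoef, h]

/-- In the expansion of the braid operator only the word with all exponents `0` acts on `1` by a
nonzero vector. -/
theorem braid_one (hq : ∀ k : ℤ, k ≠ 0 → qInt q k ≠ 0) (i : Fin r) :
    braid q i (1 : QExt q n (r + 1)) = 1 := by
  have hE := isNilpotent_opE (n := n) hq i
  have hF := isNilpotent_opF (n := n) hq i
  have hp : wtP q i 0 (1 : QExt q n (r + 1)) = 1 := by
    rw [wtP, dg_apply one_mem_homog]; simp [wt]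
  have h1 := LinearMap.congr_fun (braid_mul_wtP (n := n) hq i 0) 1
  rw [Module.End.mul_apply, Module.End.mul_apply, hp] at h1
  have hdp : ∀ (X : Module.End K (QExt q n (r + 1))), X 1 = 0 → ∀ k ≠ 0, dp q X k 1 = 0 := by
    intro X hX k hk
    rcases lt_or_ge k 0 with h | h
    · simp [dp_of_neg _ h]
    · lift k to ℕ using h
      obtain ⟨k, rfl⟩ : ∃ k', k = k' + 1 := ⟨k - 1, by omega⟩
      rw [dp_natCast, LinearMap.smul_apply, pow_succ, Module.End.mul_apply, hX]
      simp
  have hfin := finite_support_efeWord (q := q) hE hF 0 (fun t x => braidCoef q 0 t • x) (by simp)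
  simp only [sub_zero] at hfin
  have h2 := (LinearMap.applyₗ (R := K) (M₂ := QExt q n (r + 1))
    (1 : QExt q n (r + 1))).toAddMonoidHom.map_finsum hfin
  rw [h1, braidSum, wordSum]
  refine h2.trans ?_
  rw [finsum_eq_single _ (0, 0, 0)]
  · simp [braidCoef, efeWord]
  · rintro ⟨a, b, c⟩ ht
    simp only [LinearMap.toAddMonoidHom_coe, LinearMap.applyₗ_apply_apply, LinearMap.smul_apply,
      efeWord, Module.End.mul_apply]
    by_cases hc : c = 0
    · by_cases hb : b = 0
      · have ha : a ≠ 0 := by rintro rfl; exact ht (by rw [hb, hc])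
        subst hb hc
        simp [hdp _ (opE_one i) a ha]
      · subst hc
        simp [hdp _ (opF_one i) b hb]
    · simp [hdp _ (opE_one i) c hc]

theorem mulLeft_mul_wtP (i : Fin r) (k : Fin n) (j : Fin (r + 1)) (l : ℤ) :
    mulLeft K (z q k j) * wtP q i l = wtP q i (l + wt i (Pi.single j 1)) * mulLeft K (z q k j) := by
  rw [wtP, wtP, dg_mul_mulLeft]
  simp only [wt_add, add_left_inj]

theorem mulRight_mul_wtP (i : Fin r) (k : Fin n) (j : Fin (r + 1)) (l : ℤ) :
    mulRight K (z q k j) * wtP q i l =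
      wtP q i (l + wt i (Pi.single j 1)) * mulRight K (z q k j) := by
  rw [wtP, wtP, dg_mul_mulRight]
  simp only [wt_add, add_left_inj]

theorem wt_single_succ (i : Fin r) : wt i (Pi.single i.succ 1) = 1 := by
  have h : i.castSucc ≠ i.succ := Fin.castSucc_lt_succ.ne
  simp [wt, h]

theorem wt_single_castSucc (i : Fin r) : wt i (Pi.single i.castSucc 1) = -1 := by
  have h : i.castSucc ≠ i.succ := Fin.castSucc_lt_succ.ne
  simp [wt, h.symm]

theorem wt_single_of_ne (i : Fin r) {j : Fin (r + 1)} (h1 : j ≠ i.castSucc) (h2 : j ≠ i.succ) :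
    wt i (Pi.single j 1) = 0 := by
  simp [wt, h1.symm, h2.symm]

theorem opE_z_castSucc (i : Fin r) (k : Fin n) : opE q i (z q k i.castSucc) = z q k i.succ := by
  simp [opE_z']

theorem opE_z_succ (i : Fin r) (k : Fin n) : opE q i (z q k i.succ) = 0 := by
  simp [opE_z']

theorem opF_z_castSucc (i : Fin r) (k : Fin n) : opF q i (z q k i.castSucc) = 0 := by
  simp [opF_z']

theorem opF_z_succ (i : Fin r) (k : Fin n) : opF q i (z q k i.succ) = z q k i.castSucc := by
  simp [opF_z']

/-- The multiplications by the generators of two adjacent columns form a doublet. Left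
multiplications by column `i + 1` and right multiplications by column `i` intertwine the braid
operator with a single term. -/
theorem braid_mul_mulLeft_succ (hq : ∀ k : ℤ, k ≠ 0 → qInt q k ≠ 0) (i : Fin r) (k : Fin n) :
    braid q i * mulLeft K (z q k i.succ) =
      -qe q 1 • (mulLeft K (z q k i.castSucc) * braid q i) := by
  refine braid_mul_of_commute_opE hq i ?_ ?_ ?_ ?_ fun l => ?_
  · rw [opE_mul_mulLeft, opE_z_succ]; simp
  · rw [opF_mul_mulLeft i (z_mem_homog _ _), opF_z_succ, wt_single_succ]
  · rw [opF_mul_mulLeft i (z_mem_homog _ _), opF_z_castSucc, wt_single_castSucc]; simp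
  · rw [opE_mul_mulLeft, opE_z_castSucc]
  · rw [mulLeft_mul_wtP, wt_single_succ]

theorem braid_mul_mulRight_castSucc (hq : ∀ k : ℤ, k ≠ 0 → qInt q k ≠ 0) (i : Fin r)
    (k : Fin n) : braid q i * mulRight K (z q k i.castSucc) =
      mulRight K (z q k i.succ) * braid q i := by
  refine braid_mul_of_commute_opF hq i ?_ ?_ ?_ ?_ fun l => ?_
  · rw [opF_mul_mulRight, opF_z_castSucc]; simp
  · rw [opE_mul_mulRight i (z_mem_homog _ _), opE_z_castSucc, wt_single_castSucc]
  · rw [opE_mul_mulRight i (z_mem_homog _ _), opE_z_succ, wt_single_succ]; simp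
  · rw [opF_mul_mulRight, opF_z_succ]
  · rw [mulRight_mul_wtP, wt_single_castSucc, sub_eq_add_neg]

theorem braid_mul_mulLeft_of_ne (hq : ∀ k : ℤ, k ≠ 0 → qInt q k ≠ 0) (i : Fin r) (k : Fin n)
    {j : Fin (r + 1)} (h1 : j ≠ i.castSucc) (h2 : j ≠ i.succ) :
    braid q i * mulLeft K (z q k j) = mulLeft K (z q k j) * braid q i := by
  have hE : opE q i (z q k j) = 0 := by rw [opE_z, eZ, if_neg h1]
  have hF : opF q i (z q k j) = 0 := by rw [opF_z, fZ, if_neg h2]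
  refine braid_mul_of_commute hq i ?_ ?_ fun l => ?_
  · rw [opE_mul_mulLeft, hE]; simp
  · rw [opF_mul_mulLeft i (z_mem_homog _ _), hF, wt_single_of_ne i h1 h2]; simp
  · rw [mulLeft_mul_wtP, wt_single_of_ne i h1 h2, add_zero]

/-- The braid operators are invertible: by the intertwining relations with the multiplications by
generators the range contains all monomials, and the algebra is finite-dimensional. -/
theorem isUnit_braid (hq : ∀ k : ℤ, k ≠ 0 → qInt q k ≠ 0) (i : Fin r) :
    IsUnit (braid (n := n) q i) := by
  have hsurj : Function.Surjective (braid (n := n) q i) := by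
    rw [← LinearMap.range_eq_top]
    refine eq_top_of_mul_mem i.succ ⟨1, braid_one hq i⟩ ?_ ?_
    · rintro j hj k _ ⟨x, rfl⟩
      by_cases h : j = i.castSucc
      · subst h
        have := LinearMap.congr_fun (braid_mul_mulLeft_succ (n := n) hq i k) x
        refine ⟨-(qe q (-1) • (z q k i.succ * x)), ?_⟩
        rw [map_neg, map_smul]
        simp only [Module.End.mul_apply, LinearMap.mulLeft_apply, LinearMap.smul_apply] at this
        rw [this, neg_smul, smul_neg, neg_neg, smul_smul, mul_comm, qe_mul_neg, one_smul]
      · have := LinearMap.congr_fun (braid_mul_mulLeft_of_ne (n := n) hq i k h hj) x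
        exact ⟨z q k j * x, this⟩
    · rintro k _ ⟨x, rfl⟩
      exact ⟨x * z q k i.castSucc, LinearMap.congr_fun (braid_mul_mulRight_castSucc hq i k) x⟩
  rw [Module.End.isUnit_iff]
  exact ⟨LinearMap.injective_iff_surjective.2 hsurj, hsurj⟩

end BraidOperators

/-! ### Iterated `q`-commutators -/

section Tower

variable {K : Type*} [Field K] {q : Kˣ} {R : Type*} [Ring R] [Algebra K R]

/-- The `q`-commutator `x y - q y x`. -/
def qComm (q : Kˣ) (x y : R) : R := x * y - qe q 1 • (y * x)

/-- The iterated `q`-commutator `[⋯[[F_a, F_{a+1}], F_{a+2}], ⋯, F_{a+k}]`. -/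
def tower (q : Kˣ) (F : ℕ → R) (a : ℕ) : ℕ → R
  | 0 => F a
  | k + 1 => qComm q (tower q F a k) (F (a + k + 1))

theorem qComm_assoc {x y w : R} (h : x * w = w * x) :
    qComm q (qComm q x y) w = qComm q x (qComm q y w) := by
  have h' : ∀ v, x * (w * v) = w * (x * v) := fun v => by rw [← mul_assoc, h, mul_assoc]
  simp only [qComm, sub_mul, mul_sub, smul_mul_assoc, mul_smul_comm, smul_sub, mul_assoc, h, h']
  abel

theorem commute_qComm {A x y : R} (hx : Commute A x) (hy : Commute A y) :
    Commute A (qComm q x y) :=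
  (hx.mul_right hy).sub_right ((hy.mul_right hx).smul_right _)

theorem commute_tower {F : ℕ → R} {A : R} {a k : ℕ}
    (h : ∀ j, a ≤ j → j ≤ a + k → Commute A (F j)) : Commute A (tower q F a k) := by
  induction k with
  | zero => exact h a le_rfl le_rfl
  | succ k ih =>
    exact commute_qComm (ih fun j h1 h2 => h j h1 (by omega)) (h _ (by omega) (by omega))

/-- The relations of the positive part of quantum `sl` of infinite rank for a sequence of
elements. A finite sequence that satisfies them can be continued by zeros. -/
structure SerreSeq (q : Kˣ) (F : ℕ → R) : Prop where
  comm : ∀ i j, i + 2 ≤ j → F i * F j = F j * F i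
  serre_up : ∀ i, F i * F i * F (i + 1) - qInt q 2 • (F i * F (i + 1) * F i)
    + F (i + 1) * F i * F i = 0
  serre_down : ∀ i, F (i + 1) * F (i + 1) * F i - qInt q 2 • (F (i + 1) * F i * F (i + 1))
    + F i * F (i + 1) * F (i + 1) = 0

theorem qComm_mul_of_serre (hq : ∀ k : ℤ, k ≠ 0 → qInt q k ≠ 0) {x y : R}
    (h : y * y * x - qInt q 2 • (y * x * y) + x * y * y = 0) :
    qComm q x y * y = qe q (-1) • (y * qComm q x y) := by
  have e : qComm q x y * y - qe q (-1) • (y * qComm q x y) =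
      y * y * x - qInt q 2 • (y * x * y) + x * y * y := by
    simp only [qComm, sub_mul, mul_sub, smul_mul_assoc, mul_smul_comm, smul_sub, smul_smul,
      mul_assoc, qInt_two hq, qe_mul_eq q (show (-1 : ℤ) + 1 = 0 by norm_num), qe_zero]
    module
  rw [← sub_eq_zero, e, h]

theorem mul_qComm_of_serre (hq : ∀ k : ℤ, k ≠ 0 → qInt q k ≠ 0) {x y : R}
    (h : x * x * y - qInt q 2 • (x * y * x) + y * x * x = 0) :
    x * qComm q x y = qe q (-1) • (qComm q x y * x) := by
  have e : x * qComm q x y - qe q (-1) • (qComm q x y * x) =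
      x * x * y - qInt q 2 • (x * y * x) + y * x * x := by
    simp only [qComm, sub_mul, mul_sub, smul_mul_assoc, mul_smul_comm, smul_sub, smul_smul,
      mul_assoc, qInt_two hq, qe_mul_eq q (show (-1 : ℤ) + 1 = 0 by norm_num), qe_zero]
    module
  rw [← sub_eq_zero, e, h]

/-- The middle letter of a chain of three commutes with the iterated `q`-commutator. -/
theorem commute_qComm_qComm (hq : ∀ k : ℤ, k ≠ 0 → qInt q k ≠ 0) {x y w : R}
    (hxw : x * w = w * x) (hx : y * y * x - qInt q 2 • (y * x * y) + x * y * y = 0)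
    (hw : y * y * w - qInt q 2 • (y * w * y) + w * y * y = 0) :
    Commute y (qComm q (qComm q x y) w) := by
  have hxw' : ∀ v, w * (x * v) = x * (w * v) := fun v => by rw [← mul_assoc, ← hxw, mul_assoc]
  have hx1 : qInt q 2 • (y * x * y) = y * y * x + x * y * y := by
    rw [← sub_eq_zero, ← neg_eq_zero, ← hx]; abel
  have hw1 : qInt q 2 • (y * w * y) = y * y * w + w * y * y := by
    rw [← sub_eq_zero, ← neg_eq_zero, ← hw]; abel
  have e : qInt q 2 • (y * qComm q (qComm q x y) w - qComm q (qComm q x y) w * y) =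
      (qInt q 2 • (y * x * y)) * w - qe q 1 • qInt q 2 • (y * y * x * w)
      + qe q 2 • ((qInt q 2 • (y * w * y)) * x) - x * (qInt q 2 • (y * w * y))
      + qe q 1 • qInt q 2 • (x * w * y * y) - qe q 2 • (w * (qInt q 2 • (y * x * y))) := by
    simp only [qComm, sub_mul, mul_sub, smul_mul_assoc, mul_smul_comm, smul_sub, smul_smul,
      mul_assoc, hxw', qe_mul_eq q (show (1 : ℤ) + 1 = 2 by norm_num)]
    module
  have hq2 : qe q 1 * qInt q 2 = 1 + qe q 2 := by
    rw [qInt_two hq, mul_add, qe_mul_eq q (show (1 : ℤ) + 1 = 2 by norm_num), qe_mul_neg, add_comm]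
  have e2 : qInt q 2 • (y * qComm q (qComm q x y) w - qComm q (qComm q x y) w * y) = 0 := by
    rw [e, hx1, hw1, smul_smul, smul_smul, hq2]
    simp only [add_mul, mul_add, mul_assoc, ← hxw, hxw']
    module
  exact sub_eq_zero.1 ((smul_eq_zero.1 e2).resolve_left (hq 2 two_ne_zero))

namespace SerreSeq

variable {F : ℕ → R}

theorem tower_left (hF : SerreSeq q F) (a k : ℕ) :
    tower q F a (k + 1) = qComm q (F a) (tower q F (a + 1) k) := by
  induction k with
  | zero => rfl
  | succ k ih =>
    rw [tower, ih, qComm_assoc (hF.comm _ _ (by omega)), tower,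
      show a + 1 + k + 1 = a + (k + 1) + 1 by ring]

theorem serre_tower_last (hF : SerreSeq q F) (a k : ℕ) :
    F (a + k + 1) * F (a + k + 1) * tower q F a k
      - qInt q 2 • (F (a + k + 1) * tower q F a k * F (a + k + 1))
      + tower q F a k * F (a + k + 1) * F (a + k + 1) = 0 := by
  cases k with
  | zero => exact hF.serre_down a
  | succ k =>
    have hc : Commute (F (a + (k + 1) + 1)) (tower q F a k) :=
      commute_tower fun j h1 h2 => (hF.comm j _ (by omega)).symm
    have hs := hF.serre_down (a + k + 1)
    have h1 : ∀ v, F (a + (k + 1) + 1) * (tower q F a k * v) =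
      tower q F a k * (F (a + (k + 1) + 1) * v) := fun v => by
      rw [← mul_assoc, hc.eq, mul_assoc]
    rw [tower, show a + (k + 1) + 1 = a + k + 1 + 1 by ring] at *
    generalize F (a + k + 1 + 1) = f at *
    generalize tower q F a k = T at *
    generalize F (a + k + 1) = g at *
    have e : f * f * qComm q T g - qInt q 2 • (f * qComm q T g * f) + qComm q T g * f * f =
      qComm q T (f * f * g - qInt q 2 • (f * g * f) + g * f * f) := by
      simp only [qComm, sub_mul, mul_sub, add_mul, mul_add, smul_mul_assoc, mul_smul_comm,
        smul_sub, smul_add, mul_assoc, h1, hc.eq]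
      module
    rw [e, hs]; simp [qComm]

theorem serre_tower_first (hF : SerreSeq q F) (a k : ℕ) :
    F a * F a * tower q F (a + 1) k - qInt q 2 • (F a * tower q F (a + 1) k * F a)
      + tower q F (a + 1) k * F a * F a = 0 := by
  cases k with
  | zero => exact hF.serre_up a
  | succ k =>
    have hc : Commute (F a) (tower q F (a + 1 + 1) k) :=
      commute_tower fun j h1 h2 => hF.comm _ j (by omega)
    have hs := hF.serre_up a
    have h1 : ∀ v, F a * (tower q F (a + 1 + 1) k * v) =
      tower q F (a + 1 + 1) k * (F a * v) := fun v => by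
      rw [← mul_assoc, hc.eq, mul_assoc]
    rw [hF.tower_left] at *
    generalize tower q F (a + 1 + 1) k = T at *
    generalize F (a + 1) = g at *
    generalize F a = f at *
    have e : f * f * qComm q g T - qInt q 2 • (f * qComm q g T * f) + qComm q g T * f * f =
      qComm q (f * f * g - qInt q 2 • (f * g * f) + g * f * f) T := by
      simp only [qComm, sub_mul, mul_sub, add_mul, mul_add, smul_mul_assoc, mul_smul_comm,
        smul_sub, smul_add, mul_assoc, h1, hc.eq]
      module
    rw [e, hs]; simp [qComm]

theorem tower_mul_last (hF : SerreSeq q F) (hq : ∀ k : ℤ, k ≠ 0 → qInt q k ≠ 0) (a k : ℕ) :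
    tower q F a (k + 1) * F (a + k + 1) = qe q (-1) • (F (a + k + 1) * tower q F a (k + 1)) :=
  qComm_mul_of_serre hq (hF.serre_tower_last a k)

theorem first_mul_tower (hF : SerreSeq q F) (hq : ∀ k : ℤ, k ≠ 0 → qInt q k ≠ 0) (a k : ℕ) :
    F a * tower q F a (k + 1) = qe q (-1) • (tower q F a (k + 1) * F a) := by
  rw [hF.tower_left]
  exact mul_qComm_of_serre hq (hF.serre_tower_first a k)

theorem commute_middle (hF : SerreSeq q F) (hq : ∀ k : ℤ, k ≠ 0 → qInt q k ≠ 0) {a k j : ℕ}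
    (h1 : a < j) (h2 : j < a + k) : Commute (F j) (tower q F a k) := by
  obtain ⟨i, rfl⟩ : ∃ i, j = a + i + 1 := ⟨j - a - 1, by omega⟩
  obtain ⟨l, rfl⟩ : ∃ l, k = i + 2 + l := ⟨k - i - 2, by omega⟩
  clear h1 h2
  induction l with
  | zero =>
    refine commute_qComm_qComm hq ?_ (hF.serre_tower_last a i) (hF.serre_up (a + i + 1))
    exact (commute_tower fun j h1 h2 => (hF.comm j (a + (i + 1) + 1) (by omega)).symm).symm
  | succ l ih =>
    exact commute_qComm ih (hF.comm (a + i + 1) (a + (i + 2 + l) + 1) (by omega))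

/-- The `q`-commutator relation of a tower with its proper initial towers. -/
theorem initial_mul_tower (hF : SerreSeq q F) (hq : ∀ k : ℤ, k ≠ 0 → qInt q k ≠ 0) (a k : ℕ)
    {i : ℕ} (hi : i ≤ k) :
    tower q F a i * tower q F a (k + 1) = qe q (-1) • (tower q F a (k + 1) * tower q F a i) := by
  induction i with
  | zero => exact hF.first_mul_tower hq a k
  | succ i ih =>
    have hc := (hF.commute_middle hq (show a < a + i + 1 by omega)
      (show a + i + 1 < a + (k + 1) by omega)).eq
    have ih := ih (by omega)
    generalize tower q F a (k + 1) = T at *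
    rw [tower]
    simp only [qComm, sub_mul, mul_sub, smul_mul_assoc, mul_smul_comm, smul_sub, mul_assoc, hc, ih]
    simp only [← mul_assoc, hc, ih, smul_mul_assoc, smul_smul, mul_comm (qe q (-1))]

/-- The `q`-commutator relation of a tower with the tower lacking the first letter. -/
theorem tower_mul_final (hF : SerreSeq q F) (hq : ∀ k : ℤ, k ≠ 0 → qInt q k ≠ 0) (a k : ℕ) :
    tower q F a (k + 1) * tower q F (a + 1) k =
      qe q (-1) • (tower q F (a + 1) k * tower q F a (k + 1)) := by
  cases k with
  | zero => exact hF.tower_mul_last hq a 0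
  | succ k =>
    have hc : Commute (tower q F a (k + 1 + 1)) (tower q F (a + 1) k) :=
      commute_tower fun j h1 h2 => (hF.commute_middle hq (by omega) (by omega)).symm
    have hl := hF.tower_mul_last hq a (k + 1)
    rw [show a + (k + 1) + 1 = a + 1 + k + 1 by ring] at hl
    generalize tower q F a (k + 1 + 1) = T at *
    rw [tower]
    simp only [qComm, sub_mul, mul_sub, smul_mul_assoc, mul_smul_comm, smul_sub]
    simp only [← mul_assoc, hc.eq, hl, smul_mul_assoc]
    simp only [mul_assoc, hc.eq, hl, mul_smul_comm, smul_smul, mul_comm (qe q (-1))]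

end SerreSeq

/-- The Serre relations between a simple root vector `e` and the image `X D` of the affine root
vector, deduced from the commutator `[e, X] = G C` and from `q`-commutation relations. -/
theorem serre_affine (hq : ∀ k : ℤ, k ≠ 0 → qInt q k ≠ 0) {e X G C D : R} (σ : ℤ)
    (hσ : σ = 1 ∨ σ = -1) (heX : e * X - X * e = G * C) (hDe : D * e = qe q σ • (e * D))
    (hCe : C * e = qe q (-2 * σ) • (e * C)) (heG : e * G = G * e) (hDX : D * X = X * D)
    (hCX : C * X = qe q σ • (X * C)) (hDG : D * G = qe q σ • (G * D))
    (hGX : G * X = qe q σ • (X * G)) (hDC : D * C = C * D) :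
    e * e * (X * D) - qInt q 2 • (e * (X * D) * e) + X * D * e * e = 0 ∧
    X * D * (X * D) * e - qInt q 2 • (X * D * e * (X * D)) + e * (X * D) * (X * D) = 0 := by
  have a {u v w : R} (h : u * v = w) (y : R) : u * (v * y) = w * y := by rw [← mul_assoc, h]
  have h2 : qInt q 2 = qe q σ + qe q (-σ) := by
    rw [qInt_two hq]
    rcases hσ with rfl | rfl
    · rfl
    · rw [add_comm, neg_neg]
  have hc : e * (X * D) - qe q (-σ) • (X * D * e) = G * C * D := by
    rw [← heX, mul_assoc X, hDe, mul_smul_comm, smul_smul, mul_comm, qe_mul_neg, one_smul]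
    noncomm_ring
  constructor
  · have e1 : e * e * (X * D) - qInt q 2 • (e * (X * D) * e) + X * D * e * e =
        e * (e * (X * D) - qe q (-σ) • (X * D * e))
          - qe q σ • ((e * (X * D) - qe q (-σ) • (X * D * e)) * e) := by
      simp only [h2, mul_sub, sub_mul, mul_smul_comm, smul_mul_assoc, smul_sub, smul_smul,
        qe_mul_neg, mul_assoc]
      module
    rw [e1, hc]
    simp only [mul_assoc, hDe, mul_smul_comm, a hCe, smul_mul_assoc, smul_smul, a heG,
      ← qe_add]
    rw [show σ + (σ + -2 * σ) = 0 by ring]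
    simp
  · have e1 : X * D * (X * D) * e - qInt q 2 • (X * D * e * (X * D)) + e * (X * D) * (X * D) =
        (e * (X * D) - qe q (-σ) • (X * D * e)) * (X * D)
          - qe q σ • (X * D * (e * (X * D) - qe q (-σ) • (X * D * e))) := by
      simp only [h2, mul_sub, sub_mul, mul_smul_comm, smul_mul_assoc, smul_sub, smul_smul,
        qe_mul_neg, mul_assoc]
      module
    rw [e1, hc]
    simp only [mul_assoc, a hDX, a hDG, a hDC, a hCX, a hGX, mul_smul_comm, smul_mul_assoc,
      smul_smul, ← qe_add, sub_self]

end Tower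

/-! ### Root vectors for the highest root -/

section Chev

variable {K : Type*} [Field K] {q : Kˣ} {n r : ℕ}

/-- The sign `1` for `true` and `-1` for `false`; the Boolean distinguishes the two halves of the
quantum group. -/
def sg (b : Bool) : ℤ := if b then 1 else -1

theorem sg_not (b : Bool) : sg (!b) = -sg b := by cases b <;> rfl

theorem sg_mul_self (b : Bool) : sg b * sg b = 1 := by cases b <;> rfl

variable (q) in
/-- The Chevalley operators as a sequence: `E_j` for `b = true` and `F_j` for `b = false`,
continued by zero for `r ≤ j`. -/
def chev (n r : ℕ) (b : Bool) (j : ℕ) : Module.End K (QExt q n (r + 1)) :=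
  if h : j < r then (if b then opE q ⟨j, h⟩ else opF q ⟨j, h⟩) else 0

theorem chev_true (i : Fin r) : chev q n r true i = opE q i := by simp [chev]

theorem chev_false (i : Fin r) : chev q n r false i = opF q i := by simp [chev]

theorem chev_of_le (b : Bool) {j : ℕ} (h : r ≤ j) : chev q n r b j = 0 := by
  simp [chev, not_lt.2 h]

/-- The `j`-th entry of a multidegree, `0` if out of range. -/
def ent (j : ℕ) (d : Fin (r + 1) → ℤ) : ℤ := if h : j < r + 1 then d ⟨j, h⟩ else 0

theorem ent_val (j : Fin (r + 1)) (d : Fin (r + 1) → ℤ) : ent j d = d j := by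
  rw [ent, dif_pos j.isLt]

/-- The `j`-th unit multidegree, `0` if out of range. -/
def unitDeg (r j : ℕ) : Fin (r + 1) → ℤ := fun x => if (x : ℕ) = j then 1 else 0

theorem ent_unitDeg {i j : ℕ} (h : i < r + 1) : ent i (unitDeg r j) = if i = j then 1 else 0 := by
  simp [ent, unitDeg, h]

theorem ent_add (j : ℕ) (d e : Fin (r + 1) → ℤ) : ent j (d + e) = ent j d + ent j e := by
  unfold ent; split_ifs <;> simp

theorem ent_smul (j : ℕ) (c : ℤ) (d : Fin (r + 1) → ℤ) : ent j (c • d) = c * ent j d := by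
  unfold ent; split_ifs <;> simp

theorem ent_sub (j : ℕ) (d e : Fin (r + 1) → ℤ) : ent j (d - e) = ent j d - ent j e := by
  unfold ent; split_ifs <;> simp

/-- The weight `a_{j+1} - a_j`. -/
def wtN (j : ℕ) (d : Fin (r + 1) → ℤ) : ℤ := ent (j + 1) d - ent j d

theorem wtN_val (i : Fin r) (d : Fin (r + 1) → ℤ) : wtN i d = wt i d := by
  rw [wtN, wt, ← ent_val i.succ d, ← ent_val i.castSucc d]; rfl

theorem mroot_eq (i : Fin r) : mroot i = unitDeg r (i + 1) - unitDeg r i := by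
  funext x
  simp [mroot, unitDeg, Pi.single_apply, Fin.ext_iff]

theorem dg_mul_chev (f : (Fin (r + 1) → ℤ) → K) (b : Bool) (j : ℕ) :
    dg q f * chev q n r b j =
      chev q n r b j * dg q fun d => f (d + sg b • (unitDeg r (j + 1) - unitDeg r j)) := by
  rcases lt_or_ge j r with h | h
  · lift j to Fin r using h
    cases b
    · rw [chev_false, dg_mul_opF, mroot_eq]
      simp [sg, sub_eq_add_neg, add_comm]
    · rw [chev_true, dg_mul_opE, mroot_eq]
      simp [sg]
  · simp [chev_of_le b h]

theorem dg_mul_tower (f : (Fin (r + 1) → ℤ) → K) (b : Bool) (a k : ℕ) :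
    dg q f * tower q (chev q n r b) a k = tower q (chev q n r b) a k *
      dg q fun d => f (d + sg b • (unitDeg r (a + k + 1) - unitDeg r a)) := by
  induction k generalizing f with
  | zero => exact dg_mul_chev f b a
  | succ k ih =>
    rw [tower, qComm, mul_sub, mul_smul_comm, ← mul_assoc, ← mul_assoc, ih, dg_mul_chev, mul_assoc,
      mul_assoc, dg_mul_chev, ih, sub_mul, smul_mul_assoc, ← mul_assoc, ← mul_assoc]
    congr 3 <;> · congr 1; funext d; congr 1; simp only [← add_assoc]; module

theorem chev_cross (hq : ∀ k : ℤ, k ≠ 0 → qInt q k ≠ 0) (b : Bool) {i j : ℕ} (h : i ≠ j) :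
    chev q n r b i * chev q n r (!b) j = chev q n r (!b) j * chev q n r b i := by
  rcases lt_or_ge i r with hi | hi
  · rcases lt_or_ge j r with hj | hj
    · lift i to Fin r using hi
      lift j to Fin r using hj
      have hij : i ≠ j := fun e => h (by rw [e])
      cases b
      · have := opE_opF_sub (n := n) hq j i
        rw [if_neg hij.symm, sub_eq_zero] at this
        rw [chev_false, Bool.not_false, chev_true, this]
      · have := opE_opF_sub (n := n) hq i j
        rw [if_neg hij, sub_eq_zero] at this
        rw [chev_true, Bool.not_true, chev_false, this]
    · simp [chev_of_le _ hj]
  · simp [chev_of_le _ hi]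

theorem chev_self (hq : ∀ k : ℤ, k ≠ 0 → qInt q k ≠ 0) (b : Bool) {j : ℕ} (hj : j < r) :
    chev q n r (!b) j * chev q n r b j - chev q n r b j * chev q n r (!b) j =
      dg q fun d => qInt q (-sg b * wtN j d) := by
  lift j to Fin r using hj
  have := opE_opF_sub (n := n) hq j j
  rw [if_pos rfl] at this
  cases b
  · rw [chev_false, Bool.not_false, chev_true, this]
    simp [sg, wtN_val]
  · rw [chev_true, Bool.not_true, chev_false, ← neg_sub, this, ← neg_one_smul K, smul_dg]
    simp [sg, wtN_val, qInt_neg]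

theorem cartanSl_of_succ {i : ℕ} (h : i < r) (h' : i + 1 < r) :
    cartanSl r ⟨i, h⟩ ⟨i + 1, h'⟩ = -1 ∧ cartanSl r ⟨i + 1, h'⟩ ⟨i, h⟩ = -1 := by
  simp [cartanSl]

theorem cartanSl_of_add_two_le {i j : Fin r} (h : (i : ℕ) + 2 ≤ j) :
    cartanSl r i j = 0 ∧ cartanSl r j i = 0 := by
  simp only [cartanSl, Fin.ext_iff]
  constructor <;> split_ifs <;> omega

theorem serreSeq_chev (hq : ∀ k : ℤ, k ≠ 0 → qInt q k ≠ 0) (b : Bool) :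
    SerreSeq q (chev q n r b) where
  comm i j h := by
    rcases lt_or_ge j r with hj | hj
    · lift i to Fin r using by omega
      lift j to Fin r using hj
      have hc := (cartanSl_of_add_two_le h).1
      cases b
      · rw [chev_false, chev_false, commF _ _ hc]
      · rw [chev_true, chev_true, commE _ _ hc]
    · simp [chev_of_le _ hj]
  serre_up i := by
    rcases lt_or_ge (i + 1) r with hj | hj
    · have hi : i < r := by omega
      have hc := (cartanSl_of_succ hi hj).1
      cases b
      · simpa [chev, hi, hj] using serreF hq _ _ hc
      · simpa [chev, hi, hj] using serreE hq _ _ hc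
    · simp [chev_of_le _ hj]
  serre_down i := by
    rcases lt_or_ge (i + 1) r with hj | hj
    · have hi : i < r := by omega
      have hc := (cartanSl_of_succ hi hj).2
      cases b
      · simpa [chev, hi, hj] using serreF hq _ _ hc
      · simpa [chev, hi, hj] using serreE hq _ _ hc
    · simp [chev_of_le _ hj]

theorem commute_chev_tower (hq : ∀ k : ℤ, k ≠ 0 → qInt q k ≠ 0) (b : Bool) {j a k : ℕ}
    (h : ∀ i, a ≤ i → i ≤ a + k → j ≠ i) :
    Commute (chev q n r (!b) j) (tower q (chev q n r b) a k) :=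
  commute_tower fun i h1 h2 => (chev_cross hq b (h i h1 h2).symm).symm

theorem qInt_add_one_sub (hq : ∀ k : ℤ, k ≠ 0 → qInt q k ≠ 0) (k : ℤ) :
    qInt q (k + 1) - qe q 1 * qInt q k = qe q (-k) := by
  rw [add_comm, qInt_add, qInt_one hq]; ring

theorem qInt_sub_add_one (hq : ∀ k : ℤ, k ≠ 0 → qInt q k ≠ 0) (k : ℤ) :
    qInt q k - qe q 1 * qInt q (k + 1) = -qe q 1 * qe q k := by
  rw [qInt_add, qInt_one hq]
  linear_combination (-qInt q k) * qe_mul_neg q 1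

/-- Commutator of a tower with the opposite Chevalley operator at the first node. -/
theorem comm_tower_first (hq : ∀ k : ℤ, k ≠ 0 → qInt q k ≠ 0) (b : Bool) (k : ℕ) (hr : 0 < r) :
    chev q n r (!b) 0 * tower q (chev q n r b) 0 (k + 1)
      - tower q (chev q n r b) 0 (k + 1) * chev q n r (!b) 0 =
      tower q (chev q n r b) 1 k * dg q fun d => qe q (sg b * wtN 0 d) := by
  have hc := (commute_chev_tower (q := q) (n := n) (r := r) hq b (j := 0) (a := 1) (k := k)
    (fun i h1 _ => by omega)).eq
  have hs := chev_self (n := n) hq b hr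
  have hH := dg_mul_tower (n := n) (q := q) (fun d => qInt q (-sg b * wtN (r := r) 0 d)) b 1 k
  rw [(serreSeq_chev hq b).tower_left, zero_add]
  generalize tower q (chev q n r b) 1 k = T at *
  have e : chev q n r (!b) 0 * qComm q (chev q n r b 0) T
      - qComm q (chev q n r b 0) T * chev q n r (!b) 0 =
      qComm q (chev q n r (!b) 0 * chev q n r b 0 - chev q n r b 0 * chev q n r (!b) 0) T := by
    have hc' : ∀ v, chev q n r (!b) 0 * (T * v) = T * (chev q n r (!b) 0 * v) := fun v => by
      rw [← mul_assoc, hc, mul_assoc]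
    simp only [qComm, mul_sub, sub_mul, mul_smul_comm, smul_mul_assoc, mul_assoc, hc, hc',
      smul_sub]
    abel
  rw [e, hs, qComm, hH, ← mul_smul_comm, ← mul_sub, smul_dg, dg_sub]
  congr 2
  funext d
  have hw : -sg b * wtN 0 (d + sg b • (unitDeg r (1 + k + 1) - unitDeg r 1)) =
      -sg b * wtN 0 d + 1 := by
    simp only [wtN, ent_add, ent_smul, ent_sub]
    rw [ent_unitDeg (by omega), ent_unitDeg (by omega), ent_unitDeg (by omega),
      ent_unitDeg (by omega), if_neg (by omega), if_pos rfl, if_neg (by omega), if_neg (by omega)]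
    linear_combination sg_mul_self b
  rw [hw, qInt_add_one_sub hq]
  congr 1; ring

/-- Commutator of a tower with the opposite Chevalley operator at the last node. -/
theorem comm_tower_last (hq : ∀ k : ℤ, k ≠ 0 → qInt q k ≠ 0) (b : Bool) (a k : ℕ)
    (hr : a + k + 1 < r) :
    chev q n r (!b) (a + k + 1) * tower q (chev q n r b) a (k + 1)
      - tower q (chev q n r b) a (k + 1) * chev q n r (!b) (a + k + 1) =
      (-qe q 1 • tower q (chev q n r b) a k) *
        dg q fun d => qe q (-sg b * wtN (a + k + 1) d) := by
  have hc := (commute_chev_tower (q := q) (n := n) (r := r) hq b (j := a + k + 1) (a := a) (k := k)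
    (fun i _ h2 => by omega)).eq
  have hs := chev_self (n := n) hq b hr
  have hH := dg_mul_tower (n := n) (q := q)
    (fun d => qInt q (-sg b * wtN (r := r) (a + k + 1) d)) b a k
  rw [tower]
  generalize tower q (chev q n r b) a k = T at *
  generalize chev q n r (!b) (a + k + 1) = e at *
  generalize chev q n r b (a + k + 1) = f at *
  have e : e * qComm q T f - qComm q T f * e = qComm q T (e * f - f * e) := by
    have hc' : ∀ v, e * (T * v) = T * (e * v) := fun v => by
      rw [← mul_assoc, hc, mul_assoc]
    simp only [qComm, mul_sub, sub_mul, mul_smul_comm, smul_mul_assoc, mul_assoc, hc, hc',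
      smul_sub]
    abel
  rw [e, hs, qComm, hH, ← mul_smul_comm, ← mul_sub, smul_dg, dg_sub, smul_mul_assoc,
    ← mul_smul_comm, smul_dg]
  congr 2
  funext d
  have hw : -sg b * wtN (a + k + 1) (d + sg b • (unitDeg r (a + k + 1) - unitDeg r a)) =
      -sg b * wtN (a + k + 1) d + 1 := by
    simp only [wtN, ent_add, ent_smul, ent_sub]
    rw [ent_unitDeg (by omega), ent_unitDeg (by omega), ent_unitDeg (by omega),
      ent_unitDeg (by omega), if_neg (by omega), if_neg (by omega), if_pos rfl, if_neg (by omega)]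
    linear_combination sg_mul_self b
  rw [hw, qInt_sub_add_one hq]

/-- A tower commutes with the opposite Chevalley operators at its inner nodes. -/
theorem commute_tower_inner (hq : ∀ k : ℤ, k ≠ 0 → qInt q k ≠ 0) (b : Bool) {a k j : ℕ}
    (h1 : a < j) (h2 : j < a + k) (hr : j < r) :
    Commute (chev q n r (!b) j) (tower q (chev q n r b) a k) := by
  obtain ⟨i, rfl⟩ : ∃ i, j = a + i + 1 := ⟨j - a - 1, by omega⟩
  obtain ⟨l, rfl⟩ : ∃ l, k = i + 2 + l := ⟨k - i - 2, by omega⟩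
  clear h1 h2
  induction l with
  | zero =>
    have h := comm_tower_last (n := n) hq b a i hr
    have hf := chev_cross (q := q) (n := n) (r := r) hq b
      (show a + i + 1 + 1 ≠ a + i + 1 by omega)
    have hT : Commute (chev q n r b (a + i + 1 + 1)) (tower q (chev q n r b) a i) :=
      commute_tower fun j h1 h2 => ((serreSeq_chev hq b).comm j _ (by omega)).symm
    have hK := dg_mul_chev (q := q) (n := n)
      (fun d => qe q (-sg b * wtN (r := r) (a + i + 1) d)) b (a + i + 1 + 1)
    have hw : ∀ d, -sg b * wtN (a + i + 1)
        (d + sg b • (unitDeg r (a + i + 1 + 1 + 1) - unitDeg r (a + i + 1 + 1))) =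
        1 + -sg b * wtN (a + i + 1) d := fun d => by
      simp only [wtN, ent_add, ent_smul, ent_sub]
      rw [ent_unitDeg (by omega), ent_unitDeg (by omega), ent_unitDeg (by omega),
        ent_unitDeg (by omega), if_neg (by omega), if_pos rfl, if_neg (by omega),
        if_neg (by omega)]
      linear_combination sg_mul_self b
    simp only [hw, qe_add] at hK
    rw [← smul_dg, mul_smul_comm] at hK
    rw [Commute, SemiconjBy, ← sub_eq_zero]
    change chev q n r (!b) (a + i + 1) *
      qComm q (tower q (chev q n r b) a (i + 1)) (chev q n r b (a + i + 1 + 1)) -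
      qComm q (tower q (chev q n r b) a (i + 1)) (chev q n r b (a + i + 1 + 1)) * _ = 0
    generalize tower q (chev q n r b) a (i + 1) = T' at *
    generalize tower q (chev q n r b) a i = T at *
    generalize chev q n r (!b) (a + i + 1) = e at *
    generalize chev q n r b (a + i + 1 + 1) = f at *
    generalize (dg q fun d => qe q (-sg b * wtN (a + i + 1) d)) = C at *
    have e1 : e * qComm q T' f - qComm q T' f * e = qComm q (e * T' - T' * e) f := by
      have hf' : ∀ v, f * (e * v) = e * (f * v) := fun v => by
        rw [← mul_assoc, hf, mul_assoc]
      simp only [qComm, mul_sub, sub_mul, mul_smul_comm, smul_mul_assoc, mul_assoc, hf, hf',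
        smul_sub]
      abel
    rw [e1, h, qComm, smul_mul_assoc, smul_mul_assoc, mul_assoc, hK, mul_smul_comm, ← mul_assoc,
      hT.eq.symm, mul_smul_comm, ← mul_assoc f T C, hT.eq]
    module
  | succ l ih =>
    exact commute_qComm ih (chev_cross hq b (show a + (i + 2 + l) + 1 ≠ a + i + 1 by omega)).symm

/-- The braid operator at node `k + 1` extends a tower ending at node `k` by one letter. -/
theorem braid_mul_tower (hq : ∀ k : ℤ, k ≠ 0 → qInt q k ≠ 0) (b : Bool) {k : ℕ}
    (hk : k + 1 < r) :
    braid q ⟨k + 1, hk⟩ * tower q (chev q n r b) 0 k =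
      ((if b then -qe q (-1) else 1 : K) • tower q (chev q n r b) 0 (k + 1))
        * braid q ⟨k + 1, hk⟩ := by
  set i : Fin r := ⟨k + 1, hk⟩ with hi
  have hwt : ∀ (b : Bool) (c j : ℕ) (_ : c = if j = k then 1 else 0) (_ : j ≤ k) (l : ℤ),
      chev q n r b j * wtP q i l = wtP q i (l + -sg b * c) * chev q n r b j := by
    intro b c j hc hj l
    rw [wtP, wtP, dg_mul_chev]
    congr 2
    funext d
    congr 1
    rw [← wtN_val, ← wtN_val]
    have hiv : (i : ℕ) = k + 1 := rfl
    simp only [wtN, ent_add, ent_smul, ent_sub, hiv]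
    have hcz : (if k + 1 = j + 1 then 1 else 0 : ℤ) = c := by
      rw [hc]; split_ifs <;> first | rfl | omega
    rw [ent_unitDeg (by omega), ent_unitDeg (by omega), ent_unitDeg (by omega),
      ent_unitDeg (by omega), hcz, if_neg (by omega), if_neg (by omega), if_neg (by omega)]
    apply propext
    constructor <;> intro h <;> linarith
  have hstep : braid q i * chev q n r b k =
      ((if b then -qe q (-1) else 1 : K) • qComm q (chev q n r b k) (chev q n r b (k + 1)))
        * braid q i := by
    have hcross := fun b => chev_cross (n := n) (r := r) hq b (show k + 1 ≠ k by omega)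
    have hcross' := fun b => chev_cross (n := n) (r := r) hq b (show k ≠ k + 1 by omega)
    have hself := chev_self (n := n) hq b hk
    have hH := dg_mul_chev (q := q) (n := n)
      (fun d => qInt q (-sg b * wtN (r := r) (k + 1) d)) b k
    have hw : ∀ d, -sg b * wtN (k + 1) (d + sg b • (unitDeg r (k + 1) - unitDeg r k)) =
        -sg b * wtN (k + 1) d + 1 := fun d => by
      simp only [wtN, ent_add, ent_smul, ent_sub]
      rw [ent_unitDeg (by omega), ent_unitDeg (by omega), ent_unitDeg (by omega),
        ent_unitDeg (by omega), if_neg (by omega), if_neg (by omega), if_pos rfl, if_neg (by omega)]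
      linear_combination sg_mul_self b
    simp only [hw] at hH
    have hserre := (serreSeq_chev (n := n) (r := r) hq b).serre_down k
    have hB : qComm q (chev q n r b k) (chev q n r b (k + 1)) =
        -qe q 1 • (chev q n r b (k + 1) * chev q n r b k
          - qe q (-1) • (chev q n r b k * chev q n r b (k + 1))) := by
      rw [qComm, smul_sub, smul_smul, neg_mul, qe_mul_neg]; module
    -- the lowest weight vector of the doublet spanned by the root vectors at `k` and `(k, k + 1)`
    have hfB : ∀ (x y : Module.End K (QExt q n (r + 1))),
        y * y * x - qInt q 2 • (y * x * y) + x * y * y = 0 →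
        y * (y * x - qe q (-1) • (x * y)) = qe q 1 • ((y * x - qe q (-1) • (x * y)) * y) := by
      intro x y h
      rw [← sub_eq_zero, ← h, qInt_two hq]
      simp only [mul_sub, sub_mul, smul_sub, mul_smul_comm, smul_mul_assoc, smul_smul, qe_mul_neg,
        mul_assoc]
      module
    have hFx : ∀ (x y f H H' : Module.End K (QExt q n (r + 1))), f * x = x * f →
        f * y - y * f = H → H * x = x * H' →
        f * (y * x - qe q (-1) • (x * y)) =
          (y * x - qe q (-1) • (x * y)) * f + x * (H' - qe q (-1) • H) := by
      intro x y f H H' h1 h2 h3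
      have h1' : ∀ v, f * (x * v) = x * (f * v) := fun v => by rw [← mul_assoc, h1, mul_assoc]
      have h2' : f * y = H + y * f := by rw [← h2]; abel
      have h2'' : ∀ v, f * (y * v) = H * v + y * (f * v) := fun v => by
        rw [← mul_assoc, h2', add_mul, mul_assoc]
      simp only [mul_sub, sub_mul, mul_smul_comm, smul_mul_assoc, mul_assoc, h1', h2', h2'', h1,
        h3, mul_add]
      module
    have hHH : (dg (n := n) q fun d => qInt q (-sg b * wtN (r := r) (k + 1) d + 1))
        - qe q (-1) • (dg q fun d => qInt q (-sg b * wtN (k + 1) d)) =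
        dg q fun d => qe q (-sg b * wtN (k + 1) d) := by
      rw [smul_dg, dg_sub]
      congr 1
      funext d
      rw [qInt_add, qInt_one hq]; ring
    have hE := chev_true (q := q) (n := n) i
    have hF := chev_false (q := q) (n := n) i
    have hi' : (i : ℕ) = k + 1 := rfl
    have hfx := hFx _ _ _ _ _ (hcross' b).symm hself hH
    rw [hHH] at hfx
    rw [hi'] at hE hF
    cases b
    · rw [if_neg (by simp), one_smul, hB, smul_mul_assoc]
      refine braid_mul_of_commute_opE hq i ?_ ?_ ?_ ?_ fun l => ?_
      · rw [← hE]; exact hcross true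
      · rw [← hF]; abel
      · rw [← hF]; exact hfB _ _ hserre
      · rw [← hE]
        refine hfx.trans ?_
        simp only [sg, opK, ← wtN_val]
        rfl
      · rw [hwt false 1 k (by simp) le_rfl]; simp [sg]
    · rw [if_pos rfl, hB, smul_smul, neg_mul_neg, mul_comm, qe_mul_neg, one_smul]
      refine braid_mul_of_commute_opF hq i ?_ ?_ ?_ ?_ fun l => ?_
      · rw [← hF]; exact hcross false
      · rw [← hE]; abel
      · rw [← hE]; exact hfB _ _ hserre
      · rw [← hF]
        refine hfx.trans ?_
        simp only [sg, opK, ← wtN_val]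
        rfl
      · rw [hwt true 1 k (by simp) le_rfl]; simp [sg, sub_eq_add_neg]
  cases k with
  | zero => exact hstep
  | succ k =>
    have hT : Commute (braid q i) (tower q (chev q n r b) 0 k) := by
      refine commute_tower fun j _ hj => ?_
      have hjr : j < r := by omega
      refine braid_mul_of_commute hq i ?_ ?_ fun l => ?_
      · have hE := chev_true (q := q) (n := n) i
        rw [← hE]
        cases b
        · exact chev_cross hq true (show k + 1 + 1 ≠ j by omega)
        · exact ((serreSeq_chev hq true).comm j _ (show j + 2 ≤ k + 1 + 1 by omega)).symm
      · have hF := chev_false (q := q) (n := n) i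
        rw [← hF]
        cases b
        · exact ((serreSeq_chev hq false).comm j _ (show j + 2 ≤ k + 1 + 1 by omega)).symm
        · exact chev_cross hq false (show k + 1 + 1 ≠ j by omega)
      · rw [hwt b 0 j (by rw [if_neg (by omega)]) (by omega)]; simp
    have hT' : ∀ v, braid q i * (tower q (chev q n r b) 0 k * v) =
        tower q (chev q n r b) 0 k * (braid q i * v) := fun v => by
      rw [← mul_assoc, hT.eq, mul_assoc]
    have e : tower q (chev q n r b) 0 (k + 1 + 1) = qComm q (tower q (chev q n r b) 0 k)
        (qComm q (chev q n r b (k + 1)) (chev q n r b (k + 1 + 1))) := by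
      have hc : tower q (chev q n r b) 0 k * chev q n r b (0 + (k + 1) + 1) =
          chev q n r b (0 + (k + 1) + 1) * tower q (chev q n r b) 0 k :=
        (commute_tower fun j _ h => ((serreSeq_chev hq b).comm j _ (by omega)).symm).symm.eq
      rw [tower, tower, qComm_assoc hc]
      simp only [zero_add]
    rw [e, tower, zero_add]
    simp only [qComm] at hstep ⊢
    simp only [mul_sub, sub_mul, mul_smul_comm, smul_mul_assoc, mul_assoc, smul_sub] at hstep ⊢
    simp only [hT', hstep, mul_sub, mul_smul_comm]
    simp only [← mul_assoc, hstep, sub_mul, smul_mul_assoc, smul_sub]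
    simp only [mul_assoc, hT.eq, smul_smul]
    module

end Chev

/-! ### Conjugation by the braid operators -/

section Conjugation

variable {K : Type*} [Field K] {q : Kˣ} {n r s : ℕ}

theorem isUnit_dg {m : ℕ} {f : (Fin m → ℤ) → K} (hf : ∀ d, f d ≠ 0) : IsUnit (dg (n := n) q f) := by
  refine ⟨⟨dg q f, dg q fun d => (f d)⁻¹, ?_, ?_⟩, rfl⟩ <;>
  · rw [dg_mul_dg, ← dg_one]
    simp [hf]

theorem braidGl_eq (i : Fin r) : braidGl (n := n) q i =
    braid q i * dg q fun d => (((-1 : Kˣ) ^ d i.succ : Kˣ) : K) * qe q (-d i.succ) := by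
  rw [braidGl, dg]
  congr 2

theorem isUnit_braidGl (hq : ∀ k : ℤ, k ≠ 0 → qInt q k ≠ 0) (i : Fin r) :
    IsUnit (braidGl (n := n) q i) := by
  rw [braidGl_eq]
  exact (isUnit_braid hq i).mul (isUnit_dg fun d => mul_ne_zero (Units.ne_zero _) (qe_ne_zero q _))

theorem foldl_finRange {α : Type*} (s : ℕ) (f : α → Fin s → α) (g : ℕ → α)
    (h : ∀ i : Fin s, f (g i) i = g (i + 1)) : (List.finRange s).foldl f (g 0) = g s := by
  induction s with
  | zero => rfl
  | succ s ih =>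
    rw [List.finRange_succ_last, List.foldl_append, List.foldl_map,
      ih _ fun i => by simpa using h i.castSucc]
    simpa using h (Fin.last s)

theorem conjBy_eq {m : ℕ} {T X Y : Module.End K (QExt q n m)} (hT : IsUnit T)
    (h : T * X = Y * T) : conjBy q T X = Y := by
  rw [conjBy, h, mul_assoc, Ring.mul_inverse_cancel _ hT, mul_one]

theorem conjTower_eq (T : Fin (s + 1) → Module.End K (QExt q n (s + 1 + 1)))
    (g : ℕ → Module.End K (QExt q n (s + 1 + 1))) (hT : ∀ i, IsUnit (T i))
    (h : ∀ i : Fin s, T i.succ * g i = g (i + 1) * T i.succ) : conjTower q T (g 0) = g s :=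
  foldl_finRange s _ g fun i => conjBy_eq (hT i.succ) (h i)

/-- The family `T` extends root vectors along the diagram as the braid operators do. -/
structure ExtendsTowers (T : Fin (s + 1) → Module.End K (QExt q n (s + 1 + 1))) : Prop where
  isUnit : ∀ i, IsUnit (T i)
  mul_tower : ∀ (b : Bool) (i : Fin s), T i.succ * tower q (chev q n (s + 1) b) 0 i =
    ((if b then -qe q (-1) else 1 : K) • tower q (chev q n (s + 1) b) 0 (i + 1)) * T i.succ

theorem extendsTowers_braid (hq : ∀ k : ℤ, k ≠ 0 → qInt q k ≠ 0) :
    ExtendsTowers (s := s) (braid (n := n) q) where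
  isUnit := isUnit_braid hq
  mul_tower b i := braid_mul_tower hq b (k := i) (by omega)

/-- The rescaling that turns `T''_i` into `T_i` depends on a part of the multidegree which the root
vectors concerned do not change. -/
theorem extendsTowers_braidGl (hq : ∀ k : ℤ, k ≠ 0 → qInt q k ≠ 0) :
    ExtendsTowers (s := s) (braidGl (n := n) q) where
  isUnit := isUnit_braidGl hq
  mul_tower b i := by
    have h : ∀ d : Fin (s + 1 + 1) → ℤ,
        (d + sg b • (unitDeg (s + 1) (0 + i + 1) - unitDeg (s + 1) 0)) i.succ.succ =
          d i.succ.succ := fun d => by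
      simp [unitDeg]
    rw [braidGl_eq, mul_assoc, dg_mul_tower]
    simp only [h]
    rw [← mul_assoc, (extendsTowers_braid hq).mul_tower, mul_assoc]

theorem ExtendsTowers.conjTower_opF {T : Fin (s + 1) → Module.End K (QExt q n (s + 1 + 1))}
    (hT : ExtendsTowers T) :
    conjTower q T (opF q 0) = tower q (chev q n (s + 1) false) 0 s := by
  rw [show opF q 0 = tower q (chev q n (s + 1) false) 0 0 from (chev_false 0).symm]
  refine conjTower_eq T _ hT.isUnit fun i => ?_
  simpa using hT.mul_tower false i

theorem ExtendsTowers.conjTower_opE {T : Fin (s + 1) → Module.End K (QExt q n (s + 1 + 1))}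
    (hT : ExtendsTowers T) :
    conjTower q T (opE q 0) = (-qe q (-1)) ^ s • tower q (chev q n (s + 1) true) 0 s := by
  have h0 : opE (n := n) q 0 = (-qe q (-1)) ^ 0 • tower q (chev q n (s + 1) true) 0 0 := by
    rw [pow_zero, one_smul]; exact (chev_true 0).symm
  rw [h0]
  refine conjTower_eq T (fun k => (-qe q (-1)) ^ k • tower q (chev q n (s + 1) true) 0 k) hT.isUnit
    fun i => ?_
  have := hT.mul_tower true i
  rw [if_pos rfl] at this
  rw [mul_smul_comm, this, smul_mul_assoc, smul_mul_assoc, smul_smul, ← pow_succ]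

theorem ent_reflect (k j : ℕ) (hk : k < r) (hj : j < r + 1) (d : Fin (r + 1) → ℤ) :
    ent j (reflect ⟨k, hk⟩ d) =
      ent (if j = k then k + 1 else if j = k + 1 then k else j) d := by
  split_ifs with h1 h2
  · subst h1
    rw [ent, dif_pos hj, ent, dif_pos (by omega)]
    simp only [reflect, Function.comp_apply]
    congr 1
    exact Equiv.swap_apply_left _ _
  · subst h2
    rw [ent, dif_pos hj, ent, dif_pos (by omega)]
    simp only [reflect, Function.comp_apply]
    congr 1
    exact Equiv.swap_apply_right _ _
  · rw [ent, dif_pos hj, ent, dif_pos hj]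
    simp only [reflect, Function.comp_apply]
    congr 1
    refine Equiv.swap_apply_of_ne_of_ne ?_ ?_ <;> simpa [Fin.ext_iff] using by assumption

/-- The commutator of opposite root vectors, transported from the simple ones by the braid
operators. -/
theorem comm_tower_tower (hq : ∀ k : ℤ, k ≠ 0 → qInt q k ≠ 0) {k : ℕ} (hk : k < r) :
    (-qe q (-1)) ^ k • (tower q (chev q n r false) 0 k * tower q (chev q n r true) 0 k
      - tower q (chev q n r true) 0 k * tower q (chev q n r false) 0 k) =
      dg q fun d => qInt q (ent 0 d - ent (k + 1) d) := by
  induction k with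
  | zero =>
    have := chev_self (n := n) hq true hk
    rw [pow_zero, one_smul]
    refine this.trans ?_
    congr 1
    funext d
    simp [sg, wtN]
  | succ k ih =>
    have hf := braid_mul_tower (n := n) hq false hk
    have ht := braid_mul_tower (n := n) hq true hk
    have hd := dg_mul_braid (n := n) hq ⟨k + 1, hk⟩ fun d => qInt q (ent 0 d - ent (k + 1 + 1) d)
    simp only [ent_reflect (k + 1) 0 hk (by omega), ent_reflect (k + 1) (k + 1 + 1) hk (by omega),
      if_neg (show 0 ≠ k + 1 by omega), if_neg (show 0 ≠ k + 1 + 1 by omega),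
      if_neg (show k + 1 + 1 ≠ k + 1 by omega), if_true] at hd
    rw [← ih (by omega)] at hd
    refine (isUnit_braid hq ⟨k + 1, hk⟩).mul_left_injective ?_
    dsimp only
    rw [hd]
    rw [if_neg (by simp), one_smul] at hf
    rw [if_pos rfl] at ht
    generalize tower q (chev q n r false) 0 k = X at *
    generalize tower q (chev q n r true) 0 k = Y at *
    generalize tower q (chev q n r false) 0 (k + 1) = X' at *
    generalize tower q (chev q n r true) 0 (k + 1) = Y' at *
    generalize braid q ⟨k + 1, hk⟩ = T at *
    generalize (-qe q (-1) : K) = c at *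
    have e1 : T * (X * Y) = c • (X' * Y' * T) := by
      rw [← mul_assoc, hf, mul_assoc, ht, smul_mul_assoc, mul_smul_comm, mul_assoc]
    have e2 : T * (Y * X) = c • (Y' * X' * T) := by
      rw [← mul_assoc, ht, mul_assoc, hf, smul_mul_assoc, mul_assoc]
    rw [mul_smul_comm, mul_sub, e1, e2, smul_mul_assoc, sub_mul, pow_succ]
    module

end Conjugation

/-! ### The affine root vectors -/

section Affine

variable {K : Type*} [Field K] {q : Kˣ} {n r s : ℕ}

/-- The operator `A` raises the multidegree by `e`. -/
def Shifts (A : Module.End K (QExt q n (r + 1))) (e : Fin (r + 1) → ℤ) : Prop :=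
  ∀ f : (Fin (r + 1) → ℤ) → K, dg q f * A = A * dg q fun d => f (d + e)

theorem shifts_chev (b : Bool) (j : ℕ) :
    Shifts (chev q n r b j) (sg b • (unitDeg r (j + 1) - unitDeg r j)) :=
  fun f => dg_mul_chev f b j

theorem shifts_tower (b : Bool) (a k : ℕ) :
    Shifts (tower q (chev q n r b) a k) (sg b • (unitDeg r (a + k + 1) - unitDeg r a)) :=
  fun f => dg_mul_tower f b a k

theorem Shifts.smul {A : Module.End K (QExt q n (r + 1))} {e} (h : Shifts A e) (c : K) :
    Shifts (c • A) e := fun f => by rw [mul_smul_comm, h, smul_mul_assoc]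

theorem Shifts.mul_dg {A : Module.End K (QExt q n (r + 1))} {e} (h : Shifts A e)
    (g : (Fin (r + 1) → ℤ) → K) : Shifts (A * dg q g) e := fun f => by
  rw [← mul_assoc, h, mul_assoc, dg_comm, mul_assoc]

/-- An operator which shifts the multidegree `q`-commutes with the powers of `q`. -/
theorem Shifts.dg_qe_mul {A : Module.End K (QExt q n (r + 1))} {e} (h : Shifts A e)
    {φ : (Fin (r + 1) → ℤ) → ℤ} {t : ℤ} (hφ : ∀ d, φ (d + e) = t + φ d) :
    (dg q fun d => qe q (φ d)) * A = qe q t • (A * dg q fun d => qe q (φ d)) := by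
  rw [h, ← mul_smul_comm, smul_dg]
  simp only [hφ, qe_add]

/-- The sum of the first and the last entry of a multidegree. -/
def ends (d : Fin (r + 1) → ℤ) : ℤ := ent 0 d + ent r d

theorem endsOp_eq (c : ℤ) :
    endsOp (n := n) (s := s) q c = dg q fun d => qe q (c * ends d) := by
  rw [endsOp, dg]
  congr 1
  funext a
  have h0 := ent_val (0 : Fin (s + 1 + 1)) fun j => (a j : ℤ)
  have h1 := ent_val (Fin.last (s + 1)) fun j => (a j : ℤ)
  rw [Fin.val_zero] at h0
  rw [Fin.val_last] at h1
  rw [ends, h0, h1]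
  rfl

variable (q n r) in
/-- The affine root vector: the root vector of the highest root times a power of `q` depending on
the ends of the multidegree. Up to scalars, it is the image of `E_0` for `b = false` and of `F_0`
for `b = true`. -/
def affOp (b : Bool) : Module.End K (QExt q n (r + 1)) :=
  tower q (chev q n r b) 0 (r - 1) * dg q fun d => qe q (sg b * ends d)

theorem ends_add (d e : Fin (r + 1) → ℤ) : ends (d + e) = ends e + ends d := by
  simp only [ends, ent_add]; ring

theorem ends_smul (c : ℤ) (d : Fin (r + 1) → ℤ) : ends (c • d) = c * ends d := by
  simp only [ends, ent_smul]; ring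

theorem ends_sub (d e : Fin (r + 1) → ℤ) : ends (d - e) = ends d - ends e := by
  simp only [ends, ent_sub]; ring

theorem ends_unitDeg_zero (hr : 0 < r) : ends (unitDeg r 0) = 1 := by
  rw [ends, ent_unitDeg (by omega), ent_unitDeg (by omega), if_pos rfl, if_neg (by omega)]; rfl

theorem ends_unitDeg_last (hr : 0 < r) : ends (unitDeg r r) = 1 := by
  rw [ends, ent_unitDeg (by omega), ent_unitDeg (by omega), if_pos rfl, if_neg (by omega)]; rfl

theorem ends_unitDeg_of_ne {j : ℕ} (h0 : 0 < j) (hr : j < r) : ends (unitDeg r j) = 0 := by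
  rw [ends, ent_unitDeg (by omega), ent_unitDeg (by omega), if_neg (by omega), if_neg (by omega)]
  rfl

theorem wtN_add (j : ℕ) (d e : Fin (r + 1) → ℤ) : wtN j (d + e) = wtN j e + wtN j d := by
  simp only [wtN, ent_add]; ring

theorem wtN_smul_sub (j : ℕ) (c : ℤ) (d e : Fin (r + 1) → ℤ) :
    wtN j (c • (d - e)) = c * (wtN j d - wtN j e) := by
  simp only [wtN, ent_smul, ent_sub]; ring

theorem wtN_unitDeg {i j : ℕ} (h : i < r) : wtN i (unitDeg r j) =
    (if i + 1 = j then 1 else 0) - (if i = j then 1 else 0) := by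
  rw [wtN, ent_unitDeg (by omega), ent_unitDeg (by omega)]

theorem shifts_affOp (b : Bool) (hr : 0 < r) :
    Shifts (affOp q n r b) (sg b • (unitDeg r r - unitDeg r 0)) := by
  have h := (shifts_tower (q := q) (n := n) (r := r) b 0 (r - 1)).mul_dg
    fun d => qe q (sg b * ends d)
  rwa [show 0 + (r - 1) + 1 = r by omega] at h

theorem dg_ends_mul_tower (b : Bool) (hr : 0 < r) (c : ℤ) :
    (dg q fun d => qe q (c * ends d)) * tower q (chev q n r b) 0 (r - 1) =
      tower q (chev q n r b) 0 (r - 1) * dg q fun d => qe q (c * ends d) := by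
  have h := (shifts_tower (q := q) (n := n) (r := r) b 0 (r - 1)).dg_qe_mul
    (φ := fun d => c * ends d) (t := 0) fun d => by
      rw [show 0 + (r - 1) + 1 = r by omega, ends_add, ends_smul, ends_sub, ends_unitDeg_zero hr,
        ends_unitDeg_last hr]
      ring
  rwa [qe_zero, one_smul] at h

/-- The affine root vector commutes with the Chevalley operators of the same half, which are the
opposite ones from the affine point of view. -/
theorem commute_chev_affOp (hq : ∀ k : ℤ, k ≠ 0 → qInt q k ≠ 0) (b : Bool) (j : ℕ) :
    Commute (chev q n r b j) (affOp q n r b) := by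
  rcases le_or_gt r j with hj | hj
  · rw [chev_of_le b hj]; exact Commute.zero_left _
  rcases Nat.lt_or_ge 1 r with hr | hr
  · obtain ⟨k, rfl⟩ : ∃ k, r = k + 2 := ⟨r - 2, by omega⟩
    have hS := serreSeq_chev (q := q) (n := n) (r := k + 2) hq b
    rw [affOp, Commute, SemiconjBy, show k + 2 - 1 = k + 1 by omega]
    have hD : ∀ t, ends (sg b • (unitDeg (k + 2) (j + 1) - unitDeg (k + 2) j)) * sg b = t →
        (dg q fun d => qe q (sg b * ends d)) * chev q n (k + 2) b j =
          qe q t • (chev q n (k + 2) b j * dg q fun d => qe q (sg b * ends d)) := fun t ht =>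
      (shifts_chev b j).dg_qe_mul fun d => by rw [ends_add, ← ht]; ring
    rw [ends_smul, ends_sub] at hD
    rw [mul_assoc]
    rcases Nat.eq_zero_or_pos j with rfl | h0
    · rw [hD (-1), mul_smul_comm, ← mul_assoc, ← mul_assoc, hS.first_mul_tower hq,
        smul_mul_assoc]
      rw [ends_unitDeg_of_ne (by omega) (by omega), ends_unitDeg_zero (by omega)]
      linear_combination (-1) * sg_mul_self b
    rcases Nat.lt_or_ge j (k + 1) with h1 | h1
    · rw [hD 0, qe_zero, one_smul, ← mul_assoc, ← mul_assoc,
        (hS.commute_middle hq (by omega : 0 < j) (by omega : j < 0 + (k + 1))).eq]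
      rw [ends_unitDeg_of_ne (by omega) (by omega), ends_unitDeg_of_ne (by omega) (by omega)]
      ring
    · obtain rfl : j = k + 1 := by omega
      have hl := hS.tower_mul_last hq 0 k
      rw [zero_add] at hl
      rw [hD 1, mul_smul_comm, ← mul_assoc, ← mul_assoc, hl, smul_mul_assoc, smul_smul,
        qe_mul_neg, one_smul]
      rw [ends_unitDeg_of_ne (j := k + 1) (by omega) (by omega), ends_unitDeg_last (by omega)]
      linear_combination sg_mul_self b
  · obtain rfl : r = 1 := by omega
    obtain rfl : j = 0 := by omega
    have h := dg_ends_mul_tower (q := q) (n := n) b one_pos (sg b)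
    change _ * chev q n 1 b 0 = chev q n 1 b 0 * _ at h
    change _ * (chev q n 1 b 0 * _) = (chev q n 1 b 0 * _) * _
    rw [mul_assoc, h]

/-- The affine root vector commutes with the opposite Chevalley operators at the nodes not adjacent
to the affine one. -/
theorem commute_chev_not_affOp (hq : ∀ k : ℤ, k ≠ 0 → qInt q k ≠ 0) (b : Bool) {j : ℕ}
    (h0 : 0 < j) (hj : j + 1 < r) : Commute (chev q n r (!b) j) (affOp q n r b) := by
  refine (commute_tower_inner hq b h0 (by omega) (by omega)).mul_right ?_
  have h := (shifts_chev (q := q) (n := n) (r := r) (!b) j).dg_qe_mul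
    (φ := fun d => sg b * ends d) (t := 0) fun d => by
      rw [ends_add, ends_smul, ends_sub, ends_unitDeg_of_ne (by omega) (by omega),
        ends_unitDeg_of_ne (by omega) (by omega)]
      ring
  rw [qe_zero, one_smul] at h
  exact h.symm

/-- The Serre relations between the affine root vector and the opposite Chevalley operator at the
first node of the diagram of rank at least two. -/
theorem serre_affOp_first (hq : ∀ k : ℤ, k ≠ 0 → qInt q k ≠ 0) (b : Bool) (hr : 1 < r) :
    chev q n r (!b) 0 * chev q n r (!b) 0 * affOp q n r b
        - qInt q 2 • (chev q n r (!b) 0 * affOp q n r b * chev q n r (!b) 0)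
        + affOp q n r b * chev q n r (!b) 0 * chev q n r (!b) 0 = 0 ∧
      affOp q n r b * affOp q n r b * chev q n r (!b) 0
        - qInt q 2 • (affOp q n r b * chev q n r (!b) 0 * affOp q n r b)
        + chev q n r (!b) 0 * affOp q n r b * affOp q n r b = 0 := by
  obtain ⟨k, rfl⟩ : ∃ k, r = k + 2 := ⟨r - 2, by omega⟩
  have hS := serreSeq_chev (q := q) (n := n) (r := k + 2) hq b
  have hm := sg_mul_self b
  refine serre_affine hq 1 (Or.inl rfl) (comm_tower_first hq b k (by omega)) ?_ ?_ ?_ ?_ ?_ ?_ ?_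
    (dg_comm _ _)
  · refine (shifts_chev _ _).dg_qe_mul fun d => ?_
    rw [ends_add, ends_smul, ends_sub, ends_unitDeg_of_ne (by omega) (by omega),
      ends_unitDeg_zero (by omega), sg_not]
    linear_combination hm
  · refine (shifts_chev _ _).dg_qe_mul fun d => ?_
    rw [wtN_add, wtN_smul_sub, wtN_unitDeg (by omega), wtN_unitDeg (by omega), sg_not,
      if_pos rfl, if_neg (by omega), if_neg (by omega), if_pos rfl]
    linear_combination -2 * hm
  · exact (commute_chev_tower hq b fun i h1 _ => by omega).eq
  · exact dg_ends_mul_tower b (by omega) _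
  · refine (shifts_tower _ _ _).dg_qe_mul fun d => ?_
    rw [wtN_add, wtN_smul_sub, wtN_unitDeg (by omega), wtN_unitDeg (by omega),
      if_neg (by omega), if_neg (by omega), if_neg (by omega), if_pos rfl]
    linear_combination hm
  · refine (shifts_tower _ _ _).dg_qe_mul fun d => ?_
    rw [ends_add, ends_smul, ends_sub, ends_unitDeg_of_ne (j := 1) (by omega) (by omega),
      show 1 + k + 1 = k + 2 by omega, ends_unitDeg_last (by omega)]
    linear_combination hm
  · have h := hS.tower_mul_final hq 0 k
    rw [show k + 2 - 1 = k + 1 by omega]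
    rw [h, smul_smul, qe_mul_neg, one_smul]

/-- The Serre relations between the affine root vector and the opposite Chevalley operator at the
last node of the diagram of rank at least two. -/
theorem serre_affOp_last (hq : ∀ k : ℤ, k ≠ 0 → qInt q k ≠ 0) (b : Bool) {j : ℕ} (hj : 0 < j)
    (hr : j + 1 = r) :
    chev q n r (!b) j * chev q n r (!b) j * affOp q n r b
        - qInt q 2 • (chev q n r (!b) j * affOp q n r b * chev q n r (!b) j)
        + affOp q n r b * chev q n r (!b) j * chev q n r (!b) j = 0 ∧
      affOp q n r b * affOp q n r b * chev q n r (!b) j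
        - qInt q 2 • (affOp q n r b * chev q n r (!b) j * affOp q n r b)
        + chev q n r (!b) j * affOp q n r b * affOp q n r b = 0 := by
  obtain ⟨k, rfl⟩ : ∃ k, j = k + 1 := ⟨j - 1, by omega⟩
  subst hr
  have hS := serreSeq_chev (q := q) (n := n) (r := k + 1 + 1) hq b
  have hm := sg_mul_self b
  have hc := comm_tower_last (n := n) hq b 0 k (r := k + 1 + 1) (by omega)
  rw [zero_add] at hc
  refine serre_affine hq (-1) (Or.inr rfl) hc ?_ ?_ ?_ ?_ ?_ ?_ ?_ (dg_comm _ _)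
  · refine (shifts_chev _ _).dg_qe_mul fun d => ?_
    rw [ends_add, ends_smul, ends_sub, ends_unitDeg_of_ne (j := k + 1) (by omega) (by omega),
      ends_unitDeg_last (by omega), sg_not]
    linear_combination -hm
  · refine (shifts_chev _ _).dg_qe_mul fun d => ?_
    rw [wtN_add, wtN_smul_sub, wtN_unitDeg (by omega), wtN_unitDeg (by omega), sg_not,
      if_pos rfl, if_neg (by omega), if_neg (by omega), if_pos rfl]
    linear_combination 2 * hm
  · exact ((commute_chev_tower hq b fun i _ h2 => by omega).smul_right _).eq
  · exact dg_ends_mul_tower b (by omega) _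
  · refine (shifts_tower _ _ _).dg_qe_mul fun d => ?_
    rw [wtN_add, wtN_smul_sub, wtN_unitDeg (by omega), wtN_unitDeg (by omega),
      if_pos (by omega), if_neg (by omega), if_neg (by omega), if_neg (by omega)]
    linear_combination -hm
  · refine ((shifts_tower _ _ _).smul _).dg_qe_mul fun d => ?_
    rw [ends_add, ends_smul, ends_sub, ends_unitDeg_of_ne (j := 0 + k + 1) (by omega) (by omega),
      ends_unitDeg_zero (by omega)]
    linear_combination -hm
  · have h := hS.initial_mul_tower hq 0 k le_rfl
    rw [show k + 1 + 1 - 1 = k + 1 by omega, smul_mul_assoc, h, mul_smul_comm, smul_comm]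

/-- The cubic Serre relation for `x` and `y` when the commutator of `x` and `y` is a Cartan
element. -/
theorem cubic_serre_of_comm {R : Type*} [Ring R] [Algebra K R] {x y h h' h'' : R}
    (hxy : x * y - y * x = h) (hx : h * x = x * h') (hx' : h' * x = x * h'')
    (hh : h + h'' = (qInt q 3 - 1) • h') :
    x * x * x * y - qInt q 3 • (x * x * y * x) + qInt q 3 • (x * y * x * x)
      - y * x * x * x = 0 := by
  have e : x * x * x * y - qInt q 3 • (x * x * y * x) + qInt q 3 • (x * y * x * x)
      - y * x * x * x = x * x * (x * y - y * x) + x * (x * y - y * x) * x + (x * y - y * x) * x * x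
        - qInt q 3 • (x * (x * y - y * x) * x) := by
    simp only [mul_sub, sub_mul, smul_sub, mul_assoc]; abel
  rw [e, hxy, mul_assoc x h, hx, mul_assoc x h', hx', ← mul_assoc, ← mul_assoc]
  have e2 : x * x * h + x * x * h' + x * x * h'' - qInt q 3 • (x * x * h') =
      x * x * (h + h'') - (qInt q 3 - 1) • (x * x * h') := by
    rw [mul_add]; module
  rw [e2, hh, mul_smul_comm, sub_self]

theorem qInt_add_qInt_add_four (hq : ∀ k : ℤ, k ≠ 0 → qInt q k ≠ 0) (k : ℤ) :
    qInt q k + qInt q (k + 4) = (qInt q 3 - 1) * qInt q (k + 2) := by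
  have h1 := qInt_add (q := q) (k + 2) (-2)
  have h2 := qInt_add (q := q) (k + 2) 2
  rw [show k + 2 + -2 = k by ring, qInt_neg, neg_neg] at h1
  rw [show k + 2 + 2 = k + 4 by ring] at h2
  rw [qInt_three hq, h1, h2]
  ring

/-- The Serre relations of affine `sl_2`. Here the affine root vector is the opposite Chevalley
operator times a diagonal operator which commutes with everything in sight. -/
theorem serre_affOp_one (hq : ∀ k : ℤ, k ≠ 0 → qInt q k ≠ 0) (b : Bool)
    {X Y : Module.End K (QExt q n (1 + 1))} (hX : X = chev q n 1 (!b) 0)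
    (hY : Y = affOp q n 1 b) :
    X * X * X * Y - qInt q 3 • (X * X * Y * X) + qInt q 3 • (X * Y * X * X) - Y * X * X * X = 0 ∧
    Y * Y * Y * X - qInt q 3 • (Y * Y * X * Y) + qInt q 3 • (Y * X * Y * Y)
      - X * Y * Y * Y = 0 := by
  have h := chev_self (n := n) hq b one_pos
  have hDY := dg_ends_mul_tower (q := q) (n := n) b one_pos (sg b)
  have hDX := dg_ends_mul_tower (q := q) (n := n) (!b) one_pos (sg b)
  have hw (b' : Bool) (f : ℤ → K) : (dg q fun d => f (sg b' * wtN 0 d)) * chev q n 1 b' 0 =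
      chev q n 1 b' 0 * dg q fun d => f (sg b' * wtN 0 d + 2) := by
    rw [shifts_chev b' 0]
    congr 2
    funext d
    rw [wtN_add, wtN_smul_sub, wtN_unitDeg one_pos, wtN_unitDeg one_pos]
    congr 1
    simp only [zero_add, if_true, one_ne_zero, zero_ne_one, if_false]
    linear_combination 2 * sg_mul_self b'
  change _ * chev q n 1 b 0 = chev q n 1 b 0 * _ at hDY
  change _ * chev q n 1 (!b) 0 = chev q n 1 (!b) 0 * _ at hDX
  change Y = chev q n 1 b 0 * _ at hY
  rw [← hX] at h hDX
  have key (b' : Bool) {x y : Module.End K (QExt q n (1 + 1))} (hx : x = chev q n 1 b' 0)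
      (hxy : x * y - y * x = dg q fun d => qInt q (sg b' * wtN 0 d)) :
      x * x * x * y - qInt q 3 • (x * x * y * x) + qInt q 3 • (x * y * x * x)
        - y * x * x * x = 0 := by
    have h1 := hw b' (qInt q)
    have h2 := hw b' fun k => qInt q (k + 2)
    rw [← hx] at h1 h2
    refine cubic_serre_of_comm hxy h1 h2 ?_
    refine ext_mon fun l => ?_
    have h4 := qInt_add_qInt_add_four hq (sg b' * wtN 0 (mdeg l))
    simp only [LinearMap.add_apply, LinearMap.smul_apply, dg_mon, smul_smul, ← add_smul, ← h4]
    rw [add_assoc]; rfl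
  have hE := key (!b) hX (by rw [h, sg_not])
  have hF := key b rfl (y := X) (by
    rw [← neg_sub, h, ← neg_one_smul K, smul_dg]
    congr 1
    funext d
    rw [neg_mul (sg b), qInt_neg]; ring)
  generalize chev q n 1 b 0 = F at *
  generalize (dg q fun d => qe q (sg b * ends d)) = D at *
  have hDY' : ∀ v, D * (F * v) = F * (D * v) := fun v => by rw [← mul_assoc, hDY, mul_assoc]
  have hDX' : ∀ v, D * (X * v) = X * (D * v) := fun v => by rw [← mul_assoc, hDX, mul_assoc]
  have eE := congrArg (· * D) hE
  have eF := congrArg (· * (D * D * D)) hF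
  simp only [sub_mul, add_mul, smul_mul_assoc, zero_mul, mul_assoc] at eE eF
  subst hY
  constructor
  · simp only [mul_assoc, hDX]
    exact eE
  · simp only [mul_assoc, hDX, hDX', hDY']
    exact eF

/-- The commutator of the two affine root vectors. -/
theorem comm_affOp (hq : ∀ k : ℤ, k ≠ 0 → qInt q k ≠ 0) (hr : 0 < r) :
    (-qe q (-1)) ^ (r - 1) • (affOp q n r false * affOp q n r true
      - affOp q n r true * affOp q n r false) = dg q fun d => qInt q (ent 0 d - ent r d) := by
  have h := comm_tower_tower (n := n) hq (show r - 1 < r by omega)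
  rw [show r - 1 + 1 = r by omega] at h
  rw [← h, affOp, affOp]
  have h1 := dg_ends_mul_tower (q := q) (n := n) true hr (sg false)
  have h2 := dg_ends_mul_tower (q := q) (n := n) false hr (sg true)
  have hD : (dg (n := n) q fun d : Fin (r + 1) → ℤ => qe q (sg false * ends d)) *
      (dg q fun d => qe q (sg true * ends d)) = 1 := by
    rw [dg_mul_dg, ← dg_one]
    congr 1
    funext d
    rw [← qe_add, ← qe_zero (q := q)]
    congr 1
    simp [sg]
  have hD' := hD
  rw [dg_comm] at hD'
  generalize tower q (chev q n r true) 0 (r - 1) = X at *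
  generalize tower q (chev q n r false) 0 (r - 1) = Y at *
  generalize (dg q fun d => qe q (sg true * ends d)) = D at *
  generalize (dg q fun d => qe q (sg false * ends d)) = D' at *
  congr 2
  · rw [mul_assoc, ← mul_assoc D', h1, mul_assoc X, hD, mul_one]
  · rw [mul_assoc, ← mul_assoc D, h2, mul_assoc Y, hD', mul_one]

end Affine

/-! ### Representations of idempotented quantum groups -/

section Lift

variable {K : Type*} [Field K] {ι : Type} {R : Type*} [Ring R] [Algebra K R]

/-- Operators `e i`, `f i` and projections `p l` onto weight spaces that satisfy the relations of
the idempotented quantum group with Cartan matrix `A`. -/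
structure IsWeightRep (q : Kˣ) (A : ι → ι → ℤ) (e f : ι → R) (p : (ι → ℤ) → R) : Prop where
  proj_mul_self : ∀ l, p l * p l = p l
  proj_mul_of_ne : ∀ l l', l ≠ l' → p l * p l' = 0
  e_mul_proj : ∀ i l, e i * p l = p (l + simpleRoot A i) * e i
  f_mul_proj : ∀ i l, f i * p l = p (l - simpleRoot A i) * f i
  comm_self : ∀ i l, (e i * f i - f i * e i) * p l = qInt q (l i) • p l
  comm_of_ne : ∀ i j, i ≠ j → e i * f j = f j * e i
  commE : ∀ i j, A i j = 0 → e i * e j = e j * e i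
  commF : ∀ i j, A i j = 0 → f i * f j = f j * f i
  serreE : ∀ i j, A i j = -1 →
    e i * e i * e j - qInt q 2 • (e i * e j * e i) + e j * e i * e i = 0
  serreF : ∀ i j, A i j = -1 →
    f i * f i * f j - qInt q 2 • (f i * f j * f i) + f j * f i * f i = 0
  serreE' : ∀ i j, A i j = -2 → e i * e i * e i * e j - qInt q 3 • (e i * e i * e j * e i)
    + qInt q 3 • (e i * e j * e i * e i) - e j * e i * e i * e i = 0
  serreF' : ∀ i j, A i j = -2 → f i * f i * f i * f j - qInt q 3 • (f i * f i * f j * f i)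
    + qInt q 3 • (f i * f j * f i * f i) - f j * f i * f i * f i = 0

/-- The operator of a generator of an idempotented quantum group. -/
def genImage (e f : ι → R) (p : (ι → ℤ) → R) : DotGen ι → R
  | .one l => p l
  | .E i l => e i * p l
  | .F i l => f i * p l

namespace IsWeightRep

variable {q : Kˣ} {A : ι → ι → ℤ} {e f : ι → R} {p : (ι → ℤ) → R}

theorem lift_wordE (h : IsWeightRep q A e f p) (l : ι → ℤ) (w : List ι) :
    FreeAlgebra.lift K (genImage e f p) (wordE K A l w) = (w.map e).prod * p l := by
  have hw : ∀ w : List ι, (w.map e).prod * p l =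
      p (l + (w.map (simpleRoot A)).sum) * (w.map e).prod := by
    intro w
    induction w with
    | nil => simp
    | cons i w ih =>
      rw [List.map_cons, List.prod_cons, mul_assoc, ih, ← mul_assoc, h.e_mul_proj, mul_assoc,
        List.map_cons, List.sum_cons, add_assoc, add_comm (simpleRoot A i)]
  induction w with
  | nil => simp [wordE, genImage]
  | cons i w ih =>
    rw [wordE, map_mul, ih, FreeAlgebra.lift_ι_apply, genImage, hw, mul_assoc, ← mul_assoc (p _),
      h.proj_mul_self, ← hw, List.map_cons, List.prod_cons, mul_assoc]

theorem lift_wordF (h : IsWeightRep q A e f p) (l : ι → ℤ) (w : List ι) :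
    FreeAlgebra.lift K (genImage e f p) (wordF K A l w) = (w.map f).prod * p l := by
  have hw : ∀ w : List ι, (w.map f).prod * p l =
      p (l - (w.map (simpleRoot A)).sum) * (w.map f).prod := by
    intro w
    induction w with
    | nil => simp
    | cons i w ih =>
      rw [List.map_cons, List.prod_cons, mul_assoc, ih, ← mul_assoc, h.f_mul_proj, mul_assoc,
        List.map_cons, List.sum_cons, sub_sub, add_comm (simpleRoot A i)]
  induction w with
  | nil => simp [wordF, genImage]
  | cons i w ih =>
    rw [wordF, map_mul, ih, FreeAlgebra.lift_ι_apply, genImage, hw, mul_assoc, ← mul_assoc (p _),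
      h.proj_mul_self, ← hw, List.map_cons, List.prod_cons, mul_assoc]

theorem e_mul_proj_mul_f (h : IsWeightRep q A e f p) (i j : ι) (l : ι → ℤ) :
    e i * p (l - simpleRoot A j) * (f j * p l) = e i * f j * p l := by
  rw [mul_assoc, ← mul_assoc (p _), ← h.f_mul_proj, mul_assoc, h.proj_mul_self, mul_assoc]

theorem f_mul_proj_mul_e (h : IsWeightRep q A e f p) (i j : ι) (l : ι → ℤ) :
    f j * p (l + simpleRoot A i) * (e i * p l) = f j * e i * p l := by
  rw [mul_assoc, ← mul_assoc (p _), ← h.e_mul_proj, mul_assoc, h.proj_mul_self, mul_assoc]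

theorem lift_rel (h : IsWeightRep q A e f p) {x y : FreeAlgebra K (DotGen ι)}
    (hxy : DotRel q A x y) :
    FreeAlgebra.lift K (genImage e f p) x = FreeAlgebra.lift K (genImage e f p) y := by
  induction hxy with
  | one_mul_one l => simp [genImage, h.proj_mul_self]
  | one_mul_one_of_ne hl => simp [genImage, h.proj_mul_of_ne _ _ hl]
  | E_mul_one i l => simp [genImage, mul_assoc, h.proj_mul_self]
  | one_mul_E i l =>
    simp only [map_mul, FreeAlgebra.lift_ι_apply, genImage]
    rw [← mul_assoc, ← h.e_mul_proj, mul_assoc, h.proj_mul_self]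
  | F_mul_one i l => simp [genImage, mul_assoc, h.proj_mul_self]
  | one_mul_F i l =>
    simp only [map_mul, FreeAlgebra.lift_ι_apply, genImage]
    rw [← mul_assoc, ← h.f_mul_proj, mul_assoc, h.proj_mul_self]
  | commutator_self i l =>
    simp only [map_sub, map_smul, map_mul, FreeAlgebra.lift_ι_apply, genImage]
    rw [h.e_mul_proj_mul_f, h.f_mul_proj_mul_e, ← sub_mul, h.comm_self]
  | commutator_of_ne hij l =>
    simp only [map_sub, map_zero, map_mul, FreeAlgebra.lift_ι_apply, genImage]
    rw [h.e_mul_proj_mul_f, h.f_mul_proj_mul_e, ← sub_mul, h.comm_of_ne _ _ hij, sub_self,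
      zero_mul]
  | commE hij l =>
    rw [h.lift_wordE, h.lift_wordE]
    simp [h.commE _ _ hij]
  | commF hij l =>
    rw [h.lift_wordF, h.lift_wordF]
    simp [h.commF _ _ hij]
  | serreE hij l =>
    have := congrArg (· * p l) (h.serreE _ _ hij)
    simpa [h.lift_wordE, mul_assoc, add_mul, sub_mul] using this
  | serreF hij l =>
    have := congrArg (· * p l) (h.serreF _ _ hij)
    simpa [h.lift_wordF, mul_assoc, add_mul, sub_mul] using this
  | serreE' hij l =>
    have := congrArg (· * p l) (h.serreE' _ _ hij)
    simpa [h.lift_wordE, mul_assoc, add_mul, sub_mul] using this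
  | serreF' hij l =>
    have := congrArg (· * p l) (h.serreF' _ _ hij)
    simpa [h.lift_wordF, mul_assoc, add_mul, sub_mul] using this

/-- The representation of the idempotented quantum group. -/
def toHom (h : IsWeightRep q A e f p) : Dot q A →ₙₐ[K] R :=
  ((RingQuot.liftAlgHom K ⟨FreeAlgebra.lift K (genImage e f p), fun _ _ => h.lift_rel⟩ :
    RingQuot (DotRel q A) →ₐ[K] R) : RingQuot (DotRel q A) →ₙₐ[K] R).comp
      (NonUnitalSubalgebraClass.subtype (Dot q A))

theorem toHom_gen (h : IsWeightRep q A e f p) (g : DotGen ι) :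
    h.toHom (Dot.gen q A g) = genImage e f p g := by
  change RingQuot.liftAlgHom K _ (RingQuot.mkAlgHom K (DotRel q A) (FreeAlgebra.ι K g)) = _
  rw [RingQuot.liftAlgHom_mkAlgHom_apply, FreeAlgebra.lift_ι_apply]

end IsWeightRep

end Lift

section WeightSpaces

variable {K : Type*} [Field K] {q : Kˣ} {n r : ℕ} {ι : Type} [Fintype ι]

variable (q n) in
/-- The projection to the sum of the components whose multidegree has weight `l`, the weight being
given by `φ`. -/
def proj (φ : (Fin (r + 1) → ℤ) → ι → ℤ) (l : ι → ℤ) : Module.End K (QExt q n (r + 1)) :=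
  dg q fun d => if φ d = l then 1 else 0

theorem proj_mul_self (φ : (Fin (r + 1) → ℤ) → ι → ℤ) (l : ι → ℤ) :
    proj q n φ l * proj q n φ l = proj q n φ l := by
  rw [proj, dg_mul_dg]
  congr 1
  funext d
  split_ifs <;> simp

theorem proj_mul_of_ne (φ : (Fin (r + 1) → ℤ) → ι → ℤ) {l l' : ι → ℤ} (h : l ≠ l') :
    proj q n φ l * proj q n φ l' = 0 := by
  rw [proj, proj, dg_mul_dg, ← dg_zero]
  congr 1
  funext d
  split_ifs with h1 h2 <;> simp_all

theorem Shifts.mul_proj {A : Module.End K (QExt q n (r + 1))} {e} (h : Shifts A e)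
    {φ : (Fin (r + 1) → ℤ) → ι → ℤ} {α : ι → ℤ} (hφ : ∀ d, φ (d + e) = φ d + α) (l : ι → ℤ) :
    A * proj q n φ l = proj q n φ (l + α) * A := by
  rw [proj, proj, h]
  simp only [hφ, add_left_inj]

theorem dg_qInt_mul_proj (φ : (Fin (r + 1) → ℤ) → ι → ℤ) (i : ι) (l : ι → ℤ) :
    (dg q fun d => qInt q (φ d i)) * proj q n φ l = qInt q (l i) • proj q n φ l := by
  rw [proj, dg_mul_dg, smul_dg]
  congr 1
  funext d
  split_ifs with h
  · rw [h]
  · rw [mul_zero, mul_zero]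

end WeightSpaces

/-! ### The actions of quantum `sl_m` and of its affine version -/

section Actions

variable {K : Type*} [Field K] {q : Kˣ} {n r : ℕ}

theorem shifts_opE (i : Fin r) : Shifts (opE (n := n) q i) (mroot i) := fun f => dg_mul_opE f i

theorem shifts_opF (i : Fin r) : Shifts (opF (n := n) q i) (-mroot i) := fun f => by
  rw [dg_mul_opF]; simp only [sub_eq_add_neg]

theorem isWeightRep_sl (hq : ∀ k : ℤ, k ≠ 0 → qInt q k ≠ 0) :
    IsWeightRep q (cartanSl r) (opE (n := n) q) (opF q) (proj q n fun d i => wt i d) where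
  proj_mul_self := proj_mul_self _
  proj_mul_of_ne _ _ := proj_mul_of_ne _
  e_mul_proj i l := (shifts_opE i).mul_proj (α := simpleRoot (cartanSl r) i) (fun d => by
    funext j; exact (wt_add j d _).trans (by rw [wt_mroot]; rfl)) l
  f_mul_proj i l := by
    rw [sub_eq_add_neg]
    exact (shifts_opF i).mul_proj (α := -simpleRoot (cartanSl r) i) (fun d => by
      funext j
      rw [← sub_eq_add_neg]
      exact (wt_sub j d _).trans (by rw [wt_mroot]; exact sub_eq_add_neg _ _)) l
  comm_self i l := by
    have h := opE_opF_sub (n := n) hq i i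
    rw [if_pos rfl] at h
    rw [h]
    exact dg_qInt_mul_proj (fun d i => wt i d) i l
  comm_of_ne i j h := by
    rw [← sub_eq_zero, opE_opF_sub hq, if_neg h]
  commE := commE
  commF := commF
  serreE := serreE hq
  serreF := serreF hq
  serreE' i j h := by simp only [cartanSl] at h; split_ifs at h; omega
  serreF' i j h := by simp only [cartanSl] at h; split_ifs at h; omega

/-- The affine weight of a multidegree: the `0`-th entry is the difference of the first and the last
entry of the multidegree, which makes the sum of all entries zero. -/
def affDeg (d : Fin (r + 1) → ℤ) : Fin (r + 1) → ℤ := Fin.cons (ent 0 d - ent r d) fun i => wt i d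

theorem affDeg_add (d e : Fin (r + 1) → ℤ) : affDeg (d + e) = affDeg d + affDeg e := by
  funext j
  refine Fin.cases ?_ (fun i => ?_) j
  · simp only [affDeg, Pi.add_apply, Fin.cons_zero, ent_add]; ring
  · simp only [affDeg, Pi.add_apply, Fin.cons_succ, wt_add]

theorem affDeg_smul (c : ℤ) (d : Fin (r + 1) → ℤ) : affDeg (c • d) = c • affDeg d := by
  funext j
  refine Fin.cases ?_ (fun i => ?_) j
  · simp only [affDeg, Pi.smul_apply, Fin.cons_zero, ent_smul, smul_eq_mul]; ring
  · simp only [affDeg, Pi.smul_apply, Fin.cons_succ, wt, smul_eq_mul]; ring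

/-- The multidegree by which the `k`-th affine Chevalley operator shifts. -/
def affRoot (k : Fin (r + 1)) : Fin (r + 1) → ℤ :=
  Fin.cons (α := fun _ => Fin (r + 1) → ℤ) (unitDeg r 0 - unitDeg r r)
    (fun i : Fin r => unitDeg r (i + 1) - unitDeg r i) k

theorem affDeg_affRoot (hr : 0 < r) (k : Fin (r + 1)) :
    affDeg (affRoot k) = simpleRoot (cartanAff r) k := by
  funext j
  rw [simpleRoot]
  refine Fin.cases ?_ (fun j => ?_) j <;> refine Fin.cases ?_ (fun k => ?_) k
  · simp only [affDeg, affRoot, Fin.cons_zero, ent_sub]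
    rw [ent_unitDeg (by omega), ent_unitDeg (by omega), ent_unitDeg (by omega),
      ent_unitDeg (by omega), cartanAff]
    split_ifs <;> first | contradiction | omega
  · simp only [affDeg, affRoot, Fin.cons_zero, Fin.cons_succ, ent_sub]
    rw [ent_unitDeg (by omega), ent_unitDeg (by omega), ent_unitDeg (by omega),
      ent_unitDeg (by omega), cartanAff]
    simp only [Fin.ext_iff, Fin.val_add_one, Fin.val_zero, Fin.val_succ, Fin.val_last]
    split_ifs <;> first | contradiction | omega
  · simp only [affDeg, affRoot, Fin.cons_zero, Fin.cons_succ, wt, cartanAff, unitDeg, Pi.sub_apply,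
      Fin.ext_iff, Fin.val_add_one, Fin.val_zero, Fin.val_succ, Fin.val_last, Fin.val_castSucc]
    split_ifs <;> first | contradiction | omega
  · simp only [affDeg, affRoot, Fin.cons_succ, wt, cartanAff, unitDeg, Pi.sub_apply,
      Fin.ext_iff, Fin.val_add_one, Fin.val_succ, Fin.val_last, Fin.val_castSucc]
    split_ifs <;> first | contradiction | omega

theorem cartanAff_succ_succ (i j : Fin r) : cartanAff r i.succ j.succ = cartanSl r i j := by
  simp only [cartanAff, cartanSl, Fin.ext_iff, Fin.val_add_one, Fin.val_succ, Fin.val_last]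
  split_ifs <;> first | contradiction | omega

theorem cartanAff_comm (i j : Fin (r + 1)) : cartanAff r i j = cartanAff r j i := by
  rw [cartanAff, cartanAff, add_comm (ite (j = i + 1) _ _)]
  simp only [eq_comm (a := i) (b := j)]

theorem cartanAff_zero_succ (j : Fin r) : cartanAff r 0 j.succ =
    -((if (j : ℕ) = 0 then 1 else 0) + (if (j : ℕ) + 1 = r then 1 else 0)) := by
  simp only [cartanAff, Fin.ext_iff, Fin.val_add_one, Fin.val_zero, Fin.val_succ, Fin.val_last]
  split_ifs <;> first | contradiction | omega

variable (q n) in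
/-- The affine Chevalley operators, those at the affine node being scaled by `c`: for `b = true`
the images of `E_0, …, E_r`, for `b = false` those of `F_0, …, F_r`. As the affine root is the
negative of the highest one, the node `0` carries the affine root vector of the other half. -/
def affChev (c : Bool → K) (b : Bool) (k : Fin (r + 1)) : Module.End K (QExt q n (r + 1)) :=
  Fin.cons (α := fun _ => Module.End K (QExt q n (r + 1))) (c b • affOp q n r !b)
    (fun i : Fin r => chev q n r b i) k

variable (c : Bool → K)

theorem affChev_zero (b : Bool) : affChev (r := r) q n c b 0 = c b • affOp q n r !b := rfl

theorem affChev_succ (b : Bool) (i : Fin r) : affChev q n c b i.succ = chev q n r b i := rfl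

theorem shifts_affChev (hr : 0 < r) (b : Bool) (k : Fin (r + 1)) :
    Shifts (affChev q n c b k) (sg b • affRoot k) := by
  refine Fin.cases ?_ (fun i => ?_) k
  · have h := (shifts_affOp (q := q) (n := n) (!b) hr).smul (c b)
    rw [sg_not, neg_smul, ← smul_neg, neg_sub] at h
    exact h
  · exact shifts_chev b i

theorem affChev_mul_proj (hr : 0 < r) (b : Bool) (k : Fin (r + 1)) (l : Fin (r + 1) → ℤ) :
    affChev q n c b k * proj q n affDeg l =
      proj q n affDeg (l + sg b • simpleRoot (cartanAff r) k) * affChev q n c b k :=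
  (shifts_affChev c hr b k).mul_proj (fun d => by
    rw [affDeg_add, affDeg_smul, affDeg_affRoot hr]) l

theorem comm_chev (b : Bool) {i j : Fin r} (h : cartanSl r i j = 0) :
    chev q n r b i * chev q n r b j = chev q n r b j * chev q n r b i := by
  cases b
  · rw [chev_false, chev_false, commF _ _ h]
  · rw [chev_true, chev_true, commE _ _ h]

theorem serre_chev (hq : ∀ k : ℤ, k ≠ 0 → qInt q k ≠ 0) (b : Bool) {i j : Fin r}
    (h : cartanSl r i j = -1) :
    chev q n r b i * chev q n r b i * chev q n r b j
      - qInt q 2 • (chev q n r b i * chev q n r b j * chev q n r b i)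
      + chev q n r b j * chev q n r b i * chev q n r b i = 0 := by
  cases b
  · rw [chev_false, chev_false, serreF hq _ _ h]
  · rw [chev_true, chev_true, serreE hq _ _ h]

theorem comm_affChev (hq : ∀ k : ℤ, k ≠ 0 → qInt q k ≠ 0) (b : Bool) {i j : Fin (r + 1)}
    (h : cartanAff r i j = 0) :
    affChev q n c b i * affChev q n c b j = affChev q n c b j * affChev q n c b i := by
  have h0 : ∀ j : Fin r, cartanAff r 0 j.succ = 0 →
      Commute (chev q n r b j) (c b • affOp q n r !b) := fun j hj => by
    rw [cartanAff_zero_succ] at hj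
    have := commute_chev_not_affOp (q := q) (n := n) (r := r) hq (!b) (j := j)
      (by split_ifs at hj <;> omega) (by split_ifs at hj <;> omega)
    rw [Bool.not_not] at this
    exact this.smul_right _
  revert h
  refine Fin.cases (fun h => ?_) (fun i h => ?_) i
  · revert h
    refine Fin.cases (fun h => rfl) (fun j h => ?_) j
    exact (h0 j h).eq.symm
  · revert h
    refine Fin.cases (fun h => ?_) (fun j h => ?_) j
    · rw [cartanAff_comm] at h
      exact (h0 i h).eq
    · rw [cartanAff_succ_succ] at h
      exact comm_chev b h

theorem serre_affChev (hq : ∀ k : ℤ, k ≠ 0 → qInt q k ≠ 0) (b : Bool) {i j : Fin (r + 1)}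
    (h : cartanAff r i j = -1) :
    affChev q n c b i * affChev q n c b i * affChev q n c b j
      - qInt q 2 • (affChev q n c b i * affChev q n c b j * affChev q n c b i)
      + affChev q n c b j * affChev q n c b i * affChev q n c b i = 0 := by
  have h0 (j : Fin r) (h : cartanAff r 0 j.succ = -1) {X Y : Module.End K (QExt q n (r + 1))}
      (hX : X = chev q n r b j) (hY : Y = affOp q n r !b) :
      X * X * Y - qInt q 2 • (X * Y * X) + Y * X * X = 0 ∧
      Y * Y * X - qInt q 2 • (Y * X * Y) + X * Y * Y = 0 := by
    rw [cartanAff_zero_succ] at h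
    have hj : (j : ℕ) = 0 ∧ 1 < r ∨ 0 < (j : ℕ) ∧ (j : ℕ) + 1 = r := by
      split_ifs at h <;> omega
    subst hX hY
    rcases hj with ⟨h1, h2⟩ | ⟨h1, h2⟩
    · have := serre_affOp_first (q := q) (n := n) hq (!b) h2
      rw [Bool.not_not] at this
      rwa [h1]
    · have := serre_affOp_last (q := q) (n := n) hq (!b) h1 h2
      rwa [Bool.not_not] at this
  revert h
  refine Fin.cases (fun h => ?_) (fun i h => ?_) i
  · revert h
    refine Fin.cases (fun h => ?_) (fun j h => ?_) j
    · simp [cartanAff] at h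
    · have h := (h0 j h rfl rfl).2
      rw [affChev_zero, affChev_succ]
      generalize chev q n r b j = X at *
      generalize (affOp q n r !b) = Y at *
      have e : c b • Y * c b • Y * X - qInt q 2 • (c b • Y * X * c b • Y) + X * c b • Y * c b • Y =
          (c b * c b) • (Y * Y * X - qInt q 2 • (Y * X * Y) + X * Y * Y) := by
        simp only [mul_smul_comm, smul_mul_assoc]; module
      rw [e, h, smul_zero]
  · revert h
    refine Fin.cases (fun h => ?_) (fun j h => ?_) j
    · rw [cartanAff_comm] at h
      have h := (h0 i h rfl rfl).1
      rw [affChev_zero, affChev_succ]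
      generalize chev q n r b i = X at *
      generalize (affOp q n r !b) = Y at *
      have e : X * X * c b • Y - qInt q 2 • (X * c b • Y * X) + c b • Y * X * X =
          c b • (X * X * Y - qInt q 2 • (X * Y * X) + Y * X * X) := by
        simp only [mul_smul_comm, smul_mul_assoc]; module
      rw [e, h, smul_zero]
    · rw [cartanAff_succ_succ] at h
      exact serre_chev hq b h

theorem cubic_serre_affChev (hq : ∀ k : ℤ, k ≠ 0 → qInt q k ≠ 0) (b : Bool) {i j : Fin (r + 1)}
    (h : cartanAff r i j = -2) :
    affChev q n c b i * affChev q n c b i * affChev q n c b i * affChev q n c b j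
      - qInt q 3 • (affChev q n c b i * affChev q n c b i * affChev q n c b j * affChev q n c b i)
      + qInt q 3 • (affChev q n c b i * affChev q n c b j * affChev q n c b i * affChev q n c b i)
      - affChev q n c b j * affChev q n c b i * affChev q n c b i * affChev q n c b i = 0 := by
  have h0 (j : Fin r) (h : cartanAff r 0 j.succ = -2) {X Y : Module.End K (QExt q n (r + 1))}
      (hX : X = chev q n r b j) (hY : Y = affOp q n r !b) :
      X * X * X * Y - qInt q 3 • (X * X * Y * X) + qInt q 3 • (X * Y * X * X) - Y * X * X * X = 0 ∧
      Y * Y * Y * X - qInt q 3 • (Y * Y * X * Y) + qInt q 3 • (Y * X * Y * Y)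
        - X * Y * Y * Y = 0 := by
    rw [cartanAff_zero_succ] at h
    obtain ⟨h1, rfl⟩ : (j : ℕ) = 0 ∧ r = 1 := by split_ifs at h <;> omega
    rw [h1] at hX
    exact serre_affOp_one hq (!b) (by rw [hX, Bool.not_not]) hY
  revert h
  refine Fin.cases (fun h => ?_) (fun i h => ?_) i
  · revert h
    refine Fin.cases (fun h => ?_) (fun j h => ?_) j
    · simp [cartanAff] at h
    · have h := (h0 j h rfl rfl).2
      rw [affChev_zero, affChev_succ]
      generalize chev q n r b j = X at *
      generalize (affOp q n r !b) = Y at *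
      have e : c b • Y * c b • Y * c b • Y * X - qInt q 3 • (c b • Y * c b • Y * X * c b • Y)
          + qInt q 3 • (c b • Y * X * c b • Y * c b • Y) - X * c b • Y * c b • Y * c b • Y =
          (c b * c b * c b) • (Y * Y * Y * X - qInt q 3 • (Y * Y * X * Y)
            + qInt q 3 • (Y * X * Y * Y) - X * Y * Y * Y) := by
        simp only [mul_smul_comm, smul_mul_assoc]; module
      rw [e, h, smul_zero]
  · revert h
    refine Fin.cases (fun h => ?_) (fun j h => ?_) j
    · rw [cartanAff_comm] at h
      have h := (h0 i h rfl rfl).1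
      rw [affChev_zero, affChev_succ]
      generalize chev q n r b i = X at *
      generalize (affOp q n r !b) = Y at *
      have e : X * X * X * c b • Y - qInt q 3 • (X * X * c b • Y * X)
          + qInt q 3 • (X * c b • Y * X * X) - c b • Y * X * X * X =
          c b • (X * X * X * Y - qInt q 3 • (X * X * Y * X) + qInt q 3 • (X * Y * X * X)
            - Y * X * X * X) := by
        simp only [mul_smul_comm, smul_mul_assoc]; module
      rw [e, h, smul_zero]
    · rw [cartanAff_succ_succ] at h
      simp only [cartanSl] at h
      split_ifs at h; omega

theorem comm_of_ne_affChev (hq : ∀ k : ℤ, k ≠ 0 → qInt q k ≠ 0) {i j : Fin (r + 1)} (h : i ≠ j) :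
    affChev q n c true i * affChev q n c false j =
      affChev q n c false j * affChev q n c true i := by
  revert h
  refine Fin.cases (fun h => ?_) (fun i h => ?_) i
  · revert h
    refine Fin.cases (fun h => absurd rfl h) (fun j h => ?_) j
    exact ((commute_chev_affOp hq false j).smul_right _).eq.symm
  · revert h
    refine Fin.cases (fun h => ?_) (fun j h => ?_) j
    · exact ((commute_chev_affOp hq true i).smul_right _).eq
    · exact chev_cross hq true fun e => h (congrArg Fin.succ (Fin.ext e))

theorem comm_self_affChev (hq : ∀ k : ℤ, k ≠ 0 → qInt q k ≠ 0) (hr : 0 < r)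
    (hc : c true * c false = (-qe q (-1)) ^ (r - 1)) (k : Fin (r + 1)) :
    affChev q n c true k * affChev q n c false k - affChev q n c false k * affChev q n c true k =
      dg q fun d => qInt q (affDeg d k) := by
  refine Fin.cases ?_ (fun i => ?_) k
  · have h := comm_affOp (n := n) hq hr
    rw [← hc] at h
    refine Eq.trans ?_ h
    rw [affChev_zero, affChev_zero]
    simp only [Bool.not_true, Bool.not_false, mul_smul_comm, smul_mul_assoc]
    module
  · rw [affChev_succ, affChev_succ, chev_true, chev_false, opE_opF_sub hq, if_pos rfl]
    rfl

theorem isWeightRep_aff (hq : ∀ k : ℤ, k ≠ 0 → qInt q k ≠ 0) (hr : 0 < r)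
    (hc : c true * c false = (-qe q (-1)) ^ (r - 1)) :
    IsWeightRep q (cartanAff r) (affChev q n c true) (affChev q n c false)
      (proj q n affDeg) where
  proj_mul_self := proj_mul_self _
  proj_mul_of_ne _ _ := proj_mul_of_ne _
  e_mul_proj i l := by simpa [sg] using affChev_mul_proj c hr true i l
  f_mul_proj i l := by simpa [sg, sub_eq_add_neg] using affChev_mul_proj c hr false i l
  comm_self i l := by
    rw [comm_self_affChev c hq hr hc]
    exact dg_qInt_mul_proj _ i l
  comm_of_ne _ _ := comm_of_ne_affChev c hq
  commE _ _ := comm_affChev c hq true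
  commF _ _ := comm_affChev c hq false
  serreE _ _ := serre_affChev c hq true
  serreF _ _ := serre_affChev c hq false
  serreE' _ _ := cubic_serre_affChev c hq true
  serreF' _ _ := cubic_serre_affChev c hq false

end Actions

section EvalExtension

variable {K : Type*} [Field K] {q : Kˣ} {n s : ℕ}

theorem sum_affDeg {r : ℕ} (d : Fin (r + 1) → ℤ) : ∑ i, affDeg d i = 0 := by
  have h : ∑ i : Fin r, wt i d = ent r d - ent 0 d := by
    rw [← Finset.sum_range_sub (fun j => ent j d), Finset.sum_range]
    exact Finset.sum_congr rfl fun i _ => (wtN_val i d).symm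
  rw [Fin.sum_univ_succ]
  simp only [affDeg, Fin.cons_zero, Fin.cons_succ, h]
  ring

theorem affDeg_eq_affWt_iff {r : ℕ} (d : Fin (r + 1) → ℤ) (l : Fin r → ℤ) :
    affDeg d = affWt l ↔ (fun i => wt i d) = l := by
  constructor
  · intro h
    funext i
    simpa [affDeg, affWt] using congrFun h i.succ
  · rintro rfl
    have h := sum_affDeg d
    rw [Fin.sum_univ_succ] at h
    funext j
    refine Fin.cases ?_ (fun i => ?_) j
    · simp only [affDeg, Fin.cons_succ, affWt, Fin.cons_zero] at h ⊢
      linarith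
    · simp [affDeg, affWt]

theorem proj_affWt {r : ℕ} (l : Fin r → ℤ) : proj q n affDeg (affWt l) = wtProj q l := by
  rw [proj]
  simp only [affDeg_eq_affWt_iff]
  rfl

theorem proj_affDeg_eq_zero {r : ℕ} {l : Fin (r + 1) → ℤ} (h : ∑ i, l i ≠ 0) :
    proj q n affDeg l = 0 := by
  rw [proj, ← dg_zero]
  congr 1
  funext d
  rw [if_neg]
  rintro rfl
  exact h (sum_affDeg d)

/-- The scalars of `E_0` (for `true`) and `F_0` (for `false`) in terms of the affine root vectors;
the power of `-q⁻¹` is that of `ExtendsTowers.conjTower_opE`. -/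
def evalScalar (q : Kˣ) (s : ℕ) (c : K) : Bool → K
  | true => c
  | false => c⁻¹ * (-qe q (-1)) ^ s

theorem evalScalar_mul {c : K} (hc : c ≠ 0) :
    evalScalar q s c true * evalScalar q s c false = (-qe q (-1)) ^ (s + 1 - 1) := by
  rw [evalScalar, evalScalar, ← mul_assoc, mul_inv_cancel₀ hc, one_mul, Nat.add_sub_cancel]

/-- The skew Howe action. -/
def skewHowe (n r : ℕ) (hq : ∀ k : ℤ, k ≠ 0 → qInt q k ≠ 0) :
    Dot q (cartanSl r) →ₙₐ[K] Module.End K (QExt q n (r + 1)) := (isWeightRep_sl hq).toHom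

theorem isSkewHoweAction_skewHowe (n r : ℕ) (hq : ∀ k : ℤ, k ≠ 0 → qInt q k ≠ 0) :
    IsSkewHoweAction q (skewHowe n r hq) where
  one _ := (isWeightRep_sl hq).toHom_gen _
  E _ _ := (isWeightRep_sl hq).toHom_gen _
  F _ _ := (isWeightRep_sl hq).toHom_gen _

/-- The extension of the skew Howe action to the quantum affine algebra. -/
def evalAction (n s : ℕ) (hq : ∀ k : ℤ, k ≠ 0 → qInt q k ≠ 0) {c : K} (hc : c ≠ 0) :
    Dot q (cartanAff (s + 1)) →ₙₐ[K] Module.End K (QExt q n (s + 1 + 1)) :=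
  (isWeightRep_aff (evalScalar q s c) hq s.succ_pos (evalScalar_mul hc)).toHom

theorem evalAction_gen (hq : ∀ k : ℤ, k ≠ 0 → qInt q k ≠ 0) {c : K} (hc : c ≠ 0)
    (g : DotGen (Fin (s + 1 + 1))) : evalAction n s hq hc (Dot.gen q _ g) =
      genImage (affChev q n (evalScalar q s c) true) (affChev q n (evalScalar q s c) false)
        (proj q n affDeg) g :=
  (isWeightRep_aff (evalScalar q s c) hq s.succ_pos (evalScalar_mul hc)).toHom_gen g

theorem isEvalExtension_evalAction (hq : ∀ k : ℤ, k ≠ 0 → qInt q k ≠ 0) {c : K} (hc : c ≠ 0)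
    {T : Fin (s + 1) → Module.End K (QExt q n (s + 1 + 1))} (hT : ExtendsTowers T) :
    IsEvalExtension q c T (skewHowe n (s + 1) hq) (evalAction n s hq hc) where
  one l := by
    rw [evalAction_gen, (isSkewHoweAction_skewHowe n _ hq).one]
    exact proj_affWt l
  one_eq_zero l hl := by
    rw [evalAction_gen]
    exact proj_affDeg_eq_zero hl
  E i l := by
    rw [evalAction_gen, (isSkewHoweAction_skewHowe n _ hq).E, genImage, proj_affWt, affChev_succ,
      chev_true]
  F i l := by
    rw [evalAction_gen, (isSkewHoweAction_skewHowe n _ hq).F, genImage, proj_affWt, affChev_succ,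
      chev_false]
  E_zero l := by
    rw [evalAction_gen, evalAction_gen, hT.conjTower_opF, endsOp_eq, genImage, genImage,
      affChev_zero, smul_mul_assoc]
    rfl
  F_zero l := by
    rw [evalAction_gen, evalAction_gen, hT.conjTower_opE, endsOp_eq, genImage, genImage,
      affChev_zero, smul_mul_assoc, smul_mul_assoc, smul_mul_assoc, smul_smul]
    rfl

end EvalExtension

/-! ### The integral form -/

section IntegralForm

variable {n m r : ℕ}

/-- The operator `M` preserves the form over `ℂ[q, q⁻¹]`. -/
def IsIntegral (M : Module.End (RatFunc ℂ) (QExt qq n m)) : Prop :=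
  ∀ x ∈ lattice n m, M x ∈ lattice n m

theorem smul_mem_lattice {c : RatFunc ℂ} (hc : c ∈ laurent) {x : QExt qq n m}
    (hx : x ∈ lattice n m) : c • x ∈ lattice n m :=
  (lattice n m).smul_mem hx (⟨c, hc⟩ : laurent)

theorem z_mem_lattice (i : Fin n) (j : Fin m) : z qq i j ∈ lattice n m :=
  Algebra.subset_adjoin ⟨(i, j), rfl⟩

theorem mon_mem_lattice (l : List (Fin n × Fin m)) : mon qq l ∈ lattice n m := by
  induction l with
  | nil => exact one_mem _
  | cons p l ih => rw [mon_cons]; exact mul_mem (z_mem_lattice _ _) ih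

theorem isIntegral_of_mon {M : Module.End (RatFunc ℂ) (QExt qq n m)}
    (h : ∀ l, M (mon qq l) ∈ lattice n m) : IsIntegral M := by
  intro x hx
  rw [lattice, ← Subalgebra.mem_toSubmodule, Algebra.adjoin_eq_span] at hx
  induction hx using Submodule.span_induction with
  | mem x hx =>
    obtain ⟨l, rfl⟩ : ∃ l, mon qq l = x := by
      induction hx using Submonoid.closure_induction with
      | mem x hx =>
        obtain ⟨p, rfl⟩ := hx
        exact ⟨[p], by simp⟩
      | one => exact ⟨[], rfl⟩
      | mul x y _ _ hx hy =>
        obtain ⟨l, rfl⟩ := hx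
        obtain ⟨l', rfl⟩ := hy
        exact ⟨l ++ l', mon_append qq l l'⟩
    exact h l
  | zero => rw [map_zero]; exact zero_mem _
  | add x y _ _ hx hy => rw [map_add]; exact add_mem hx hy
  | smul c x _ hx =>
    have : M (c • x) = (c : RatFunc ℂ) • M x := M.map_smul (c : RatFunc ℂ) x
    rw [this]
    exact smul_mem_lattice c.2 hx

namespace IsIntegral

variable {M N : Module.End (RatFunc ℂ) (QExt qq n m)}

theorem mul (hM : IsIntegral M) (hN : IsIntegral N) : IsIntegral (M * N) :=
  fun x hx => hM _ (hN x hx)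

theorem sub (hM : IsIntegral M) (hN : IsIntegral N) : IsIntegral (M - N) :=
  fun x hx => sub_mem (hM x hx) (hN x hx)

theorem smul (hM : IsIntegral M) {c : RatFunc ℂ} (hc : c ∈ laurent) : IsIntegral (c • M) :=
  fun x hx => smul_mem_lattice hc (hM x hx)

end IsIntegral

theorem qe_mem_laurent (k : ℤ) : qe qq k ∈ laurent := by
  rw [qe_eq_zpow, qq, Units.val_mk0]
  have h1 : RatFunc.X ∈ laurent := Algebra.subset_adjoin (by simp)
  have h2 : RatFunc.X⁻¹ ∈ laurent := Algebra.subset_adjoin (by simp)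
  obtain ⟨k, rfl | rfl⟩ := k.eq_nat_or_neg
  · rw [zpow_natCast]; exact pow_mem h1 k
  · rw [zpow_neg, zpow_natCast, ← inv_pow]; exact pow_mem h2 k

theorem C_mem_laurent (c : ℂ) : RatFunc.C c ∈ laurent := by
  rw [← RatFunc.algebraMap_eq_C]; exact laurent.algebraMap_mem c

theorem isIntegral_dg {f : (Fin m → ℤ) → RatFunc ℂ} (hf : ∀ d, f d ∈ laurent) :
    IsIntegral (dg (n := n) qq f) := isIntegral_of_mon fun l => by
  rw [dg_mon]; exact smul_mem_lattice (hf _) (mon_mem_lattice l)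

theorem isIntegral_proj {ι : Type} [Fintype ι] (φ : (Fin (r + 1) → ℤ) → ι → ℤ) (l : ι → ℤ) :
    IsIntegral (proj qq n φ l) := isIntegral_dg fun d => by
  split_ifs
  · exact one_mem _
  · exact zero_mem _

theorem isIntegral_opK (i : Fin r) (c : ℤ) : IsIntegral (opK (n := n) qq i c) :=
  isIntegral_dg fun _ => qe_mem_laurent _

theorem isIntegral_opE (i : Fin r) : IsIntegral (opE (n := n) qq i) := isIntegral_of_mon fun l => by
  induction l with
  | nil => rw [mon_nil, opE_one]; exact zero_mem _
  | cons p l ih =>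
    rw [mon_cons, opE_mul]
    refine add_mem (mul_mem (z_mem_lattice _ _) ih)
      (mul_mem ?_ (isIntegral_opK i 1 _ (mon_mem_lattice l)))
    rw [opE_z, eZ]
    split_ifs
    · exact z_mem_lattice _ _
    · exact zero_mem _

theorem isIntegral_opF (i : Fin r) : IsIntegral (opF (n := n) qq i) := isIntegral_of_mon fun l => by
  induction l with
  | nil => rw [mon_nil, opF_one]; exact zero_mem _
  | cons p l ih =>
    rw [mon_cons, opF_mul]
    refine add_mem (mul_mem (isIntegral_opK i (-1) _ (z_mem_lattice _ _)) ih)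
      (mul_mem ?_ (mon_mem_lattice l))
    rw [opF_z, fZ]
    split_ifs
    · exact z_mem_lattice _ _
    · exact zero_mem _

theorem isIntegral_chev (b : Bool) (j : ℕ) : IsIntegral (chev qq n r b j) := by
  unfold chev
  split_ifs
  · exact isIntegral_opE _
  · exact isIntegral_opF _
  · exact fun x _ => zero_mem _

theorem isIntegral_tower (b : Bool) (a k : ℕ) : IsIntegral (tower qq (chev qq n r b) a k) := by
  induction k with
  | zero => exact isIntegral_chev b a
  | succ k ih =>
    have h := isIntegral_chev (n := n) (r := r) b (a + k + 1)
    exact (ih.mul h).sub ((h.mul ih).smul (qe_mem_laurent 1))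

theorem isIntegral_affChev {c : Bool → RatFunc ℂ} {b : Bool} (hc : c b ∈ laurent)
    (k : Fin (r + 1)) : IsIntegral (affChev qq n c b k) := by
  refine Fin.cases ?_ (fun i => isIntegral_chev b i) k
  exact ((isIntegral_tower _ _ _).mul (isIntegral_dg fun _ => qe_mem_laurent _)).smul hc

theorem qInt_qq_ne_zero (k : ℤ) (hk : k ≠ 0) : qInt qq k ≠ 0 := by
  have hX : ∀ k : ℕ, k ≠ 0 → (RatFunc.X : RatFunc ℂ) ^ k ≠ 1 := by
    intro k hk h
    rw [← RatFunc.algebraMap_X, ← map_pow, ← map_one (algebraMap (Polynomial ℂ) (RatFunc ℂ))] at h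
    have h' := congrArg Polynomial.natDegree (RatFunc.algebraMap_injective ℂ h)
    simp [hk] at h'
  have hne : ∀ k : ℕ, k ≠ 0 → qe qq k - qe qq (-k) ≠ 0 := by
    intro k hk h
    have h2 := qe_mul_neg qq k
    rw [← sub_eq_zero.1 h, qe_eq_zpow, qq, Units.val_mk0, zpow_natCast, ← pow_add] at h2
    exact hX _ (by omega) h2
  have hpos : ∀ k : ℕ, k ≠ 0 → qInt qq k ≠ 0 := fun k hk => by
    rw [qInt_def]
    exact div_ne_zero (hne k hk) (hne 1 one_ne_zero)
  obtain ⟨k, rfl | rfl⟩ := k.eq_nat_or_neg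
  · exact hpos k (by omega)
  · rw [qInt_neg, neg_ne_zero]; exact hpos k (by omega)

end IntegralForm

theorem preservesLattice_skewHowe (n r : ℕ) : PreservesLattice (skewHowe n r qInt_qq_ne_zero) := by
  intro g
  have h := (isWeightRep_sl (n := n) (r := r) qInt_qq_ne_zero).toHom_gen g
  change IsIntegral (skewHowe n r qInt_qq_ne_zero (Dot.gen qq _ g))
  rw [skewHowe, h]
  cases g with
  | one l => exact isIntegral_proj _ l
  | E i l => exact (isIntegral_opE i).mul (isIntegral_proj _ l)
  | F i l => exact (isIntegral_opF i).mul (isIntegral_proj _ l)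

theorem preservesLattice_evalAction (n s : ℕ) {a : ℂ} (hc : RatFunc.C a ≠ 0) :
    PreservesLattice (evalAction n s qInt_qq_ne_zero hc) := by
  intro g
  change IsIntegral (evalAction n s qInt_qq_ne_zero hc (Dot.gen qq _ g))
  rw [evalAction_gen]
  cases g with
  | one l => exact isIntegral_proj _ l
  | E i l => exact (isIntegral_affChev (C_mem_laurent a) i).mul (isIntegral_proj _ l)
  | F i l =>
    refine (isIntegral_affChev ?_ i).mul (isIntegral_proj _ l)
    rw [evalScalar, ← map_inv₀]
    exact mul_mem (C_mem_laurent _) (pow_mem (neg_mem (qe_mem_laurent _)) s)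

end SkewHowe

end

open SkewHowe in
theorem mainTheorem3 (n s : ℕ) (a : ℂ) (ha : a ≠ 0) :
    (∀ i : Fin (s + 1), IsUnit (braid (n := n) qq i)) ∧
    (∀ i : Fin (s + 1), IsUnit (braidGl (n := n) qq i)) ∧
    ∃ π : Dot qq (cartanSl (s + 1)) →ₙₐ[RatFunc ℂ]
        Module.End (RatFunc ℂ) (QExt qq n (s + 1 + 1)),
      IsSkewHoweAction qq π ∧ PreservesLattice π ∧
      (∃ ρ : Dot qq (cartanAff (s + 1)) →ₙₐ[RatFunc ℂ]
          Module.End (RatFunc ℂ) (QExt qq n (s + 1 + 1)),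
        IsEvalExtension qq (RatFunc.C a) (braid qq) π ρ ∧ PreservesLattice ρ) ∧
      (∃ ρ : Dot qq (cartanAff (s + 1)) →ₙₐ[RatFunc ℂ]
          Module.End (RatFunc ℂ) (QExt qq n (s + 1 + 1)),
        IsEvalExtension qq (RatFunc.C a) (braidGl qq) π ρ ∧ PreservesLattice ρ) := by
  have hq := qInt_qq_ne_zero
  have hc : RatFunc.C a ≠ 0 := (map_ne_zero _).2 ha
  exact ⟨isUnit_braid hq, isUnit_braidGl hq, skewHowe n (s + 1) hq,
    isSkewHoweAction_skewHowe n (s + 1) hq, preservesLattice_skewHowe n (s + 1),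
    ⟨evalAction n s hq hc, isEvalExtension_evalAction hq hc (extendsTowers_braid hq),
      preservesLattice_evalAction n s hc⟩,
    ⟨evalAction n s hq hc, isEvalExtension_evalAction hq hc (extendsTowers_braidGl hq),
      preservesLattice_evalAction n s hc⟩⟩
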